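/- Let $x^2\,dY/dx=A(x)Y$ be a linear differential system of dimension $n$ with $A\in M_n(\mathbb C\{x\})$, with a formal fundamental solution $\widetilde F(x)\,x^Le^{Q(1/x)}$, where $\widetilde F\in M_n(\mathbb C[[x]])$, $\widetilde F(0)=I_n$, $L=\bigoplus_{j=1}^J(\lambda_jI_{n_j}+J_{n_j})$ ($J_{n}$ is the nilpotent Jordan block of size $n\ge1$, with ones just above the diagonal) and $Q(1/x)=\bigoplus_{j=1}^J(-a_j/x)I_{n_j}$. Assume $0\le\operatorname{Re}\lambda_j<1$ for all $j$, $a_1=\lambda_1=0$, and that the $a_j$ are not all equal. Put $\Omega=\{a_1,\dots,a_J\}$, $A_0(x)=\bigoplus_j\big(a_jI_{n_j}+x(\lambda_jI_{n_j}+J_{n_j})\big)$ and $B=A-A_0$. Let $I_{n,n_1}$ be the matrix of the first $n_1$ columns of $I_n$, and let $\widetilde f(x,\alpha)=\sum_{m\ge0}\widetilde f_m(x)\alpha^m$ be the solution, with $\widetilde f_0=I_{n,n_1}$ and $\widetilde f_m\in x\,\mathbb C[[x]]$ (entrywise) for $m\ge1$, of the perturbed system $$x^2\frac{d\widetilde f}{dx}-A_0(x)\widetilde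 f+x\widetilde fJ_{n_1}=\alpha B(x)\widetilde f ,$$ which exists and is unique. For $m\ge1$ let $\varphi_m$ be the Borel transform of $\widetilde f_m$ (defined by $x^s\mapsto\xi^{s-1}/(s-1)!$ for $s\ge1$). Let $m\ge1$ and $\omega\in\Omega$, and let $\gamma$ be a path which starts at $0$, lies in $\mathbb C\setminus\Omega$ except for its starting point, and ends at a point $\xi_0$ of an open disc $D$ centred at $\omega$ with $D\cap\Omega=\{\omega\}$. Then $\varphi_m$ converges near $0$ and has an analytic continuation $\mathrm{cont}_\gamma\varphi_m$ along $\gamma$. For each determination of $\ln(\xi_0-\omega)$, this continuation extends analytically from $\xi_0$ to the Riemann surface of the logarithm over $D\setminus\{\omega\}$, and its singularity at $\omega$ has a major (that is, a function that differs from $\mathrm{cont}_\gamma\varphi_m(\omega+\xi)$, near $\xi=0$ on this Riemann surface, by a function holomorphic at $\xi=0$) whose row-blocks, of size $n_j\times n_1$, are $$\check\varphi_m^{j;\bullet}(\omega+\xi)=\xi^{\lambda_j-1}\,\xi^{J_{n_j}}\,k_{m;(\omega)}^{j;\bullet}\,\xi^{-J_{n_1}}+\sum_{k\,:\,a_k=\omega}\xi^{\lambda_k}R_{\lambda_k,m}^{j;\bullet}(\ln\xi)\qquad(j=1,\dots,J).$$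 Here - $k_{m;(\omega)}^{j;\bullet}$ is a constant $n_j\times n_1$ matrix, and $k_{m;(\omega)}^{j;\bullet}=0$ when $a_j\ne\omega$; - $R_{\lambda_k,m}^{j;\bullet}(X)$ is an $n_j\times n_1$ matrix of polynomials in $X$ whose coefficients are functions of $\xi$ holomorphic at $0$, and whose columns $1,\dots,n_1$ have degrees at most $N[k]$, where $$N[k]=\begin{cases}[\,n_k-1,\ n_k,\ \dots,\ n_k-1+(n_1-1)\,]&\text{if }\lambda_k\neq0,\\ [\,n_k,\ n_k+1,\ \dots,\ n_k+(n_1-1)\,]&\text{if }\lambda_k=0.\end{cases}$$ The matrices $k$ and $R$ may depend on $\gamma$ and on the determination of the logarithm. -/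

import Mathlib

open scoped PowerSeries Topology

noncomputable section

namespace LevelOne

/-- The irreducible nilpotent Jordan block `J_n`: ones just above the diagonal. -/
def jordanBlock (n : ℕ) : Matrix (Fin n) (Fin n) ℂ :=
  Matrix.of fun i j => if (i : ℕ) + 1 = (j : ℕ) then 1 else 0

/-- A power series belongs to `ℂ{x}`: it converges (absolutely) at some positive radius. -/
def IsConvergent (f : ℂ⟦X⟧) : Prop :=
  ∃ r : ℝ, 0 < r ∧ Summable fun s : ℕ => ‖PowerSeries.coeff s f‖ * r ^ s

/-- A constant matrix, viewed as a matrix of power series. -/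
def constMat {m n : Type*} (M : Matrix m n ℂ) : Matrix m n ℂ⟦X⟧ :=
  M.map (PowerSeries.C (R := ℂ))

/-- The operator `x² d/dx`, entrywise on matrices of formal power series. -/
def eulerTwo {m n : Type*} (M : Matrix m n ℂ⟦X⟧) : Matrix m n ℂ⟦X⟧ :=
  M.map fun f => PowerSeries.X ^ 2 * PowerSeries.derivative ℂ f

/-- The block-diagonal coefficient matrix `A₀(x) = ⨁ⱼ aⱼ I + x (λⱼ I + J)` of the normal form, whose
normal solution is `x^L e^{Q(1/x)}` with `L = ⨁ⱼ (λⱼ I + J)` and `Q(1/x) = ⨁ⱼ (-aⱼ/x) I`. -/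
def normalForm {J : ℕ} (size : Fin J → ℕ) (a lam : Fin J → ℂ) :
    Matrix (Σ j, Fin (size j)) (Σ j, Fin (size j)) ℂ⟦X⟧ :=
  constMat (Matrix.blockDiagonal' fun j => a j • (1 : Matrix (Fin (size j)) (Fin (size j)) ℂ)) +
    (PowerSeries.X : ℂ⟦X⟧) • constMat (Matrix.blockDiagonal' fun j =>
      lam j • (1 : Matrix (Fin (size j)) (Fin (size j)) ℂ) + jordanBlock (size j))

/-- A prepared linear differential system `x² dY/dx = A(x) Y` with single level one, with formal
fundamental solution `F(x) x^L e^{Q(1/x)}`. The `J` Jordan blocks are numbered from `0`. -/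
structure PreparedSystem (J : ℕ) [NeZero J] where
  /-- sizes of the Jordan blocks of `L` -/
  size : Fin J → ℕ
  size_pos : ∀ j, 0 < size j
  /-- the Stokes values: `qⱼ(1/x) = -aⱼ/x` -/
  a : Fin J → ℂ
  /-- the exponents of formal monodromy -/
  lam : Fin J → ℂ
  /-- the coefficient matrix -/
  A : Matrix (Σ j, Fin (size j)) (Σ j, Fin (size j)) ℂ⟦X⟧
  /-- the formal gauge transformation -/
  F : Matrix (Σ j, Fin (size j)) (Σ j, Fin (size j)) ℂ⟦X⟧
  A_convergent : ∀ x y, IsConvergent (A x y)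
  F_zero : F.map (PowerSeries.constantCoeff (R := ℂ)) = 1
  /-- `Y = F x^L e^{Q(1/x)}` is a formal solution of `x² dY/dx = A Y` -/
  F_eq : eulerTwo F + F * normalForm size a lam = A * F
  a_zero : a 0 = 0
  lam_zero : lam 0 = 0
  lam_re : ∀ j, 0 ≤ (lam j).re ∧ (lam j).re < 1
  /-- the `aⱼ` are not all equal (and one of them is `0`): the level one does occur -/
  level_one : ∃ j, a j ≠ 0

namespace PreparedSystem

variable {J : ℕ} [NeZero J]

/-- Row (and column) indices of the system: pairs (block, position in the block). -/
abbrev Idx (S : PreparedSystem J) : Type := Σ j, Fin (S.size j)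

/-- Indices of the first column-block. -/
abbrev Col (S : PreparedSystem J) : Type := Fin (S.size 0)

/-- The set `Ω` of Stokes values. -/
def Omega (S : PreparedSystem J) : Set ℂ := Set.range S.a

/-- `A₀(x)` -/
def A0 (S : PreparedSystem J) : Matrix S.Idx S.Idx ℂ⟦X⟧ := normalForm S.size S.a S.lam

/-- `B(x) = A(x) - A₀(x)` -/
def B (S : PreparedSystem J) : Matrix S.Idx S.Idx ℂ⟦X⟧ := S.A - S.A0

/-- The identity matrix truncated at its first `n₁` columns. -/
def truncId (S : PreparedSystem J) : Matrix S.Idx S.Col ℂ⟦X⟧ :=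
  (1 : Matrix S.Idx S.Idx ℂ⟦X⟧).submatrix id fun q => ⟨0, q⟩

/-- `f(x, α) = ∑ₘ fₘ(x) αᵐ`, with `f₀ = I_{n,n₁}` and `fₘ ∈ x ℂ[[x]]` for `m ≥ 1`, solves the
perturbed system `x² df/dx - A₀ f + x f J_{n₁} = α B f`; equality of the coefficients of `αᵐ`. -/
structure IsPerturbativeExpansion (S : PreparedSystem J)
    (f : ℕ → Matrix S.Idx S.Col ℂ⟦X⟧) : Prop where
  zero : f 0 = S.truncId
  constantCoeff_eq_zero : ∀ m, 1 ≤ m → ∀ x q, PowerSeries.constantCoeff (f m x q) = 0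
  order_zero : eulerTwo (f 0) - S.A0 * f 0 +
      (PowerSeries.X : ℂ⟦X⟧) • (f 0 * constMat (jordanBlock (S.size 0))) = 0
  order_succ : ∀ m, eulerTwo (f (m + 1)) - S.A0 * f (m + 1) +
      (PowerSeries.X : ℂ⟦X⟧) • (f (m + 1) * constMat (jordanBlock (S.size 0))) = S.B * f m

/-- The log-degree `N[k]` of column `q` (columns are numbered from `0`). -/
def logDegree (S : PreparedSystem J) (k : Fin J) (q : S.Col) : ℕ :=
  if S.lam k ≠ 0 then (S.size k - 1) + q else S.size k + q

/-- `ξ^{λⱼ-1} ξ^{J_{nⱼ}} K ξ^{-J_{n₁}}` in the logarithmic coordinate `u = ln ξ`. -/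
def leadingTerm (S : PreparedSystem J) (j : Fin J) (K : Matrix (Fin (S.size j)) S.Col ℂ)
    (u : ℂ) : Matrix (Fin (S.size j)) S.Col ℂ :=
  Complex.exp ((S.lam j - 1) * u) •
    (NormedSpace.exp (u • jordanBlock (S.size j)) * K *
      NormedSpace.exp ((-u) • jordanBlock (S.size 0)))

open Classical in
/-- The entry at row `x` and column `q` of `∑_{k | a_k = ω} ξ^{λ_k} R_k(ln ξ)` in the coordinate
`u = ln ξ`. The entry of `R_k(X)` is the polynomial `∑ₚ c k x q p · Xᵖ`, `0 ≤ p ≤ N[k]_q`, whose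
coefficients `c k x q p` are functions of `ξ`. -/
def remainder (S : PreparedSystem J) (ω : ℂ) (c : Fin J → S.Idx → S.Col → ℕ → ℂ → ℂ)
    (x : S.Idx) (q : S.Col) (u : ℂ) : ℂ :=
  ∑ k with S.a k = ω, Complex.exp (S.lam k * u) *
    ∑ p ∈ Finset.range (S.logDegree k q + 1), c k x q p (Complex.exp u) * u ^ p

end PreparedSystem

/-- The formal Borel transform (of a series without constant term):
`x^s ↦ ξ^{s-1} / (s-1)!` for `s ≥ 1`. -/
def borel (f : ℂ⟦X⟧) : ℂ⟦X⟧ :=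
  PowerSeries.mk fun s => PowerSeries.coeff (s + 1) f / (s.factorial : ℂ)

/-- `g t` represents, for each `t`, the germ at `γ t` of the analytic continuation along `γ` of
the germ at `0` which is the sum of the power series `φ`. -/
structure IsContinuationAlong {ξ : ℂ} (γ : Path (0 : ℂ) ξ) (φ : ℂ⟦X⟧)
    (g : unitInterval → ℂ → ℂ) : Prop where
  start : ∀ᶠ z in 𝓝 (0 : ℂ), HasSum (fun s : ℕ => PowerSeries.coeff s φ * z ^ s) (g 0 z)
  analyticAt : ∀ t, AnalyticAt ℂ (g t) (γ t)
  locally_eq : ∀ t, ∀ᶠ s in 𝓝 t, g s =ᶠ[𝓝 (γ s)] g t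

/-- `M` is a major of the singularity at `ξ = 0` of `G`. Functions on the Riemann surface of the
logarithm near `0` are written in the coordinate `u = ln ξ`, on some half-plane `|exp u| < ρ`;
`M` is a major when `G - M` is (the pull-back of) a holomorphic germ at `0`. -/
def IsMajor (G M : ℂ → ℂ) : Prop :=
  ∃ h : ℂ → ℂ, AnalyticAt ℂ h 0 ∧ ∃ ρ : ℝ, 0 < ρ ∧
    ∀ u : ℂ, ‖Complex.exp u‖ < ρ → G u = M u + h (Complex.exp u)

end LevelOne

end

noncomputable section

namespace LevelOne

open Set Filter MeasureTheory Metric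

/-! The Borel transform turns `x² d/dx` into multiplication by `ξ` and products into convolutions.
Entry by entry, and after one differentiation, the equation of order `m` becomes `(ξ - a) φ' + (1 -
λ) φ = Ψ' + N φ`. Here `N`, the matrix of `f ↦ J f - f J₁`, is strictly triangular. The source `Ψ`
is entire at order one; afterwards it is a sum of convolutions of the functions of the preceding
order with entire functions `β`, the Borel transforms of the entries of `B`. `ConvSystem` abstracts
this structure. Recurrences for the Taylor coefficients give convergence near `0`
(`FormalEq.geomBound`, `isSol_seqSum`).

The only singular points are the values `a`. On a convex open set avoiding them the equations are
solved order by order, by quadratures (`IsSol.extend`). Moving the base point of the convolutions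
changes the source by an entire function only (`IsSol.rebase`), so the system keeps its form along a
path, which gives `IsSol.continuation`. In the coordinate `u = ln (ξ - ω)` the punctured disc
becomes a half-plane, which is convex and free of singular points; one more extension covers the
Riemann surface of the logarithm.

The singularity is found by induction on the order (`IsSol.exists_isDecomposition`), writing each
unknown as `R + h`. The term `R` lies in `LogClass`: sums of powers of `ξ` times polynomials in `ln
ξ` with holomorphic coefficients. The term `h` lives on the entries with `a = ω` and solves the
constant-coefficient system `h' = (λ - 1) h + N h` in `u`; `exists_leadingTerm` identifies it with
`ξ^{λ-1} ξ^J k ξ^{-J₁}`.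

The induction closes without the degrees in `ln ξ` growing with the order. Convolution with an
entire function maps the class into `ξ · class + holomorphic` (`LogClass.conv`). For `h`,
integration by parts gives `β * h = β(0) ℓ + β' * ℓ + holomorphic`, where `ℓ` is a primitive of `h`
in `ξ` (`LogClass.conv_deriv`); `ℓ` is in the class, with one more logarithm exactly when `λ = 0`,
hence the two cases of `N[k]`. Since `β(0) = 0` between entries with equal `a` (`coeff_one_B`), the
source of a singular entry is in `ξ · class + holomorphic`, and its equation can be divided by `ξ`.
The result is free of resonance because `Re (1 - λ + μ) > 0` for every exponent `μ`
(`LogClass.solve`). The entries with `a ≠ ω` satisfy equations that are regular at `ω`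
(`Compatible.logClass_of_ne`). -/

/-! ### Integrals depending holomorphically on a parameter. -/

/-- Holomorphic dependence of an integral on a parameter. -/
theorem hasDerivAt_integral_of_locally_dominated {α : Type*} [MeasurableSpace α] {μ : Measure α}
    {U : Set ℂ} (hU : IsOpen U) {F : ℂ → α → ℂ}
    (hmeas : ∀ z ∈ U, AEStronglyMeasurable (F z) μ)
    (hd : ∀ᵐ a ∂μ, DifferentiableOn ℂ (fun z => F z a) U) {z : ℂ} (hz : z ∈ U)
    (hb : ∃ ε > 0, ∃ bound : α → ℝ, Integrable bound μ ∧
      ∀ᵐ a ∂μ, ∀ z' ∈ ball z ε, ‖F z' a‖ ≤ bound a) :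
    Integrable (fun a => deriv (fun z => F z a) z) μ ∧
      HasDerivAt (fun z => ∫ a, F z a ∂μ) (∫ a, deriv (fun z => F z a) z ∂μ) z := by
  obtain ⟨ε, hε, bound, hbi, hbd⟩ := hb
  obtain ⟨δ, hδ, hδU⟩ := Metric.isOpen_iff.1 hU z hz
  set η := min ε δ / 3 with hη
  have hη0 : 0 < η := by positivity
  have hηε : 2 * η < ε := by have := min_le_left ε δ; linarith
  have hηδ : 2 * η < δ := by have := min_le_right ε δ; linarith
  have hsub : ∀ x ∈ ball z η, closedBall x η ⊆ ball z (2 * η) := fun x hx =>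
    closedBall_subset_ball' (by rw [mem_ball] at hx; linarith)
  have hU2 : ball z (2 * η) ⊆ U := (ball_subset_ball hηδ.le).trans hδU
  refine hasDerivAt_integral_of_dominated_loc_of_deriv_le (s := ball z η)
    (F' := fun z a => deriv (fun z => F z a) z) (bound := fun a => bound a / η)
    (ball_mem_nhds z hη0) ?_ ?_ ?_ ?_ (hbi.div_const η) ?_
  · filter_upwards [hU.mem_nhds hz] with x hx using hmeas x hx
  · refine hbi.mono' (hmeas z hz) ?_
    filter_upwards [hbd] with a ha using ha z (mem_ball_self hε)
  -- The derivative is measurable in the integration variable as a pointwise limit of difference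
  -- quotients along a sequence.
  · have hlim : Tendsto (fun n : ℕ => z + ((η : ℂ) / ((n : ℂ) + 2))) atTop (𝓝[≠] z) := by
      refine tendsto_nhdsWithin_iff.2 ⟨?_, Eventually.of_forall fun n => ?_⟩
      · have h1 : Tendsto (fun n : ℕ => (η : ℂ) / ((n : ℂ) + 2)) atTop (𝓝 0) := by
          have h2 := (tendsto_const_div_atTop_nhds_zero_nat (η : ℂ)).comp (tendsto_add_atTop_nat 2)
          refine h2.congr fun n => ?_
          simp
        simpa using h1.const_add z
      · have : (η : ℂ) / ((n : ℂ) + 2) ≠ 0 := by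
          refine div_ne_zero (by exact_mod_cast hη0.ne') ?_
          exact_mod_cast (by positivity : ((n : ℝ) + 2) ≠ 0)
        simpa using this
    have hmem : ∀ n : ℕ, z + ((η : ℂ) / ((n : ℂ) + 2)) ∈ U := by
      intro n
      refine hU2 ?_
      rw [mem_ball, dist_eq_norm, add_sub_cancel_left, norm_div]
      have h3 : ‖((n : ℂ) + 2)‖ = (n : ℝ) + 2 := by
        rw [show ((n : ℂ) + 2) = (((n : ℝ) + 2 : ℝ) : ℂ) by push_cast; ring]
        rw [Complex.norm_real, Real.norm_of_nonneg (by positivity)]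
      rw [h3, Complex.norm_real, Real.norm_of_nonneg hη0.le, div_lt_iff₀ (by positivity)]
      have : (0 : ℝ) ≤ n := n.cast_nonneg
      nlinarith
    refine aestronglyMeasurable_of_tendsto_ae atTop
      (f := fun (n : ℕ) a => slope (fun z => F z a) z (z + ((η : ℂ) / ((n : ℂ) + 2)))) ?_ ?_
    · intro n
      simp only [slope_def_module]
      exact ((hmeas _ (hmem n)).sub (hmeas z hz)).const_smul (z + (η : ℂ) / ((n : ℂ) + 2) - z)⁻¹
    · filter_upwards [hd] with a ha
      exact (ha.differentiableAt (hU.mem_nhds hz)).hasDerivAt.tendsto_slope.comp hlim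
  -- Cauchy's estimate on the circle of radius `η` about `x` turns the bound on the functions into a
  -- bound on their derivatives.
  · filter_upwards [hbd, hd] with a ha hda x hx
    refine Complex.norm_deriv_le_of_forall_mem_sphere_norm_le hη0 ?_ fun y hy => ?_
    · refine DifferentiableOn.diffContOnCl ?_
      rw [closure_ball x hη0.ne']
      exact hda.mono ((hsub x hx).trans hU2)
    · exact ha y (ball_subset_ball hηε.le (hsub x hx (sphere_subset_closedBall hy)))
  · filter_upwards [hd] with a ha x hx
    exact (ha.differentiableAt (hU.mem_nhds (hU2 (ball_subset_ball (by linarith) hx)))).hasDerivAt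

/-- Holomorphic dependence on a parameter, for an integral over `[0, 1]`. -/
theorem hasDerivAt_intervalIntegral_param {U : Set ℂ} (hU : IsOpen U) {F : ℂ → ℝ → ℂ}
    (hc : ContinuousOn (fun p : ℂ × ℝ => F p.1 p.2) (U ×ˢ Icc 0 1))
    (hd : ∀ t ∈ Icc (0 : ℝ) 1, DifferentiableOn ℂ (fun z => F z t) U) {z : ℂ} (hz : z ∈ U) :
    HasDerivAt (fun z => ∫ t in (0 : ℝ)..1, F z t)
      (∫ t in (0 : ℝ)..1, deriv (fun z => F z t) z) z := by
  simp only [intervalIntegral.integral_of_le zero_le_one]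
  have hmeas : ∀ z ∈ U, AEStronglyMeasurable (F z) (volume.restrict (Ioc (0 : ℝ) 1)) := by
    intro z hz
    have : ContinuousOn (F z) (Icc 0 1) :=
      hc.comp (f := fun t : ℝ => (z, t)) (by fun_prop) fun t ht => ⟨hz, ht⟩
    exact (this.mono Ioc_subset_Icc_self).aestronglyMeasurable measurableSet_Ioc
  obtain ⟨δ, hδ, hδU⟩ := Metric.isOpen_iff.1 hU z hz
  have hK : closedBall z (δ / 2) ⊆ U := (closedBall_subset_ball (by linarith)).trans hδU
  obtain ⟨C, hC⟩ := ((isCompact_closedBall z (δ / 2)).prod (isCompact_Icc (a := (0 : ℝ))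
    (b := 1))).exists_bound_of_continuousOn (hc.mono (prod_mono hK Subset.rfl))
  refine (hasDerivAt_integral_of_locally_dominated hU hmeas ?_ hz
    ⟨δ / 2, by linarith, fun _ => C, integrable_const C, ?_⟩).2
  · filter_upwards [ae_restrict_mem measurableSet_Ioc] with t ht using hd t (Ioc_subset_Icc_self ht)
  · filter_upwards [ae_restrict_mem measurableSet_Ioc] with t ht z' hz'
    exact hC (z', t) ⟨ball_subset_closedBall hz', Ioc_subset_Icc_self ht⟩

/-! ### Integration along segments in convex sets. -/

/-- The integral of `f` along the segment from `a` to `b`. -/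
def segInt (a b : ℂ) (f : ℂ → ℂ) : ℂ := ∫ t in (0 : ℝ)..1, (b - a) * f (a + t * (b - a))

theorem segment_mem {U : Set ℂ} (hU : Convex ℝ U) {a b : ℂ} (ha : a ∈ U) (hb : b ∈ U) {t : ℝ}
    (ht : t ∈ Icc (0 : ℝ) 1) : a + t * (b - a) ∈ U := by
  have := hU.add_smul_sub_mem ha hb ht
  simpa using this

theorem segInt_eq_sub {U : Set ℂ} (hU : Convex ℝ U) {a b : ℂ} (ha : a ∈ U)
    (hb : b ∈ U) {f F : ℂ → ℂ} (hf : ContinuousOn f U) (hF : ∀ z ∈ U, HasDerivAt F (f z) z) :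
    segInt a b f = F b - F a := by
  have h := intervalIntegral.integral_eq_sub_of_hasDerivAt (a := 0) (b := 1)
    (f := fun t : ℝ => F (a + t * (b - a))) (f' := fun t : ℝ => (b - a) * f (a + t * (b - a))) ?_ ?_
  · simpa [segInt] using h
  · intro t ht
    rw [uIcc_of_le zero_le_one] at ht
    have h1 : HasDerivAt (fun t : ℝ => a + (t : ℂ) * (b - a)) (b - a) t := by
      simpa using ((Complex.ofRealCLM.hasDerivAt (x := t)).mul_const (b - a)).const_add a
    exact ((hF _ (segment_mem hU ha hb ht)).comp t h1).congr_deriv (mul_comm _ _)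
  · refine ContinuousOn.intervalIntegrable ?_
    rw [uIcc_of_le zero_le_one]
    refine continuousOn_const.mul (hf.comp (by fun_prop) fun t ht => segment_mem hU ha hb ht)

theorem segInt_self (a : ℂ) (f : ℂ → ℂ) : segInt a a f = 0 := by simp [segInt]

theorem segInt_congr {U : Set ℂ} (hU : Convex ℝ U) {a b : ℂ} (ha : a ∈ U) (hb : b ∈ U)
    {f g : ℂ → ℂ} (h : EqOn f g U) : segInt a b f = segInt a b g := by
  refine intervalIntegral.integral_congr fun t ht => ?_
  rw [uIcc_of_le zero_le_one] at ht
  simp only [h (segment_mem hU ha hb ht)]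

/-- Under the integral sign, the derivative of the integrand in the endpoint `b` equals the
derivative in `t` of `t f(a + t (b - a))`, whose integral over `[0, 1]` is `f b`. -/
theorem hasDerivAt_segInt {U : Set ℂ} (hU : Convex ℝ U) (hUo : IsOpen U) {a b : ℂ} (ha : a ∈ U)
    (hb : b ∈ U) {f : ℂ → ℂ} (hf : DifferentiableOn ℂ f U) :
    HasDerivAt (fun b => segInt a b f) (f b) b := by
  have hmaps : MapsTo (fun p : ℂ × ℝ => a + p.2 * (p.1 - a)) (U ×ˢ Icc 0 1) U :=
    fun p hp => segment_mem hU ha hp.1 hp.2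
  have hfd : ∀ z ∈ U, HasDerivAt f (deriv f z) z := fun z hz =>
    (hf.differentiableAt (hUo.mem_nhds hz)).hasDerivAt
  have hder : ∀ t ∈ Icc (0 : ℝ) 1, ∀ z ∈ U, HasDerivAt (fun z => (z - a) * f (a + t * (z - a)))
      (1 * f (a + t * (z - a)) + (z - a) * (deriv f (a + t * (z - a)) * t)) z := by
    intro t ht z hz
    have h1 : HasDerivAt (fun z => a + (t : ℂ) * (z - a)) t z := by
      simpa using (((hasDerivAt_id z).sub_const a).const_mul (t : ℂ)).const_add a
    exact ((hasDerivAt_id z).sub_const a).mul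
      ((hfd _ (segment_mem hU ha hz ht)).comp z h1)
  have h := hasDerivAt_intervalIntegral_param hUo (F := fun z t => (z - a) * f (a + t * (z - a)))
    (z := b) (((by fun_prop : ContinuousOn (fun p : ℂ × ℝ => p.1 - a) (U ×ˢ Icc 0 1))).mul
      (hf.continuousOn.comp (by fun_prop) hmaps))
    (fun t ht z hz => (hder t ht z hz).differentiableAt.differentiableWithinAt) hb
  refine HasDerivAt.congr_deriv (f := fun b => segInt a b f) h ?_
  have h2 := intervalIntegral.integral_eq_sub_of_hasDerivAt (a := 0) (b := 1)
    (f := fun t : ℝ => (t : ℂ) * f (a + t * (b - a)))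
    (f' := fun t : ℝ => deriv (fun z => (z - a) * f (a + t * (z - a))) b) ?_ ?_
  · simpa using h2
  · intro t ht
    rw [uIcc_of_le zero_le_one] at ht
    rw [(hder t ht b hb).deriv]
    have h1 : HasDerivAt (fun t : ℝ => a + (t : ℂ) * (b - a)) (b - a) t := by
      simpa using ((Complex.ofRealCLM.hasDerivAt (x := t)).mul_const (b - a)).const_add a
    refine ((Complex.ofRealCLM.hasDerivAt (x := t)).mul
      ((hfd _ (segment_mem hU ha hb ht)).comp t h1)).congr_deriv ?_
    simp only [Complex.ofRealCLM_apply, Complex.ofReal_one, Function.comp_apply]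
    ring
  · refine ContinuousOn.intervalIntegrable ?_
    rw [uIcc_of_le zero_le_one]
    refine ContinuousOn.congr (f := fun t : ℝ => 1 * f (a + t * (b - a)) +
      (b - a) * (deriv f (a + t * (b - a)) * t)) ?_ fun t ht => (hder t ht b hb).deriv
    have hm : MapsTo (fun t : ℝ => a + (t : ℂ) * (b - a)) (Icc 0 1) U :=
      fun t ht => segment_mem hU ha hb ht
    have h3 := hf.continuousOn.comp (f := fun t : ℝ => a + (t : ℂ) * (b - a)) (by fun_prop) hm
    have h4 := (hf.deriv hUo).continuousOn.comp (f := fun t : ℝ => a + (t : ℂ) * (b - a))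
      (by fun_prop) hm
    exact (continuousOn_const.mul h3).add
      (continuousOn_const.mul (h4.mul Complex.continuous_ofReal.continuousOn))

theorem segInt_add {U : Set ℂ} (hU : Convex ℝ U) (hUo : IsOpen U) {a b c : ℂ} (ha : a ∈ U)
    (hb : b ∈ U) (hc : c ∈ U) {f : ℂ → ℂ} (hf : DifferentiableOn ℂ f U) :
    segInt a c f = segInt a b f + segInt b c f := by
  have h := segInt_eq_sub hU hb hc hf.continuousOn
    fun z hz => hasDerivAt_segInt hU hUo ha hz hf
  rw [h]; ring

/-- The image of a segment under `π` need not be a segment; the change of variables holds because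
`f` has a primitive on the convex set `V`. -/
theorem segInt_comp {U V : Set ℂ} (hU : Convex ℝ U) (hV : Convex ℝ V) (hVo : IsOpen V)
    {π : ℂ → ℂ} (hπV : MapsTo π U V) (hUo : IsOpen U) (hπ : DifferentiableOn ℂ π U) {a b : ℂ}
    (ha : a ∈ U) (hb : b ∈ U) {f : ℂ → ℂ} (hf : DifferentiableOn ℂ f V) :
    segInt a b (fun v => f (π v) * deriv π v) = segInt (π a) (π b) f := by
  have h := segInt_eq_sub hU ha hb (F := fun v => segInt (π a) (π v) f)
    (f := fun v => f (π v) * deriv π v)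
    ((hf.continuousOn.comp hπ.continuousOn hπV).mul (hπ.deriv hUo).continuousOn) fun z hz =>
    (hasDerivAt_segInt hV hVo (hπV ha) (hπV hz) hf).comp z
      (hπ.differentiableAt (hUo.mem_nhds hz)).hasDerivAt
  rw [h, segInt_self, sub_zero]

/-- Holomorphy of `x ↦ ∫ k(x, v) dv`, for a jointly continuous kernel which is holomorphic in `x`. -/
theorem differentiableOn_segInt_param {U V : Set ℂ} (hV : Convex ℝ V) (hUo : IsOpen U) {a b : ℂ}
    (ha : a ∈ V) (hb : b ∈ V) {k : ℂ → ℂ → ℂ}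
    (hk : ContinuousOn (fun p : ℂ × ℂ => k p.1 p.2) (U ×ˢ V))
    (hd : ∀ v ∈ V, DifferentiableOn ℂ (fun x => k x v) U) :
    DifferentiableOn ℂ (fun x => segInt a b (k x)) U := by
  intro z hz
  refine (hasDerivAt_intervalIntegral_param hUo (F := fun z t => (b - a) * k z (a + t * (b - a)))
    (z := z) (continuousOn_const.mul (hk.comp (f := fun p : ℂ × ℝ => (p.1, a + p.2 * (b - a)))
      (by fun_prop) fun p hp => ⟨hp.1, segment_mem hV ha hb hp.2⟩))
    (fun t ht => (hd _ (segment_mem hV ha hb ht)).const_mul _) hz).differentiableAt.differentiableWithinAt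

/-! ### Convolutions and scalar linear differential equations. -/

/-- The convolution `∫ b(π u - π v) φ(v) π'(v) dv` along the segment from `u₀` to `u`. -/
def conv (π : ℂ → ℂ) (u₀ : ℂ) (b φ : ℂ → ℂ) (u : ℂ) : ℂ :=
  segInt u₀ u fun v => b (π u - π v) * φ v * deriv π v

theorem differentiableOn_conv {U : Set ℂ} (hU : Convex ℝ U) (hUo : IsOpen U) {u₀ : ℂ} (h0 : u₀ ∈ U)
    {π b φ : ℂ → ℂ} (hπ : DifferentiableOn ℂ π U) (hb : Differentiable ℂ b)
    (hφ : DifferentiableOn ℂ φ U) : DifferentiableOn ℂ (conv π u₀ b φ) U := by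
  intro z hz
  have hm : MapsTo (fun p : ℂ × ℝ => u₀ + p.2 * (p.1 - u₀)) (U ×ˢ Icc 0 1) U :=
    fun p hp => segment_mem hU h0 hp.1 hp.2
  have hm' : ∀ t ∈ Icc (0 : ℝ) 1, MapsTo (fun z : ℂ => u₀ + t * (z - u₀)) U U :=
    fun t ht z hz => segment_mem hU h0 hz ht
  have hπ' := hπ.deriv hUo
  have hs : ContinuousOn (fun p : ℂ × ℝ => u₀ + p.2 * (p.1 - u₀)) (U ×ˢ Icc (0 : ℝ) 1) := by
    fun_prop
  refine (hasDerivAt_intervalIntegral_param hUo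
    (F := fun z t => (z - u₀) * (b (π z - π (u₀ + t * (z - u₀))) * φ (u₀ + t * (z - u₀)) *
      deriv π (u₀ + t * (z - u₀)))) (z := z) ?_ ?_ hz).differentiableAt.differentiableWithinAt
  · refine ContinuousOn.mul (by fun_prop) (((hb.continuous.comp_continuousOn
      ((hπ.continuousOn.comp continuousOn_fst fun p hp => hp.1).sub
        (hπ.continuousOn.comp hs hm))).mul
        (hφ.continuousOn.comp hs hm)).mul (hπ'.continuousOn.comp hs hm))
  · intro t ht
    have hs' : DifferentiableOn ℂ (fun z : ℂ => u₀ + t * (z - u₀)) U := by fun_prop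
    exact DifferentiableOn.mul (by fun_prop) (((hb.comp_differentiableOn
      (hπ.sub (hπ.comp hs' (hm' t ht)))).mul (hφ.comp hs' (hm' t ht))).mul
      (hπ'.comp hs' (hm' t ht)))

/-- Variation of constants. -/
theorem exists_linear_ode {U : Set ℂ} (hU : Convex ℝ U) (hUo : IsOpen U) {u₀ : ℂ} (h0 : u₀ ∈ U)
    {α g : ℂ → ℂ} (hα : DifferentiableOn ℂ α U) (hg : DifferentiableOn ℂ g U) (v : ℂ) :
    ∃ φ : ℂ → ℂ, φ u₀ = v ∧ ∀ u ∈ U, HasDerivAt φ (α u * φ u + g u) u := by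
  have hA : ∀ u ∈ U, HasDerivAt (fun u => segInt u₀ u α) (α u) u :=
    fun u hu => hasDerivAt_segInt hU hUo h0 hu hα
  have hh : DifferentiableOn ℂ (fun u => Complex.exp (-segInt u₀ u α) * g u) U :=
    (DifferentiableOn.cexp (DifferentiableOn.neg
      fun u hu => (hA u hu).differentiableAt.differentiableWithinAt)).mul hg
  refine ⟨fun u => Complex.exp (segInt u₀ u α) *
    (v + segInt u₀ u fun u => Complex.exp (-segInt u₀ u α) * g u), by simp [segInt_self],
    fun u hu => ?_⟩
  refine ((hA u hu).cexp.mul ((hasDerivAt_segInt hU hUo h0 hu hh).const_add v)).congr_deriv ?_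
  have : Complex.exp (segInt u₀ u α) * Complex.exp (-segInt u₀ u α) = 1 := by
    rw [← Complex.exp_add]; simp
  linear_combination g u * this

theorem eqOn_of_linear_ode {U : Set ℂ} (hU : Convex ℝ U) (hUo : IsOpen U) {u₀ : ℂ} (h0 : u₀ ∈ U)
    {α g φ ψ : ℂ → ℂ} (hα : DifferentiableOn ℂ α U)
    (hφ : ∀ u ∈ U, HasDerivAt φ (α u * φ u + g u) u)
    (hψ : ∀ u ∈ U, HasDerivAt ψ (α u * ψ u + g u) u) (h : φ u₀ = ψ u₀) : EqOn φ ψ U := by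
  have hA : ∀ u ∈ U, HasDerivAt (fun u => segInt u₀ u α) (α u) u :=
    fun u hu => hasDerivAt_segInt hU hUo h0 hu hα
  intro u hu
  have h1 := segInt_eq_sub hU h0 hu (f := fun _ => 0)
    (F := fun u => Complex.exp (-segInt u₀ u α) * (φ u - ψ u)) continuousOn_const fun z hz => by
      refine ((hA z hz).neg.cexp.mul ((hφ z hz).sub (hψ z hz))).congr_deriv ?_
      simp only [Pi.sub_apply]
      ring
  have h2 : segInt u₀ u (fun _ => 0) = 0 := by simp [segInt]
  rw [h2, h, sub_self, mul_zero, sub_zero] at h1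
  have := (mul_eq_zero.1 h1.symm).resolve_left (Complex.exp_ne_zero _)
  exact sub_eq_zero.1 this

/-- Solves a triangular system by induction on the rank: the condition on the component `p` involves
only components of smaller rank, and the ranks are bounded since `P` is finite. It serves for
holomorphic solutions, for solutions in `LogClass` and for formal series. -/
theorem exists_of_triangular {P T : Type*} [Finite P] [Nonempty T] (rk : P → ℕ)
    (R : P → (P → T) → T → Prop)
    (hloc : ∀ p Φ Φ' t, (∀ p', rk p' < rk p → Φ p' = Φ' p') → R p Φ t → R p Φ' t)
    (hex : ∀ p Φ, (∀ p', rk p' < rk p → R p' Φ (Φ p')) → ∃ t, R p Φ t) :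
    ∃ Φ : P → T, ∀ p, R p Φ (Φ p) := by
  classical
  have key : ∀ n, ∃ Φ : P → T, ∀ p, rk p < n → R p Φ (Φ p) := by
    intro n
    induction n with
    | zero => exact ⟨fun _ => Classical.arbitrary T, fun p hp => absurd hp (Nat.not_lt_zero _)⟩
    | succ n ih =>
      obtain ⟨Φ, hΦ⟩ := ih
      have h : ∀ p, rk p = n → ∃ t, R p Φ t := fun p hp => hex p Φ fun p' hp' => hΦ p' (hp ▸ hp')
      choose t ht using h
      refine ⟨fun p => if hp : rk p = n then t p hp else Φ p, fun p hp => ?_⟩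
      have hagree : ∀ p', rk p' < rk p →
          Φ p' = (fun p => if hp : rk p = n then t p hp else Φ p) p' := by
        intro p' hp'
        simp only
        rw [dif_neg (by omega)]
      by_cases hpn : rk p = n
      · simp only [dif_pos hpn]
        exact hloc p Φ _ _ hagree (ht p hpn)
      · simp only [dif_neg hpn]
        exact hloc p Φ _ _ hagree (hΦ p (by omega))
  obtain ⟨n, hn⟩ := (Set.finite_range rk).bddAbove
  obtain ⟨Φ, hΦ⟩ := key (n + 1)
  exact ⟨Φ, fun p => hΦ p (Nat.lt_succ_of_le (hn (mem_range_self p)))⟩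

/-! ### Convolution systems: existence, uniqueness, extension, change of base point and of
coordinate. -/

/-- Data of the convolution equations satisfied by the Borel transforms: unknowns indexed by `P`,
coupled at each order by a strictly triangular constant matrix `N`, and to the preceding order by
convolution with the entire functions `β`. -/
structure ConvSystem (P : Type) [Fintype P] where
  a : P → ℂ
  lam : P → ℂ
  N : P → P → ℂ
  rk : P → ℕ
  β : P → P → ℂ → ℂ
  rk_lt : ∀ {p p'}, N p p' ≠ 0 → rk p' < rk p
  a_eq : ∀ {p p'}, N p p' ≠ 0 → a p' = a p
  lam_eq : ∀ {p p'}, N p p' ≠ 0 → lam p' = lam p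
  diff : ∀ p p', Differentiable ℂ (β p p')

namespace ConvSystem

variable {P : Type} [Fintype P] (T : ConvSystem P)

/-- The right-hand side of the equations of order `m`. -/
def source (π : ℂ → ℂ) (u₀ : ℂ) (E : P → ℂ → ℂ) (Φ : P → ℂ → ℂ) (p : P) (u : ℂ) : ℂ :=
  E p (π u) + ∑ p', conv π u₀ (T.β p p') (Φ p') u

/-- `Φ` solves on `U` the pull-back by `π` of the differential equation with right-hand side `Ψ`. -/
def SolvesOn (U : Set ℂ) (π : ℂ → ℂ) (Ψ Φ : P → ℂ → ℂ) : Prop :=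
  ∀ p, DifferentiableOn ℂ (Φ p) U ∧ ∀ u ∈ U,
    (π u - T.a p) * deriv (Φ p) u + (1 - T.lam p) * deriv π u * Φ p u =
      deriv (Ψ p) u + deriv π u * ∑ p', T.N p p' * Φ p' u

/-- A solution of all the equations, in the coordinate `u` on `U`. -/
structure IsSol (U : Set ℂ) (π : ℂ → ℂ) (u₀ : ℂ) (E Φ : ℕ → P → ℂ → ℂ) : Prop where
  entire : ∀ m p, Differentiable ℂ (E m p)
  zero : ∀ p u, Φ 0 p u = 0
  solves : ∀ m, T.SolvesOn U π (T.source π u₀ (E (m + 1)) (Φ m)) (Φ (m + 1))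

variable {T}

theorem sum_N_congr {p : P} {f g : P → ℂ} (h : ∀ p', T.rk p' < T.rk p → f p' = g p') :
    ∑ p', T.N p p' * f p' = ∑ p', T.N p p' * g p' := by
  refine Finset.sum_congr rfl fun p' _ => ?_
  by_cases hN : T.N p p' = 0
  · simp [hN]
  · rw [h p' (T.rk_lt hN)]

/-- Away from the singular values one may divide by `π u - a`; since `N` is strictly triangular,
each component then solves a scalar equation with known right-hand side. -/
theorem SolvesOn.exists {U : Set ℂ} (hU : Convex ℝ U) (hUo : IsOpen U) {u₀ : ℂ} (h0 : u₀ ∈ U)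
    {π : ℂ → ℂ} (hπ : DifferentiableOn ℂ π U) (ha : ∀ u ∈ U, ∀ p, π u ≠ T.a p) {Ψ : P → ℂ → ℂ}
    (hΨ : ∀ p, DifferentiableOn ℂ (Ψ p) U) (v : P → ℂ) :
    ∃ Φ : P → ℂ → ℂ, (∀ p, Φ p u₀ = v p) ∧ T.SolvesOn U π Ψ Φ := by
  have hπ' := hπ.deriv hUo
  suffices H : ∃ Φ : P → ℂ → ℂ, ∀ p, (Φ p u₀ = v p ∧ DifferentiableOn ℂ (Φ p) U ∧ ∀ u ∈ U,
      (π u - T.a p) * deriv (Φ p) u + (1 - T.lam p) * deriv π u * Φ p u =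
      deriv (Ψ p) u + deriv π u * ∑ p', T.N p p' * Φ p' u) by
    obtain ⟨Φ, hΦ⟩ := H
    exact ⟨Φ, fun p => (hΦ p).1, fun p => (hΦ p).2⟩
  refine exists_of_triangular (T := ℂ → ℂ) T.rk
    (fun p Φ φ => φ u₀ = v p ∧ DifferentiableOn ℂ φ U ∧ ∀ u ∈ U,
      (π u - T.a p) * deriv φ u + (1 - T.lam p) * deriv π u * φ u =
      deriv (Ψ p) u + deriv π u * ∑ p', T.N p p' * Φ p' u) ?_ ?_
  · rintro p Φ Φ' t h ⟨h1, h2, h3⟩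
    refine ⟨h1, h2, fun u hu => ?_⟩
    rw [h3 u hu, sum_N_congr fun p' hp' => congrFun (h p' hp') u]
  · intro p Φ hΦ
    have hne : ∀ u ∈ U, π u - T.a p ≠ 0 := fun u hu => sub_ne_zero.2 (ha u hu p)
    have hN : DifferentiableOn ℂ (fun u => ∑ p', T.N p p' * Φ p' u) U := by
      refine DifferentiableOn.fun_sum fun p' _ => ?_
      by_cases hN : T.N p p' = 0
      · simp [hN]
      · exact (hΦ p' (T.rk_lt hN)).2.1.const_mul _
    obtain ⟨φ, hφ0, hφ⟩ := exists_linear_ode hU hUo h0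
      (α := fun u => -((1 - T.lam p) * deriv π u) / (π u - T.a p))
      (g := fun u => (deriv (Ψ p) u + deriv π u * ∑ p', T.N p p' * Φ p' u) / (π u - T.a p))
      ((hπ'.const_mul _).neg.div (hπ.sub_const _) hne)
      ((((hΨ p).deriv hUo).add (hπ'.mul hN)).div (hπ.sub_const _) hne) (v p)
    refine ⟨φ, hφ0, fun u hu => (hφ u hu).differentiableAt.differentiableWithinAt, fun u hu => ?_⟩
    rw [(hφ u hu).deriv]
    have := hne u hu
    field_simp
    ring

theorem SolvesOn.eqOn {U : Set ℂ} (hU : Convex ℝ U) (hUo : IsOpen U) {u₀ : ℂ} (h0 : u₀ ∈ U)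
    {π : ℂ → ℂ} (hπ : DifferentiableOn ℂ π U) (ha : ∀ u ∈ U, ∀ p, π u ≠ T.a p)
    {Ψ Ψ' Φ Φ' : P → ℂ → ℂ} (hΨ : ∀ p, EqOn (Ψ p) (Ψ' p) U) (hΦ : T.SolvesOn U π Ψ Φ)
    (hΦ' : T.SolvesOn U π Ψ' Φ') (hv : ∀ p, Φ p u₀ = Φ' p u₀) : ∀ p, EqOn (Φ p) (Φ' p) U := by
  have hπ' := hπ.deriv hUo
  have key : ∀ n p, T.rk p < n → EqOn (Φ p) (Φ' p) U := by
    intro n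
    induction n with
    | zero => intro p hp; exact absurd hp (Nat.not_lt_zero _)
    | succ n ih =>
      intro p hp
      have hne : ∀ u ∈ U, π u - T.a p ≠ 0 := fun u hu => sub_ne_zero.2 (ha u hu p)
      refine eqOn_of_linear_ode hU hUo h0
        (α := fun u => -((1 - T.lam p) * deriv π u) / (π u - T.a p))
        (g := fun u => (deriv (Ψ p) u + deriv π u * ∑ p', T.N p p' * Φ p' u) / (π u - T.a p))
        ((hπ'.const_mul _).neg.div (hπ.sub_const _) hne) ?_ ?_ (hv p)
      · intro u hu
        refine (((hΦ p).1.differentiableAt (hUo.mem_nhds hu)).hasDerivAt).congr_deriv ?_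
        have := hne u hu
        have h2 := (hΦ p).2 u hu
        field_simp
        linear_combination h2
      · intro u hu
        refine (((hΦ' p).1.differentiableAt (hUo.mem_nhds hu)).hasDerivAt).congr_deriv ?_
        have := hne u hu
        have h2 := (hΦ' p).2 u hu
        have h3 : deriv (Ψ p) u = deriv (Ψ' p) u :=
          ((hΨ p).eventuallyEq_of_mem (hUo.mem_nhds hu)).deriv_eq
        have h4 : ∑ p', T.N p p' * Φ p' u = ∑ p', T.N p p' * Φ' p' u :=
          sum_N_congr fun p' hp' => ih p' (by omega) hu
        rw [h3, h4]
        field_simp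
        linear_combination h2
  exact fun p => key _ p (Nat.lt_succ_self _)

theorem differentiableOn_source {U : Set ℂ} (hU : Convex ℝ U) (hUo : IsOpen U) {u₀ : ℂ}
    (h0 : u₀ ∈ U) {π : ℂ → ℂ} (hπ : DifferentiableOn ℂ π U) {E Φ : P → ℂ → ℂ}
    (hE : ∀ p, Differentiable ℂ (E p)) (hΦ : ∀ p, DifferentiableOn ℂ (Φ p) U) (p : P) :
    DifferentiableOn ℂ (T.source π u₀ E Φ p) U :=
  ((hE p).comp_differentiableOn hπ).add
    (DifferentiableOn.fun_sum fun p' _ => differentiableOn_conv hU hUo h0 hπ (T.diff p p') (hΦ p'))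

theorem eqOn_source {U : Set ℂ} (hU : Convex ℝ U) {u₀ : ℂ} (h0 : u₀ ∈ U) {π : ℂ → ℂ}
    {E Φ Φ' : P → ℂ → ℂ} (h : ∀ p, EqOn (Φ p) (Φ' p) U) (p : P) :
    EqOn (T.source π u₀ E Φ p) (T.source π u₀ E Φ' p) U := by
  intro u hu
  refine congrArg (E p (π u) + ·) (Finset.sum_congr rfl fun p' _ => ?_)
  refine segInt_congr hU h0 hu fun v hv => ?_
  simp only [h p' hv]

variable {U V : Set ℂ} {π : ℂ → ℂ} {u₀ : ℂ} {E Φ : ℕ → P → ℂ → ℂ}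

theorem IsSol.differentiableOn (h : T.IsSol U π u₀ E Φ) (m : ℕ) (p : P) :
    DifferentiableOn ℂ (Φ m p) U := by
  cases m with
  | zero => exact (differentiableOn_const (0 : ℂ)).congr fun u _ => h.zero p u
  | succ m => exact (h.solves m p).1

theorem IsSol.mono (h : T.IsSol U π u₀ E Φ) (hVU : V ⊆ U) : T.IsSol V π u₀ E Φ :=
  ⟨h.entire, h.zero, fun m p => ⟨(h.solves m p).1.mono hVU, fun u hu => (h.solves m p).2 u (hVU hu)⟩⟩

/-- A solution near `u₀` extends to any convex open set which `π` maps outside the singularities. -/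
theorem IsSol.extend (h : T.IsSol U π u₀ E Φ) (hU : U ∈ 𝓝 u₀) (hV : Convex ℝ V) (hVo : IsOpen V)
    (h0 : u₀ ∈ V) (hπ : DifferentiableOn ℂ π V) (ha : ∀ u ∈ V, ∀ p, π u ≠ T.a p) :
    ∃ Φ' : ℕ → P → ℂ → ℂ, T.IsSol V π u₀ E Φ' ∧ ∀ m p, Φ' m p =ᶠ[𝓝 u₀] Φ m p := by
  have hstep : ∀ (m : ℕ) (F : P → ℂ → ℂ), ∃ G : P → ℂ → ℂ, (∀ p, DifferentiableOn ℂ (F p) V) →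
      (∀ p, G p u₀ = Φ (m + 1) p u₀) ∧ T.SolvesOn V π (T.source π u₀ (E (m + 1)) F) G := by
    intro m F
    -- The recursion needs a step defined for every `F`; its value when `F` is not holomorphic plays
    -- no role.
    by_cases hF : ∀ p, DifferentiableOn ℂ (F p) V
    · obtain ⟨G, hG⟩ := SolvesOn.exists hV hVo h0 hπ ha
        (differentiableOn_source (T := T) hV hVo h0 hπ (h.entire (m + 1)) hF) fun p => Φ (m + 1) p u₀
      exact ⟨G, fun _ => hG⟩
    · exact ⟨F, fun hF' => absurd hF' hF⟩
  choose G hG using hstep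
  let Φ' : ℕ → P → ℂ → ℂ := fun m => Nat.rec (fun _ _ => 0) (fun m F => G m F) m
  have hd : ∀ m p, DifferentiableOn ℂ (Φ' m p) V := by
    intro m
    induction m with
    | zero => exact fun p => differentiableOn_const 0
    | succ m ih => exact fun p => ((hG m (Φ' m) ih).2 p).1
  have hs : T.IsSol V π u₀ E Φ' := ⟨h.entire, fun _ _ => rfl, fun m => (hG m (Φ' m) (hd m)).2⟩
  refine ⟨Φ', hs, ?_⟩
  obtain ⟨ε, hε, hεUV⟩ := Metric.mem_nhds_iff.1 (inter_mem hU (hVo.mem_nhds h0))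
  have hεV : ball u₀ ε ⊆ V := hεUV.trans inter_subset_right
  have hO := h.mono (hεUV.trans inter_subset_left)
  have hO' := hs.mono hεV
  have heq : ∀ m p, EqOn (Φ' m p) (Φ m p) (ball u₀ ε) := by
    intro m
    induction m with
    | zero => intro p u _; rw [h.zero, hs.zero]
    | succ m ih =>
      exact SolvesOn.eqOn (convex_ball u₀ ε) isOpen_ball (mem_ball_self hε) (hπ.mono hεV)
        (fun u hu => ha u (hεV hu)) (eqOn_source (convex_ball u₀ ε) (mem_ball_self hε) ih)
        (hO'.solves m) (hO.solves m) fun p => (hG m (Φ' m) (hd m)).1 p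
  exact fun m p => (heq m p).eventuallyEq_of_mem (ball_mem_nhds u₀ hε)

theorem SolvesOn.congr_source {Ψ Ψ' Φ : P → ℂ → ℂ} (hUo : IsOpen U) (h : T.SolvesOn U π Ψ Φ)
    (hΨ : ∀ p, EqOn (Ψ' p) (Ψ p) U) : T.SolvesOn U π Ψ' Φ := fun p => ⟨(h p).1, fun u hu => by
  rw [(h p).2 u hu, ((hΨ p).eventuallyEq_of_mem (hUo.mem_nhds hu)).deriv_eq]⟩

/-- Changing the base point of the convolutions only changes the entire functions. -/
theorem IsSol.rebase (h : T.IsSol U id u₀ E Φ) (hU : Convex ℝ U) (hUo : IsOpen U) (h0 : u₀ ∈ U)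
    {u₁ : ℂ} (h1 : u₁ ∈ U) : ∃ E' : ℕ → P → ℂ → ℂ, T.IsSol U id u₁ E' Φ := by
  -- The added term is the part of the convolution over the fixed segment from `u₀` to `u₁`; it is
  -- entire in `x` because `β` is. Only its values at `m ≥ 1` enter the equations.
  refine ⟨fun m p x => E m p x + ∑ p', segInt u₀ u₁ fun v => T.β p p' (x - v) * Φ (m - 1) p' v,
    fun m p => ?_, h.zero, fun m => (h.solves m).congr_source hUo fun p u hu => ?_⟩
  · refine (h.entire m p).add (Differentiable.fun_sum fun p' _ => ?_)
    rw [← differentiableOn_univ]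
    refine differentiableOn_segInt_param hU isOpen_univ h0 h1 ?_ fun v _ => ?_
    · exact ((T.diff p p').continuous.comp_continuousOn (by fun_prop)).mul
        ((h.differentiableOn (m - 1) p').continuousOn.comp continuousOn_snd fun q hq => hq.2)
    · exact ((((T.diff p p').comp (differentiable_id.sub_const v))).mul_const _).differentiableOn
  · simp only [source, id, Nat.add_sub_cancel, add_assoc, ← Finset.sum_add_distrib]
    refine congrArg _ (Finset.sum_congr rfl fun p' _ => ?_)
    simp only [conv, deriv_id', mul_one, id]
    have hd : DifferentiableOn ℂ (fun v => T.β p p' (u - v) * Φ m p' v) U :=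
      ((T.diff p p').comp (differentiable_id.const_sub u)).differentiableOn.mul
        (h.differentiableOn m p')
    exact (segInt_add hU hUo h0 h1 hu hd).symm

/-- Pull-back of a solution near `π u₀`. -/
theorem IsSol.comp (h : T.IsSol U id (π u₀) E Φ) (hU : U ∈ 𝓝 (π u₀)) (hVo : IsOpen V)
    (hV0 : u₀ ∈ V) (hπ : DifferentiableOn ℂ π V) :
    ∃ O ∈ 𝓝 u₀, T.IsSol O π u₀ E fun m p u => Φ m p (π u) := by
  obtain ⟨ε, hε, hεU⟩ := Metric.mem_nhds_iff.1 hU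
  have hcont : ContinuousAt π u₀ := (hπ.differentiableAt (hVo.mem_nhds hV0)).continuousAt
  obtain ⟨δ, hδ, hδV⟩ := Metric.mem_nhds_iff.1
    (inter_mem (hVo.mem_nhds hV0) (hcont.preimage_mem_nhds (ball_mem_nhds _ hε)))
  have hπO : DifferentiableOn ℂ π (ball u₀ δ) := hπ.mono (hδV.trans inter_subset_left)
  have hm : MapsTo π (ball u₀ δ) (ball (π u₀) ε) := fun u hu => (hδV hu).2
  have hB := h.mono hεU
  have hsrc : ∀ m p, EqOn (T.source π u₀ (E (m + 1)) (fun p u => Φ m p (π u)) p)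
      (fun u => T.source id (π u₀) (E (m + 1)) (Φ m) p (π u)) (ball u₀ δ) := by
    intro m p u hu
    refine congrArg _ (Finset.sum_congr rfl fun p' _ => ?_)
    simp only [conv, deriv_id', mul_one, id]
    exact segInt_comp (convex_ball u₀ δ) (convex_ball (π u₀) ε) isOpen_ball hm isOpen_ball hπO
      (mem_ball_self hδ) hu (f := fun v => T.β p p' (π u - v) * Φ m p' v)
      (((T.diff p p').comp (differentiable_id.const_sub (π u))).differentiableOn.mul
        (hB.differentiableOn m p'))
  refine ⟨ball u₀ δ, ball_mem_nhds _ hδ, h.entire, fun p u => h.zero p _, fun m =>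
    SolvesOn.congr_source (Ψ := fun p u => T.source id (π u₀) (E (m + 1)) (Φ m) p (π u))
      isOpen_ball ?_ (hsrc m)⟩
  intro p
  refine ⟨(hB.differentiableOn (m + 1) p).comp hπO hm, fun u hu => ?_⟩
  have hπu := (hπO.differentiableAt (isOpen_ball.mem_nhds hu)).hasDerivAt
  have h1 := (((hB.differentiableOn (m + 1) p).differentiableAt
    (isOpen_ball.mem_nhds (hm hu))).hasDerivAt.comp u hπu).deriv
  have h2 := (((differentiableOn_source (T := T) (convex_ball _ ε) isOpen_ball (mem_ball_self hε)
    differentiableOn_id (h.entire (m + 1)) (hB.differentiableOn m) p).differentiableAt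
    (isOpen_ball.mem_nhds (hm hu))).hasDerivAt.comp u hπu).deriv
  simp only [Function.comp_def] at h1 h2
  rw [h1, h2]
  have h3 := (hB.solves m p).2 (π u) (hm hu)
  simp only [id, deriv_id', mul_one, one_mul] at h3
  -- By the chain rule, the pulled-back equation is the original one at `π u` multiplied by `π'`.
  linear_combination deriv π u * h3

end ConvSystem

/-! ### Analytic continuation along a path. -/

namespace ConvSystem

variable {P : Type} [Fintype P] {T : ConvSystem P} {E Φ : ℕ → P → ℂ → ℂ}

/-- The solution `Φ` near `0` has been continued along the part `[0, t]` of the path `γ`. -/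
structure ContinuedTo (T : ConvSystem P) {ξ : ℂ} (γ : Path (0 : ℂ) ξ) (Φ : ℕ → P → ℂ → ℂ)
    (t : unitInterval) (g : ℕ → P → unitInterval → ℂ → ℂ) : Prop where
  start : ∀ m p, g m p 0 = Φ m p
  analyticAt : ∀ m p, ∀ s ≤ t, AnalyticAt ℂ (g m p s) (γ s)
  locally_eq : ∀ m p, ∀ s ≤ t, ∀ᶠ s' in 𝓝[Iic t] s, g m p s' =ᶠ[𝓝 (γ s')] g m p s
  sol : ∃ E' : ℕ → P → ℂ → ℂ, ∃ U ∈ 𝓝 (γ t), T.IsSol U id (γ t) E' fun m p => g m p t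

/-- On a convex set `V` without singular values that contains the arc from `γ s` to `γ t`, the end
germ extends to a single function. Keeping the old germs up to `s` and this function afterwards
continues the family, and rebasing at `γ t` makes the step repeatable. -/
theorem ContinuedTo.step {ξ : ℂ} {γ : Path (0 : ℂ) ξ} {s t : unitInterval}
    {g : ℕ → P → unitInterval → ℂ → ℂ} (h : T.ContinuedTo γ Φ s g) (hst : s ≤ t) {V : Set ℂ}
    (hV : Convex ℝ V) (hVo : IsOpen V) (ha : ∀ u ∈ V, ∀ p, u ≠ T.a p)
    (hγ : ∀ r ∈ Icc s t, γ r ∈ V) : ∃ g', T.ContinuedTo γ Φ t g' := by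
  obtain ⟨E', U, hU, hsol⟩ := h.sol
  have hsV : γ s ∈ V := hγ s ⟨le_rfl, hst⟩
  have htV : γ t ∈ V := hγ t ⟨hst, le_rfl⟩
  obtain ⟨Φ', hΦ', heq⟩ := hsol.extend hU hV hVo hsV differentiableOn_id ha
  obtain ⟨E'', hE''⟩ := hΦ'.rebase hV hVo hsV htV
  have hΦd : ∀ m p, ∀ u ∈ V, AnalyticAt ℂ (Φ' m p) u := fun m p u hu =>
    (hΦ'.differentiableOn m p).analyticAt (hVo.mem_nhds hu)
  have hev : ∀ m p, ∀ᶠ s' in 𝓝 s, Φ' m p =ᶠ[𝓝 (γ s')] g m p s := fun m p =>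
    (γ.continuous.tendsto s).eventually (heq m p).eventuallyEq_nhds
  have htt : ∀ m p, Φ' m p =ᶠ[𝓝 (γ t)] if t ≤ s then g m p t else Φ' m p := by
    intro m p
    split_ifs with hts
    · obtain rfl := le_antisymm hst hts
      exact heq m p
    · exact EventuallyEq.rfl
  refine ⟨fun m p r => if r ≤ s then g m p r else Φ' m p, fun m p => ?_, fun m p r hr => ?_,
    fun m p r hr => ?_, ?_⟩
  · simp only [unitInterval.nonneg', if_true, h.start]
  · split_ifs with hrs
    · exact h.analyticAt m p r hrs
    · exact hΦd m p _ (hγ r ⟨(not_le.1 hrs).le, hr⟩)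
  · rcases lt_trichotomy r s with hrs | rfl | hrs
    · have h1 : ∀ᶠ s' in 𝓝 r, s' < s := eventually_lt_nhds hrs
      have h2 := eventually_nhdsWithin_iff.1 (h.locally_eq m p r hrs.le)
      refine Filter.Eventually.filter_mono nhdsWithin_le_nhds ?_
      filter_upwards [h1, h2] with s' h1 h2
      simp only [if_pos h1.le, if_pos hrs.le]
      exact h2 h1.le
    · refine Filter.Eventually.filter_mono nhdsWithin_le_nhds ?_
      filter_upwards [hev m p, eventually_nhdsWithin_iff.1 (h.locally_eq m p r le_rfl)] with s' h1 h2
      simp only [le_refl, if_true]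
      split_ifs with h3
      · exact h2 h3
      · exact h1
    · refine Filter.Eventually.filter_mono nhdsWithin_le_nhds ?_
      filter_upwards [eventually_gt_nhds hrs] with s' h1
      simp only [if_neg (not_le.2 h1), if_neg (not_le.2 hrs)]
      exact EventuallyEq.rfl
  · by_cases hts : t ≤ s
    · obtain rfl := le_antisymm hst hts
      exact ⟨E', U, hU, by simpa using hsol⟩
    · exact ⟨E'', V, hVo.mem_nhds htV, by simpa [hts] using hE''⟩

/-- Continuation of a solution along a path which avoids the singularities. -/
theorem IsSol.continuation {ξ : ℂ} (γ : Path (0 : ℂ) ξ)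
    (hγ : ∀ t : unitInterval, t ≠ 0 → ∀ p, γ t ≠ T.a p) {U : Set ℂ} (hU : U ∈ 𝓝 (0 : ℂ))
    (h : T.IsSol U id 0 E Φ) : ∃ g, T.ContinuedTo γ Φ 1 g := by
  obtain ⟨ε, hε, hεU⟩ := Metric.mem_nhds_iff.1 hU
  have hB := h.mono hεU
  obtain ⟨δ, hδ, hδγ⟩ : ∃ δ > 0, ∀ s : unitInterval, dist s 0 < δ → γ s ∈ ball (0 : ℂ) ε :=
    Metric.eventually_nhds_iff.1 (γ.continuous.continuousAt.eventually
      (by rw [γ.source]; exact ball_mem_nhds (0 : ℂ) hε))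
  -- The path may start at a singular value, so near `t = 0` extension through the equation is
  -- unavailable; the given solution on the disc around `0` is used directly.
  have hbase : ∀ t : unitInterval, dist t 0 < δ → ∃ g, T.ContinuedTo γ Φ t g := by
    intro t ht
    have hs : ∀ s ≤ t, γ s ∈ ball (0 : ℂ) ε := fun s hst => hδγ s (lt_of_le_of_lt (by
      rw [Subtype.dist_eq, Subtype.dist_eq, Real.dist_eq, Real.dist_eq]
      simp only [Set.Icc.coe_zero, sub_zero, abs_of_nonneg s.2.1, abs_of_nonneg t.2.1]
      exact hst) ht)
    obtain ⟨E', hE'⟩ := hB.rebase (convex_ball 0 ε) isOpen_ball (mem_ball_self hε) (hs t le_rfl)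
    exact ⟨fun m p _ => Φ m p, fun _ _ => rfl, fun m p s hst =>
      (hB.differentiableOn m p).analyticAt (isOpen_ball.mem_nhds (hs s hst)),
      fun m p s hst => Eventually.of_forall fun _ => EventuallyEq.rfl,
      E', ball 0 ε, isOpen_ball.mem_nhds (hs t le_rfl), hE'⟩
  have hclosed : IsClosed (range T.a) := (Set.finite_range T.a).isClosed
  have hball : ∀ s : unitInterval, ∃ r > 0, s ≠ 0 → ∀ u ∈ ball (γ s) r, ∀ p, u ≠ T.a p := by
    intro s
    by_cases hs : s = 0
    · exact ⟨1, one_pos, fun h => absurd hs h⟩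
    · have : γ s ∈ (range T.a)ᶜ := by
        rintro ⟨p, hp⟩
        exact hγ s hs p hp.symm
      obtain ⟨r, hr, hr'⟩ := Metric.isOpen_iff.1 hclosed.isOpen_compl _ this
      exact ⟨r, hr, fun _ u hu p hp => hr' hu ⟨p, hp.symm⟩⟩
  choose r hr0 hr using hball
  -- A subdivision of the path, each piece of which lies either near the start or in a disc without
  -- singular values.
  obtain ⟨t, ht0, htm, ⟨n, hn⟩, htc⟩ := exists_monotone_Icc_subset_open_cover_unitInterval
    (c := fun s : unitInterval => if s = 0 then {x | dist x 0 < δ} else γ ⁻¹' ball (γ s) (r s))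
    (fun s => by
      split_ifs
      · exact isOpen_lt (by fun_prop) (by fun_prop)
      · exact isOpen_ball.preimage γ.continuous)
    (fun s _ => mem_iUnion.2 ⟨s, by
      split_ifs with hs
      · simpa [hs] using hδ
      · exact mem_ball_self (hr0 s)⟩)
  have hall : ∀ k, ∃ g, T.ContinuedTo γ Φ (t k) g := by
    intro k
    induction k with
    | zero => exact hbase _ (by simpa [ht0] using hδ)
    | succ k ih =>
      obtain ⟨g, hg⟩ := ih
      obtain ⟨s, hs⟩ := htc k
      have hle := htm (Nat.le_succ k)
      by_cases hs0 : s = 0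
      · rw [if_pos hs0] at hs
        exact hbase _ (hs ⟨hle, le_rfl⟩)
      · rw [if_neg hs0] at hs
        exact hg.step hle (convex_ball _ _) isOpen_ball (hr s hs0) fun q hq => hs hq
  have := hall n
  rwa [hn n le_rfl] at this

end ConvSystem

/-! ### Integrals over a half-line and the equation `y' + ν y = uⁱ G(exp u)`. -/

/-- Half of the exponential decay absorbs the polynomial factor, through `yⁱ / i! ≤ exp y` with `y =
κ (M - w)` and `κ = Re ν / 2`; the bound is uniform for `‖z‖ ≤ M`. -/
theorem exists_exp_mul_pow_le {ν : ℂ} (hν : 0 < ν.re) (M : ℝ) (i : ℕ) :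
    ∃ C : ℝ, ∀ (w : ℝ) (z : ℂ), w ≤ 0 → ‖z‖ ≤ M →
      ‖Complex.exp (ν * w) * (z + w) ^ i‖ ≤ C * Real.exp (ν.re / 2 * w) := by
  set κ := ν.re / 2 with hκ
  have hκ0 : 0 < κ := by positivity
  refine ⟨(i.factorial / κ ^ i) * Real.exp (κ * M), fun w z hw hz => ?_⟩
  have hM : 0 ≤ M := (norm_nonneg z).trans hz
  have h1 : ‖z + w‖ ≤ M - w := by
    refine (norm_add_le _ _).trans ?_
    rw [Complex.norm_real, Real.norm_of_nonpos hw]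
    linarith
  have h2 := Real.pow_div_factorial_le_exp (x := κ * (M - w)) (by nlinarith) i
  have h3 : (M - w) ^ i ≤ (i.factorial / κ ^ i) * Real.exp (κ * (M - w)) := by
    rw [mul_pow, div_le_iff₀ (by positivity)] at h2
    rw [div_mul_eq_mul_div, le_div_iff₀ (by positivity)]
    linarith
  rw [norm_mul, norm_pow, Complex.norm_exp]
  have h4 : (ν * (w : ℂ)).re = 2 * κ * w := by
    simp only [Complex.mul_re, Complex.ofReal_re, Complex.ofReal_im, mul_zero, sub_zero, hκ]; ring
  rw [h4]
  calc Real.exp (2 * κ * w) * ‖z + w‖ ^ i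
      ≤ Real.exp (2 * κ * w) * ((i.factorial / κ ^ i) * Real.exp (κ * (M - w))) := by
        gcongr
        exact (pow_le_pow_left₀ (norm_nonneg _) h1 i).trans h3
    _ = (i.factorial / κ ^ i) * (Real.exp (2 * κ * w) * Real.exp (κ * (M - w))) := by ring
    _ = (i.factorial / κ ^ i) * (Real.exp (κ * M) * Real.exp (κ * w)) := by
        rw [← Real.exp_add, ← Real.exp_add]; ring_nf
    _ = _ := by ring

theorem integrableOn_exp_half {ν : ℂ} (hν : 0 < ν.re) (C : ℝ) :
    IntegrableOn (fun w : ℝ => C * Real.exp (ν.re / 2 * w)) (Iic 0) :=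
  (integrableOn_exp_mul_Iic (by positivity) 0).const_mul C

/-- Holomorphy in `z` of the integral over `w ≤ 0` of `exp (ν w) (p(z) + w)ⁱ Q(z, w)`. -/
theorem hasDerivAt_expInt {ν : ℂ} (hν : 0 < ν.re) (i : ℕ) {U : Set ℂ} (hU : IsOpen U)
    {p : ℂ → ℂ} (hp : DifferentiableOn ℂ p U) {Q : ℂ → ℝ → ℂ}
    (hQc : ∀ z ∈ U, ContinuousOn (Q z) (Iic 0))
    (hQd : ∀ w ≤ 0, DifferentiableOn ℂ (fun z => Q z w) U) {z : ℂ} (hz : z ∈ U)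
    (hQb : ∃ C : ℝ, ∀ᶠ z' in 𝓝 z, ∀ w ≤ 0, ‖Q z' w‖ ≤ C) :
    IntegrableOn (fun w : ℝ => Complex.exp (ν * w) * (p z + w) ^ i * Q z w) (Iic 0) ∧
    IntegrableOn (fun w : ℝ => deriv (fun z => Complex.exp (ν * w) * (p z + w) ^ i * Q z w) z)
      (Iic 0) ∧
    HasDerivAt (fun z => ∫ w : ℝ in Iic 0, Complex.exp (ν * w) * (p z + w) ^ i * Q z w)
      (∫ w : ℝ in Iic 0, deriv (fun z => Complex.exp (ν * w) * (p z + w) ^ i * Q z w) z) z := by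
  obtain ⟨C, hC⟩ := hQb
  have hpc : ContinuousAt p z := (hp.differentiableAt (hU.mem_nhds hz)).continuousAt
  have hpb : ∀ᶠ z' in 𝓝 z, ‖p z'‖ ≤ ‖p z‖ + 1 :=
    (hpc.norm.eventually_lt continuousAt_const (by simp)).mono fun _ h => h.le
  obtain ⟨ε, hε, hball⟩ := Metric.eventually_nhds_iff_ball.1 (hC.and hpb)
  obtain ⟨D, hD⟩ := exists_exp_mul_pow_le hν (‖p z‖ + 1) i
  have hmeas : ∀ z ∈ U, AEStronglyMeasurable
      (fun w : ℝ => Complex.exp (ν * w) * (p z + w) ^ i * Q z w) (volume.restrict (Iic 0)) := by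
    intro z hz
    refine ContinuousOn.aestronglyMeasurable ?_ measurableSet_Iic
    exact ContinuousOn.mul (by fun_prop) (hQc z hz)
  have hbd : ∀ᵐ w : ℝ ∂(volume.restrict (Iic 0)), ∀ z' ∈ ball z ε,
      ‖Complex.exp (ν * w) * (p z' + w) ^ i * Q z' w‖ ≤ D * Real.exp (ν.re / 2 * w) * C := by
    filter_upwards [ae_restrict_mem measurableSet_Iic] with w hw z' hz'
    have h1 := hD w (p z') hw (hball z' hz').2
    rw [norm_mul]
    exact mul_le_mul h1 ((hball z' hz').1 w hw) (norm_nonneg _) ((norm_nonneg _).trans h1)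
  have hbi := (integrableOn_exp_half hν D).mul_const C
  refine ⟨hbi.mono' (hmeas z hz) ?_, ?_⟩
  · filter_upwards [hbd] with w hw using hw z (mem_ball_self hε)
  · refine hasDerivAt_integral_of_locally_dominated hU hmeas ?_ hz ⟨ε, hε, _, hbi, hbd⟩
    filter_upwards [ae_restrict_mem measurableSet_Iic] with w hw
    exact ((differentiableOn_const _).mul ((hp.add_const _).pow i)).mul (hQd w hw)

/-- The half-plane `|exp u| < r`. -/
def logPlane (r : ℝ) : Set ℂ := {u | ‖Complex.exp u‖ < r}

theorem mem_logPlane {r : ℝ} {u : ℂ} : u ∈ logPlane r ↔ Complex.exp u ∈ ball (0 : ℂ) r := by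
  simp [logPlane]

theorem isOpen_logPlane (r : ℝ) : IsOpen (logPlane r) :=
  isOpen_lt (by fun_prop) continuous_const

theorem convex_logPlane {r : ℝ} (hr : 0 < r) : Convex ℝ (logPlane r) := by
  have : logPlane r = {u : ℂ | u.re < Real.log r} := by
    ext u
    rw [logPlane, mem_ofPred_eq, mem_ofPred_eq, Complex.norm_exp, Real.lt_log_iff_exp_lt hr]
  rw [this]
  exact convex_halfSpace_re_lt _

theorem add_mem_logPlane {r : ℝ} {u : ℂ} (hu : u ∈ logPlane r) {w : ℝ} (hw : w ≤ 0) :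
    u + w ∈ logPlane r := by
  simp only [logPlane, mem_ofPred_eq, Complex.norm_exp] at hu ⊢
  refine lt_of_le_of_lt (Real.exp_le_exp.2 ?_) hu
  simpa using hw

theorem mapsTo_exp (r : ℝ) : MapsTo Complex.exp (logPlane r) (ball 0 r) := fun _ hu =>
  mem_logPlane.1 hu

theorem exists_closedBall_mem {r : ℝ} {x : ℂ} (hx : x ∈ ball (0 : ℂ) r) :
    ∃ ρ, (∀ᶠ x' in 𝓝 x, x' ∈ closedBall (0 : ℂ) ρ) ∧ closedBall (0 : ℂ) ρ ⊆ ball 0 r := by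
  obtain ⟨ρ, h1, h2⟩ := exists_between (mem_ball_zero_iff.1 hx)
  refine ⟨ρ, ?_, closedBall_subset_ball h2⟩
  filter_upwards [isOpen_ball.mem_nhds (mem_ball_zero_iff.2 h1)] with x' hx'
  exact ball_subset_closedBall hx'

theorem norm_exp_mul_le (x : ℂ) {w : ℝ} (hw : w ≤ 0) : ‖x * Complex.exp w‖ ≤ ‖x‖ := by
  rw [norm_mul, Complex.norm_exp, Complex.ofReal_re]
  exact mul_le_of_le_one_right (norm_nonneg _) (Real.exp_le_one_iff.2 hw)

/-- The solution of `y' + ν y = uⁱ G(exp u)` without homogeneous part. -/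
def logInt (ν : ℂ) (i : ℕ) (G : ℂ → ℂ) (u : ℂ) : ℂ :=
  ∫ w : ℝ in Iic 0, Complex.exp (ν * w) * (u + w) ^ i * G (Complex.exp (u + w))

/-- The integrand is `exp (ν w) g(u + w)` with `g v = vⁱ G(exp v)`, so its derivative in `u` is its
derivative in `w` minus `ν` times itself. The former integrates to the boundary value `g u`, the
contribution at `-∞` being zero since `Re ν > 0`. -/
theorem hasDerivAt_logInt {ν : ℂ} (hν : 0 < ν.re) (i : ℕ) {r : ℝ} {G : ℂ → ℂ}
    (hG : DifferentiableOn ℂ G (ball 0 r)) {u : ℂ} (hu : u ∈ logPlane r) :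
    HasDerivAt (logInt ν i G) (u ^ i * G (Complex.exp u) - ν * logInt ν i G u) u := by
  have hQd : ∀ w : ℝ, w ≤ 0 →
      DifferentiableOn ℂ (fun z => G (Complex.exp (z + w))) (logPlane r) := fun w hw =>
    hG.comp (by fun_prop) fun z hz => mapsTo_exp r (add_mem_logPlane hz hw)
  have hb : ∃ C : ℝ, ∀ᶠ z' in 𝓝 u, ∀ w : ℝ, w ≤ 0 → ‖G (Complex.exp (z' + w))‖ ≤ C := by
    obtain ⟨ρ, h1, h2⟩ := exists_closedBall_mem (mapsTo_exp r hu)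
    obtain ⟨C, hC⟩ := (isCompact_closedBall (0 : ℂ) ρ).exists_bound_of_continuousOn
      (hG.continuousOn.mono h2)
    refine ⟨C, ?_⟩
    filter_upwards [Complex.continuous_exp.continuousAt.eventually h1] with z' hz' w hw
    refine hC _ ?_
    rw [Complex.exp_add, mem_closedBall_zero_iff]
    exact (norm_exp_mul_le _ hw).trans (mem_closedBall_zero_iff.1 hz')
  obtain ⟨hi, hi', hder⟩ := hasDerivAt_expInt hν i (isOpen_logPlane r) (p := fun z => z)
    differentiableOn_id (Q := fun z w => G (Complex.exp (z + w)))
    (fun z hz => hG.continuousOn.comp (by fun_prop)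
      fun w hw => mapsTo_exp r (add_mem_logPlane hz hw)) hQd hu hb
  refine HasDerivAt.congr_deriv (f := logInt ν i G) hder ?_
  set g : ℂ → ℂ := fun v => v ^ i * G (Complex.exp v) with hg
  have hgd : ∀ v ∈ logPlane r, HasDerivAt g (deriv g v) v := fun v hv =>
    DifferentiableAt.hasDerivAt (((differentiableOn_id.pow i).mul (hG.comp (by fun_prop)
      (mapsTo_exp r))).differentiableAt ((isOpen_logPlane r).mem_nhds hv))
  have hd1 : ∀ w : ℝ, w ≤ 0 →
      deriv (fun z : ℂ => Complex.exp (ν * w) * (z + w) ^ i * G (Complex.exp (z + w))) u =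
        Complex.exp (ν * w) * deriv g (u + w) := by
    intro w hw
    have := (((hgd _ (add_mem_logPlane hu hw)).comp u ((hasDerivAt_id u).add_const (w : ℂ))).const_mul
      (Complex.exp (ν * w))).deriv
    simpa [hg, Function.comp_def, mul_assoc] using this
  have hFTC := integral_Iic_of_hasDerivAt_of_tendsto' (a := (0 : ℝ)) (m := (0 : ℂ))
    (f := fun w : ℝ => Complex.exp (ν * w) * (u + w) ^ i * G (Complex.exp (u + w)))
    (f' := fun w : ℝ =>
      deriv (fun z : ℂ => Complex.exp (ν * w) * (z + w) ^ i * G (Complex.exp (z + w))) u +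
      ν * (Complex.exp (ν * w) * (u + w) ^ i * G (Complex.exp (u + w)))) ?_ ?_ ?_
  · rw [integral_add hi' (hi.const_mul ν), integral_const_mul] at hFTC
    simp only [Complex.ofReal_zero, mul_zero, Complex.exp_zero, add_zero, one_mul, sub_zero]
      at hFTC
    rw [logInt]
    linear_combination hFTC
  · intro w hw
    have hw' : w ≤ 0 := hw
    rw [hd1 w hw']
    have h1 : HasDerivAt (fun w : ℝ => Complex.exp (ν * w)) (Complex.exp (ν * w) * ν) w := by
      have := ((Complex.ofRealCLM.hasDerivAt (x := w)).const_mul ν).cexp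
      simpa using this
    have h2 : HasDerivAt (fun w : ℝ => u + (w : ℂ)) 1 w := by
      simpa using (Complex.ofRealCLM.hasDerivAt (x := w)).const_add u
    have h3 := h1.mul ((hgd _ (add_mem_logPlane hu hw')).comp w h2)
    refine (h3.congr_deriv ?_).congr_of_eventuallyEq (Eventually.of_forall fun w => ?_)
    · simp only [hg, Function.comp_apply]; ring
    · simp [hg, mul_assoc]
  · exact hi'.add (hi.const_mul ν)
  · obtain ⟨C, hC⟩ := hb
    obtain ⟨D, hD⟩ := exists_exp_mul_pow_le hν ‖u‖ i
    have hlim : Tendsto (fun w : ℝ => D * Real.exp (ν.re / 2 * w) * C) atBot (𝓝 0) := by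
      have : Tendsto (fun w : ℝ => Real.exp (ν.re / 2 * w)) atBot (𝓝 0) :=
        Real.tendsto_exp_atBot.comp (tendsto_id.const_mul_atBot (by positivity))
      simpa using (this.const_mul D).mul_const C
    refine squeeze_zero_norm' ?_ hlim
    filter_upwards [eventually_le_atBot (0 : ℝ)] with w hw
    have h1 := hD w u hw le_rfl
    rw [norm_mul]
    exact mul_le_mul h1 (hC.self_of_nhds w hw) (norm_nonneg _) ((norm_nonneg _).trans h1)

/-- The coefficients of the expansion of `logInt` in powers of `u`. -/
def logCoeff (ν : ℂ) (l : ℕ) (k : ℂ → ℂ → ℂ) (x : ℂ) : ℂ :=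
  ∫ w : ℝ in Iic 0, Complex.exp (ν * w) * (0 + w) ^ l * k x (x * Complex.exp w)

theorem integrableOn_and_differentiableAt_logCoeff {ν : ℂ} (hν : 0 < ν.re) (l : ℕ) {r : ℝ} {b c : ℂ → ℂ}
    (hb : Differentiable ℂ b) (hc : DifferentiableOn ℂ c (ball 0 r)) {x : ℂ}
    (hx : x ∈ ball (0 : ℂ) r) :
    IntegrableOn (fun w : ℝ => Complex.exp (ν * w) * (0 + w) ^ l *
      (b (x - x * Complex.exp w) * c (x * Complex.exp w))) (Iic 0) ∧
    DifferentiableAt ℂ (logCoeff ν l fun x y => b (x - y) * c y) x := by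
  have hm : ∀ x ∈ ball (0 : ℂ) r, ∀ w : ℝ, w ≤ 0 → x * Complex.exp w ∈ ball (0 : ℂ) r :=
    fun x hx w hw => mem_ball_zero_iff.2
      ((norm_exp_mul_le x hw).trans_lt (mem_ball_zero_iff.1 hx))
  have h := hasDerivAt_expInt hν l isOpen_ball (p := fun _ => 0) (differentiableOn_const 0)
    (Q := fun x w => b (x - x * Complex.exp w) * c (x * Complex.exp w))
    (fun x hx => (hb.continuous.comp_continuousOn (by fun_prop)).mul
      (hc.continuousOn.comp (by fun_prop) fun w hw => hm x hx w hw))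
    (fun w hw => (hb.comp_differentiableOn (by fun_prop)).mul
      (hc.comp (by fun_prop) fun x hx => hm x hx w hw)) hx ?_
  · exact ⟨h.1, h.2.2.differentiableAt⟩
  · obtain ⟨ρ, h1, h2⟩ := exists_closedBall_mem hx
    obtain ⟨C, hC⟩ := (isCompact_closedBall (0 : ℂ) ρ).exists_bound_of_continuousOn
      (hc.continuousOn.mono h2)
    obtain ⟨D, hD⟩ := (isCompact_closedBall (0 : ℂ) (2 * ρ)).exists_bound_of_continuousOn
      hb.continuous.continuousOn
    refine ⟨D * C, h1.mono fun x' hx' w hw => ?_⟩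
    rw [mem_closedBall_zero_iff] at hx'
    have h3 := (norm_exp_mul_le x' hw).trans hx'
    have h4 : ‖b (x' - x' * Complex.exp w)‖ ≤ D := hD _ (mem_closedBall_zero_iff.2 (by
      refine (norm_sub_le _ _).trans ?_; linarith))
    rw [norm_mul]
    exact mul_le_mul h4 (hC _ (mem_closedBall_zero_iff.2 h3)) (norm_nonneg _)
      ((norm_nonneg _).trans h4)

/-- The binomial expansion of `(u + w)ⁱ` shows that the integral is a polynomial in the logarithm of
degree at most `i`, with coefficients holomorphic in `exp u`: no power of the logarithm is gained.
-/
theorem logInt_expand {ν : ℂ} (hν : 0 < ν.re) (i : ℕ) {r : ℝ} {b c : ℂ → ℂ}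
    (hb : Differentiable ℂ b) (hc : DifferentiableOn ℂ c (ball 0 r)) {u : ℂ}
    (hu : u ∈ logPlane r) :
    logInt ν i (fun y => b (Complex.exp u - y) * c y) u =
      ∑ l ∈ Finset.range (i + 1), ((i.choose l : ℂ) *
        logCoeff ν (i - l) (fun x y => b (x - y) * c y) (Complex.exp u)) * u ^ l := by
  simp only [logCoeff, logInt]
  have : ∀ w : ℝ, Complex.exp (ν * w) * (u + w) ^ i *
      (b (Complex.exp u - Complex.exp (u + w)) * c (Complex.exp (u + w))) =
      ∑ l ∈ Finset.range (i + 1), (i.choose l * u ^ l) * (Complex.exp (ν * w) * (0 + w) ^ (i - l) *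
        (b (Complex.exp u - Complex.exp u * Complex.exp w) *
          c (Complex.exp u * Complex.exp w))) := by
    intro w
    rw [add_pow, Complex.exp_add, Finset.mul_sum, Finset.sum_mul]
    refine Finset.sum_congr rfl fun l _ => ?_
    rw [zero_add]; ring
  simp only [this]
  rw [integral_finsetSum]
  · refine Finset.sum_congr rfl fun l _ => ?_
    rw [integral_const_mul]
    ring
  · intro l _
    exact ((integrableOn_and_differentiableAt_logCoeff hν (i - l) hb hc (mapsTo_exp r hu)).1).const_mul _

/-- Used for the lower boundary term of a convolution, where `u` is the fixed base point and `x` the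
variable. -/
theorem differentiable_logInt_param {ν : ℂ} (hν : 0 < ν.re) (i : ℕ) {r : ℝ} {b c : ℂ → ℂ}
    (hb : Differentiable ℂ b) (hc : DifferentiableOn ℂ c (ball 0 r)) {u : ℂ}
    (hu : u ∈ logPlane r) :
    Differentiable ℂ fun x => logInt ν i (fun y => b (x - y) * c y) u := by
  intro x
  have hm : ∀ w : ℝ, w ≤ 0 → Complex.exp (u + w) ∈ closedBall (0 : ℂ) ‖Complex.exp u‖ :=
    fun w hw => mem_closedBall_zero_iff.2 (by
      rw [Complex.exp_add]; exact norm_exp_mul_le _ hw)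
  have hsub : closedBall (0 : ℂ) ‖Complex.exp u‖ ⊆ ball 0 r := closedBall_subset_ball hu
  refine (hasDerivAt_expInt hν i isOpen_univ (p := fun _ => u) (differentiableOn_const u)
    (Q := fun x w => b (x - Complex.exp (u + w)) * c (Complex.exp (u + w)))
    (fun x _ => (hb.continuous.comp_continuousOn (by fun_prop)).mul
      (hc.continuousOn.comp (by fun_prop) fun w hw => hsub (hm w hw)))
    (fun w hw => (hb.comp_differentiableOn (by fun_prop)).mul_const _) (mem_univ x)
    ?_).2.2.differentiableAt
  obtain ⟨C, hC⟩ := (isCompact_closedBall (0 : ℂ) ‖Complex.exp u‖).exists_bound_of_continuousOn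
    (hc.continuousOn.mono hsub)
  obtain ⟨D, hD⟩ := (isCompact_closedBall (0 : ℂ)
    (‖x‖ + 1 + ‖Complex.exp u‖)).exists_bound_of_continuousOn hb.continuous.continuousOn
  have hx : ∀ᶠ x' in 𝓝 x, ‖x'‖ ≤ ‖x‖ + 1 :=
    (continuousAt_id.norm.eventually_lt continuousAt_const (by simp)).mono fun _ h => h.le
  refine ⟨D * C, hx.mono fun x' hx' w hw => ?_⟩
  have h4 : ‖b (x' - Complex.exp (u + w))‖ ≤ D := hD _ (mem_closedBall_zero_iff.2 (by
    refine (norm_sub_le _ _).trans ?_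
    have := mem_closedBall_zero_iff.1 (hm w hw)
    linarith))
  rw [norm_mul]
  exact mul_le_mul h4 (hC _ (hm w hw)) (norm_nonneg _) ((norm_nonneg _).trans h4)

theorem eqOn_const_of_hasDerivAt_zero {U : Set ℂ} (hU : Convex ℝ U) {f : ℂ → ℂ}
    (hf : ∀ u ∈ U, HasDerivAt f 0 u) {u₀ u : ℂ} (h0 : u₀ ∈ U) (hu : u ∈ U) : f u = f u₀ := by
  have h1 := segInt_eq_sub hU h0 hu (f := fun _ => 0) continuousOn_const hf
  have h2 : segInt u₀ u (fun _ => 0) = 0 := by simp [segInt]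
  exact sub_eq_zero.1 (h1.symm.trans h2)

theorem intervalIntegrable_segment {U : Set ℂ} (hU : Convex ℝ U) {a b : ℂ} (ha : a ∈ U)
    (hb : b ∈ U) {f : ℂ → ℂ} (hf : ContinuousOn f U) :
    IntervalIntegrable (fun t : ℝ => (b - a) * f (a + t * (b - a))) volume 0 1 := by
  refine ContinuousOn.intervalIntegrable ?_
  rw [uIcc_of_le zero_le_one]
  exact continuousOn_const.mul (hf.comp (by fun_prop) fun t ht => segment_mem hU ha hb ht)

theorem segInt_fun_add {U : Set ℂ} (hU : Convex ℝ U) {a b : ℂ} (ha : a ∈ U) (hb : b ∈ U)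
    {f g : ℂ → ℂ} (hf : ContinuousOn f U) (hg : ContinuousOn g U) :
    segInt a b (fun v => f v + g v) = segInt a b f + segInt a b g := by
  simp only [segInt, mul_add]
  exact intervalIntegral.integral_add (intervalIntegrable_segment hU ha hb hf)
    (intervalIntegrable_segment hU ha hb hg)

/-! ### Classes of functions with powers and logarithms. -/

section LogClass

variable {κ : Type*} [Fintype κ] {r : ℝ} {μ : κ → ℂ} {d : κ → ℕ} {f g : ℂ → ℂ}

/-- Functions `∑ₖ ξ^{μₖ} ∑_{i < dₖ} c_{k,i}(ξ) (ln ξ)ⁱ` of `ξ = exp u`, with `c` holomorphic. -/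
def LogClass (r : ℝ) (μ : κ → ℂ) (d : κ → ℕ) (f : ℂ → ℂ) : Prop :=
  ∃ c : κ → ℕ → ℂ → ℂ, (∀ k i, DifferentiableOn ℂ (c k i) (ball 0 r)) ∧
    ∀ u ∈ logPlane r, f u = ∑ k, Complex.exp (μ k * u) *
      ∑ i ∈ Finset.range (d k), c k i (Complex.exp u) * u ^ i

theorem LogClass.congr (h : LogClass r μ d f) (hfg : ∀ u ∈ logPlane r, g u = f u) :
    LogClass r μ d g :=
  let ⟨c, hc, hf⟩ := h
  ⟨c, hc, fun u hu => (hfg u hu).trans (hf u hu)⟩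

theorem LogClass.zero : LogClass r μ d fun _ => 0 :=
  ⟨fun _ _ _ => 0, fun _ _ => differentiableOn_const 0, fun u _ => by simp⟩

theorem LogClass.add (hf : LogClass r μ d f) (hg : LogClass r μ d g) :
    LogClass r μ d fun u => f u + g u := by
  obtain ⟨c, hc, hf⟩ := hf
  obtain ⟨e, he, hg⟩ := hg
  refine ⟨fun k i x => c k i x + e k i x, fun k i => (hc k i).add (he k i), fun u hu => ?_⟩
  simp only [hf u hu, hg u hu, add_mul, Finset.sum_add_distrib, mul_add]

theorem LogClass.hol_mul (hf : LogClass r μ d f) {b : ℂ → ℂ}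
    (hb : DifferentiableOn ℂ b (ball 0 r)) : LogClass r μ d fun u => b (Complex.exp u) * f u := by
  obtain ⟨c, hc, hf⟩ := hf
  refine ⟨fun k i x => b x * c k i x, fun k i => hb.mul (hc k i), fun u hu => ?_⟩
  simp only [hf u hu, Finset.mul_sum]
  exact Finset.sum_congr rfl fun k _ => Finset.sum_congr rfl fun i _ => by ring

theorem LogClass.const_mul (hf : LogClass r μ d f) (b : ℂ) : LogClass r μ d fun u => b * f u :=
  hf.hol_mul (differentiableOn_const b)

theorem LogClass.sum {ι : Type*} (s : Finset ι) {F : ι → ℂ → ℂ}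
    (h : ∀ i ∈ s, LogClass r μ d (F i)) : LogClass r μ d fun u => ∑ i ∈ s, F i u := by
  classical
  induction s using Finset.induction_on with
  | empty => simpa using LogClass.zero
  | insert i s hi ih =>
    simp only [Finset.sum_insert hi]
    exact (h i (Finset.mem_insert_self i s)).add
      (ih fun j hj => h j (Finset.mem_insert_of_mem hj))

theorem LogClass.mono {d' : κ → ℕ} (hd : d ≤ d') (hf : LogClass r μ d f) : LogClass r μ d' f := by
  obtain ⟨c, hc, hf⟩ := hf
  refine ⟨fun k i => if i < d k then c k i else fun _ => 0, fun k i => ?_, fun u hu => ?_⟩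
  · dsimp only
    split_ifs
    · exact hc k i
    · exact differentiableOn_const 0
  · rw [hf u hu]
    refine Finset.sum_congr rfl fun k _ => congrArg _ ?_
    refine Finset.sum_subset_zero_on_sdiff (Finset.range_subset_range.2 (hd k)) ?_ ?_
    · intro i hi
      simp only [Finset.mem_sdiff, Finset.mem_range] at hi
      simp [hi.2]
    · intro i hi
      simp [Finset.mem_range.1 hi]

theorem LogClass.poly {k : κ} {n : ℕ} (hn : n ≤ d k) {c : ℕ → ℂ → ℂ}
    (hc : ∀ i, DifferentiableOn ℂ (c i) (ball 0 r)) :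
    LogClass r μ d fun u => Complex.exp (μ k * u) *
      ∑ i ∈ Finset.range n, c i (Complex.exp u) * u ^ i := by
  classical
  refine LogClass.mono (d := fun k' => if k' = k then n else 0) ?_
    ⟨fun _ => c, fun _ => hc, fun u _ => ?_⟩
  · intro k'
    simp only
    split_ifs with h
    · exact h ▸ hn
    · exact Nat.zero_le _
  · rw [Finset.sum_eq_single k]
    · simp
    · intro k' _ h
      simp [h]
    · simp

theorem LogClass.atom {k : κ} {i : ℕ} (hi : i < d k) {c : ℂ → ℂ}
    (hc : DifferentiableOn ℂ c (ball 0 r)) :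
    LogClass r μ d fun u => Complex.exp (μ k * u) * (c (Complex.exp u) * u ^ i) := by
  refine (LogClass.poly (μ := μ) hi (c := fun j => if j = i then c else fun _ => 0)
    fun j => ?_).congr fun u _ => ?_
  · split_ifs
    · exact hc
    · exact differentiableOn_const 0
  · rw [Finset.sum_eq_single_of_mem i (by simp)]
    · simp
    · intro j _ hj
      simp [hj]

theorem LogClass.hol (h : ∃ k, μ k = 0 ∧ 0 < d k) {c : ℂ → ℂ}
    (hc : DifferentiableOn ℂ c (ball 0 r)) : LogClass r μ d fun u => c (Complex.exp u) := by
  obtain ⟨k, hk, hd⟩ := h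
  refine (LogClass.atom (μ := μ) hd hc).congr fun u _ => ?_
  simp [hk]

/-- Reduces an additive property to a single term `ξ^μ c(ξ) (ln ξ)ⁱ`. -/
theorem LogClass.induction {Q : (ℂ → ℂ) → Prop} (h0 : Q fun _ => 0)
    (hadd : ∀ f g, Q f → Q g → Q fun u => f u + g u)
    (hcongr : ∀ f g, (∀ u ∈ logPlane r, g u = f u) → Q f → Q g)
    (hatom : ∀ k, ∀ i < d k, ∀ c, DifferentiableOn ℂ c (ball 0 r) →
      Q fun u => Complex.exp (μ k * u) * (c (Complex.exp u) * u ^ i))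
    (hf : LogClass r μ d f) : Q f := by
  classical
  have hsum : ∀ {ι : Type _} (s : Finset ι) (F : ι → ℂ → ℂ), (∀ i ∈ s, Q (F i)) →
      Q fun u => ∑ i ∈ s, F i u := by
    intro ι s F h
    induction s using Finset.induction_on with
    | empty => simpa using h0
    | insert i s hi ih =>
      simp only [Finset.sum_insert hi]
      exact hadd _ _ (h i (Finset.mem_insert_self i s))
        (ih fun j hj => h j (Finset.mem_insert_of_mem hj))
  obtain ⟨c, hc, hf⟩ := hf
  refine hcongr _ _ (fun u hu => (hf u hu).trans ?_) (hsum (Finset.univ.sigma fun k =>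
    Finset.range (d k)) (fun q u => Complex.exp (μ q.1 * u) * (c q.1 q.2 (Complex.exp u) * u ^ q.2))
    fun q hq => hatom q.1 q.2 (by simpa using hq) _ (hc q.1 q.2))
  rw [Finset.sum_sigma]
  simp only [Finset.mul_sum]

theorem LogClass.hasDerivAt (hf : LogClass r μ d f) :
    ∃ f', LogClass r μ d f' ∧ ∀ u ∈ logPlane r, HasDerivAt f (f' u) u := by
  refine hf.induction (Q := fun f => ∃ f', LogClass r μ d f' ∧
    ∀ u ∈ logPlane r, HasDerivAt f (f' u) u)
    ⟨_, LogClass.zero, fun u _ => hasDerivAt_const u 0⟩ ?_ ?_ ?_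
  · rintro f g ⟨f', hf', h1⟩ ⟨g', hg', h2⟩
    exact ⟨_, hf'.add hg', fun u hu => (h1 u hu).add (h2 u hu)⟩
  · rintro f g hfg ⟨f', hf', h1⟩
    exact ⟨f', hf', fun u hu => (h1 u hu).congr_of_eventuallyEq
      (Filter.eventuallyEq_of_mem ((isOpen_logPlane r).mem_nhds hu) hfg)⟩
  · intro k i hi c hc
    have hc' := hc.deriv isOpen_ball
    -- For `i = 0` the second term has coefficient `i = 0`, so the truncated exponent `i - 1` is
    -- harmless.
    refine ⟨_, ((LogClass.atom hi (c := fun x => μ k * c x + x * deriv c x)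
      ((hc.const_mul _).add (differentiableOn_id.mul hc'))).add
      (LogClass.atom (k := k) (i := i - 1) (by omega) (hc.const_mul (i : ℂ)))), fun u hu => ?_⟩
    have h1 : HasDerivAt (fun u => Complex.exp (μ k * u)) (Complex.exp (μ k * u) * μ k) u := by
      simpa using ((hasDerivAt_id u).const_mul (μ k)).cexp
    have h2 : HasDerivAt (fun u => c (Complex.exp u)) (deriv c (Complex.exp u) * Complex.exp u) u :=
      ((hc.differentiableAt (isOpen_ball.mem_nhds (mapsTo_exp r hu))).hasDerivAt).comp u
        (Complex.hasDerivAt_exp u)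
    refine (h1.mul (h2.mul (hasDerivAt_pow i u))).congr_deriv ?_
    simp only [Pi.mul_apply]
    ring

theorem LogClass.differentiableOn (hf : LogClass r μ d f) : DifferentiableOn ℂ f (logPlane r) :=
  let ⟨_, _, h⟩ := hf.hasDerivAt
  fun u hu => (h u hu).differentiableAt.differentiableWithinAt

/-- The equation `χ' + (1 - s) χ = g` has a solution in the class, without resonance. -/
theorem LogClass.solve (hμ : ∀ k, 0 ≤ (μ k).re) {s : ℂ} (hs : s.re < 1) (hg : LogClass r μ d g) :
    ∃ χ, LogClass r μ d χ ∧ ∀ u ∈ logPlane r, HasDerivAt χ (g u - (1 - s) * χ u) u := by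
  refine hg.induction (Q := fun g => ∃ χ, LogClass r μ d χ ∧
    ∀ u ∈ logPlane r, HasDerivAt χ (g u - (1 - s) * χ u) u)
    ⟨_, LogClass.zero, fun u _ => by simpa using hasDerivAt_const u (0 : ℂ)⟩
    ?_ ?_ ?_
  · rintro f g ⟨f', hf', h1⟩ ⟨g', hg', h2⟩
    exact ⟨_, hf'.add hg', fun u hu => ((h1 u hu).add (h2 u hu)).congr_deriv (by ring)⟩
  · rintro f g hfg ⟨f', hf', h1⟩
    exact ⟨f', hf', fun u hu => by rw [hfg u hu]; exact h1 u hu⟩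
  · intro k i hi c hc
    have hν : 0 < (1 - s + μ k).re := by
      have := hμ k
      simp only [Complex.add_re, Complex.sub_re, Complex.one_re]
      linarith
    refine ⟨fun u => Complex.exp (μ k * u) * logInt (1 - s + μ k) i c u, ?_, fun u hu => ?_⟩
    · refine (LogClass.poly (k := k) (n := i + 1) hi (c := fun l x => (i.choose l : ℂ) *
        logCoeff (1 - s + μ k) (i - l) (fun x y => 1 * c y) x) fun l => ?_).congr fun u hu => ?_
      · exact DifferentiableOn.const_mul (fun x hx => (integrableOn_and_differentiableAt_logCoeff hν
          (i - l) (b := fun _ => 1) (differentiable_const 1) hc hx).2.differentiableWithinAt) _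
      · rw [← logInt_expand hν i (b := fun _ => 1) (differentiable_const 1) hc hu]
        simp only [one_mul]
    · have h1 : HasDerivAt (fun u => Complex.exp (μ k * u)) (Complex.exp (μ k * u) * μ k) u := by
        simpa using ((hasDerivAt_id u).const_mul (μ k)).cexp
      refine (h1.mul (hasDerivAt_logInt hν i hc hu)).congr_deriv ?_
      ring

/-- Functions `ξ g + h(ξ)` of `ξ = exp u`, with `g` in the class and `h` holomorphic. -/
def LogClassPlus (r : ℝ) (μ : κ → ℂ) (d : κ → ℕ) (f : ℂ → ℂ) : Prop :=
  ∃ g h : ℂ → ℂ, LogClass r μ d g ∧ DifferentiableOn ℂ h (ball 0 r) ∧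
    ∀ u ∈ logPlane r, f u = Complex.exp u * g u + h (Complex.exp u)

theorem LogClassPlus.congr (h : LogClassPlus r μ d f) (hfg : ∀ u ∈ logPlane r, g u = f u) :
    LogClassPlus r μ d g :=
  let ⟨c, e, hc, he, hf⟩ := h
  ⟨c, e, hc, he, fun u hu => (hfg u hu).trans (hf u hu)⟩

theorem LogClassPlus.hol {c : ℂ → ℂ} (hc : DifferentiableOn ℂ c (ball 0 r)) :
    LogClassPlus r μ d fun u => c (Complex.exp u) :=
  ⟨_, c, LogClass.zero, hc, fun u _ => by simp⟩

theorem LogClassPlus.add (hf : LogClassPlus r μ d f) (hg : LogClassPlus r μ d g) :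
    LogClassPlus r μ d fun u => f u + g u := by
  obtain ⟨c, h, hc, hh, hf⟩ := hf
  obtain ⟨c', h', hc', hh', hg⟩ := hg
  exact ⟨_, fun x => h x + h' x, hc.add hc', hh.add hh', fun u hu => by
    simp only [hf u hu, hg u hu]; ring⟩

theorem LogClassPlus.sum {ι : Type*} (s : Finset ι) {F : ι → ℂ → ℂ}
    (h : ∀ i ∈ s, LogClassPlus r μ d (F i)) : LogClassPlus r μ d fun u => ∑ i ∈ s, F i u := by
  classical
  induction s using Finset.induction_on with
  | empty => simpa using LogClassPlus.hol (differentiableOn_const (0 : ℂ))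
  | insert i s hi ih =>
    simp only [Finset.sum_insert hi]
    exact (h i (Finset.mem_insert_self i s)).add
      (ih fun j hj => h j (Finset.mem_insert_of_mem hj))

theorem LogClassPlus.mono {d' : κ → ℕ} (hd : d ≤ d') (hf : LogClassPlus r μ d f) :
    LogClassPlus r μ d' f :=
  let ⟨c, e, hc, he, hf⟩ := hf
  ⟨c, e, hc.mono hd, he, hf⟩

theorem LogClassPlus.logClass (h : ∃ k, μ k = 0 ∧ 0 < d k) (hf : LogClassPlus r μ d f) :
    LogClass r μ d f :=
  let ⟨_, _, hg, hh, hf⟩ := hf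
  ((hg.hol_mul differentiableOn_id).add (LogClass.hol h hh)).congr hf

/-- The derivative keeps the factor `exp u`, because `d/du = ξ d/dξ`. This is what allows division
of the equation of a singular entry by `ξ`. -/
theorem LogClassPlus.hasDerivAt (h : ∃ k, μ k = 0 ∧ 0 < d k) (hf : LogClassPlus r μ d f) :
    ∃ g, LogClass r μ d g ∧ ∀ u ∈ logPlane r, HasDerivAt f (Complex.exp u * g u) u := by
  obtain ⟨g, e, hg, he, hf⟩ := hf
  obtain ⟨g', hg', h1⟩ := hg.hasDerivAt
  refine ⟨_, (hg.add hg').add (LogClass.hol h (he.deriv isOpen_ball)), fun u hu => ?_⟩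
  have h2 : HasDerivAt (fun u => e (Complex.exp u)) (deriv e (Complex.exp u) * Complex.exp u) u :=
    ((he.differentiableAt (isOpen_ball.mem_nhds (mapsTo_exp r hu))).hasDerivAt).comp u
      (Complex.hasDerivAt_exp u)
  refine ((((Complex.hasDerivAt_exp u).mul (h1 u hu)).add h2).congr_of_eventuallyEq
    (Filter.eventuallyEq_of_mem ((isOpen_logPlane r).mem_nhds hu) hf)).congr_deriv ?_
  ring

variable {ω u₀ : ℂ} {b : ℂ → ℂ}

theorem deriv_const_add_exp (ω : ℂ) : deriv (fun u => ω + Complex.exp u) = Complex.exp := by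
  funext u
  exact ((Complex.hasDerivAt_exp u).const_add ω).deriv

theorem conv_const_add_exp (ω u₀ : ℂ) (b f : ℂ → ℂ) (u : ℂ) :
    conv (fun u => ω + Complex.exp u) u₀ b f u =
      segInt u₀ u fun v => b (Complex.exp u - Complex.exp v) * f v * Complex.exp v := by
  simp only [conv, deriv_const_add_exp, add_sub_add_left_eq_sub]

theorem conv_fun_add (hr : 0 < r) (h0 : u₀ ∈ logPlane r) (hb : Continuous b)
    (hf : ContinuousOn f (logPlane r)) (hg : ContinuousOn g (logPlane r)) {u : ℂ}
    (hu : u ∈ logPlane r) :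
    conv (fun u => ω + Complex.exp u) u₀ b (fun v => f v + g v) u =
      conv (fun u => ω + Complex.exp u) u₀ b f u + conv (fun u => ω + Complex.exp u) u₀ b g u := by
  simp only [conv_const_add_exp]
  rw [← segInt_fun_add (convex_logPlane hr) h0 hu]
  · refine segInt_congr (convex_logPlane hr) h0 hu fun v _ => ?_
    ring
  · exact ((by fun_prop : Continuous fun v => b (Complex.exp u - Complex.exp v)).continuousOn.mul
      hf).mul Complex.continuous_exp.continuousOn
  · exact ((by fun_prop : Continuous fun v => b (Complex.exp u - Complex.exp v)).continuousOn.mul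
      hg).mul Complex.continuous_exp.continuousOn

/-- For a single term, freeze `x = exp u` in the kernel: the integrand in `v` has the primitive `exp
((μ + 1) v) logInt (μ + 1) i (b(x - ·) c) v`. Its value at `v = u` has the factor `exp u` and
otherwise lies in the class; its value at `v = u₀` is entire in `x`. -/
theorem LogClass.conv (hr : 0 < r) (hμ : ∀ k, 0 ≤ (μ k).re) (h0 : u₀ ∈ logPlane r)
    (hb : Differentiable ℂ b) (hf : LogClass r μ d f) :
    LogClassPlus r μ d (LevelOne.conv (fun u => ω + Complex.exp u) u₀ b f) := by
  suffices H : ContinuousOn f (logPlane r) ∧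
    LogClassPlus r μ d (LevelOne.conv (fun u => ω + Complex.exp u) u₀ b f) from H.2
  refine hf.induction (Q := fun f => ContinuousOn f (logPlane r) ∧
    LogClassPlus r μ d (LevelOne.conv (fun u => ω + Complex.exp u) u₀ b f))
    ⟨continuousOn_const, ?_⟩ ?_ ?_ ?_
  · refine (LogClassPlus.hol (differentiableOn_const (0 : ℂ))).congr fun u _ => ?_
    simp [LevelOne.conv, segInt]
  · rintro f g ⟨hf, hf'⟩ ⟨hg, hg'⟩
    exact ⟨hf.add hg, (hf'.add hg').congr fun u hu => conv_fun_add hr h0 hb.continuous hf hg hu⟩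
  · rintro f g hfg ⟨hf, hf'⟩
    refine ⟨hf.congr hfg, hf'.congr fun u hu => segInt_congr (convex_logPlane hr) h0 hu
      fun v hv => ?_⟩
    simp only [hfg v hv]
  · intro k i hi c hc
    refine ⟨(LogClass.atom hi hc).differentiableOn.continuousOn, ?_⟩
    have hν : 0 < (μ k + 1).re := by
      have := hμ k
      simp only [Complex.add_re, Complex.one_re]
      linarith
    have hkd : ∀ x, DifferentiableOn ℂ (fun y => b (x - y) * c y) (ball 0 r) := fun x =>
      (hb.comp_differentiableOn (by fun_prop)).mul hc
    refine ⟨fun u => Complex.exp (μ k * u) *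
        logInt (μ k + 1) i (fun y => b (Complex.exp u - y) * c y) u,
      fun x => -(Complex.exp ((μ k + 1) * u₀) *
        logInt (μ k + 1) i (fun y => b (x - y) * c y) u₀), ?_, ?_, ?_⟩
    · refine (LogClass.poly (k := k) (n := i + 1) hi (c := fun l x => (i.choose l : ℂ) *
        logCoeff (μ k + 1) (i - l) (fun x y => b (x - y) * c y) x) fun l => ?_).congr fun u hu => ?_
      · exact DifferentiableOn.const_mul (fun x hx => (integrableOn_and_differentiableAt_logCoeff hν
          (i - l) hb hc hx).2.differentiableWithinAt) _
      · rw [← logInt_expand hν i hb hc hu]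
    · exact ((differentiable_logInt_param hν i hb hc h0).differentiableOn.const_mul _).neg
    · intro u hu
      rw [conv_const_add_exp]
      have h1 : ∀ v, HasDerivAt (fun v => Complex.exp ((μ k + 1) * v))
          (Complex.exp ((μ k + 1) * v) * (μ k + 1)) v := fun v => by
        simpa using ((hasDerivAt_id v).const_mul (μ k + 1)).cexp
      have hexp : ∀ v, Complex.exp ((μ k + 1) * v) = Complex.exp (μ k * v) * Complex.exp v :=
        fun v => by rw [← Complex.exp_add]; ring_nf
      have h2 := segInt_eq_sub (convex_logPlane hr) h0 hu
        (f := fun v => b (Complex.exp u - Complex.exp v) *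
          (Complex.exp (μ k * v) * (c (Complex.exp v) * v ^ i)) * Complex.exp v)
        (F := fun v => Complex.exp ((μ k + 1) * v) *
          logInt (μ k + 1) i (fun y => b (Complex.exp u - y) * c y) v) ?_ fun v hv => ?_
      · rw [h2, hexp]; ring
      · have := (LogClass.atom (μ := μ) hi hc).differentiableOn.continuousOn
        exact ((hb.continuous.comp (by fun_prop : Continuous fun v : ℂ =>
          Complex.exp u - Complex.exp v)).continuousOn.mul this).mul
            Complex.continuous_exp.continuousOn
      · refine ((h1 v).mul (hasDerivAt_logInt hν i (hkd (Complex.exp u)) hv)).congr_deriv ?_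
        rw [hexp]; ring

/-- Convolution with a function which has a primitive (with respect to `ξ = exp u`) in the class. -/
theorem LogClass.conv_deriv (hr : 0 < r) (hμ : ∀ k, 0 ≤ (μ k).re) (h0 : u₀ ∈ logPlane r)
    (hb : Differentiable ℂ b) (hf : LogClass r μ d f) {h : ℂ → ℂ}
    (hh : ContinuousOn h (logPlane r))
    (hd : ∀ u ∈ logPlane r, HasDerivAt f (h u * Complex.exp u) u) :
    ∃ S, LogClassPlus r μ d S ∧ ∀ u ∈ logPlane r,
      LevelOne.conv (fun u => ω + Complex.exp u) u₀ b h u = S u + b 0 * f u := by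
  have hb' : Differentiable ℂ (deriv b) :=
    differentiableOn_univ.1 ((differentiableOn_univ.2 hb).deriv isOpen_univ)
  -- Integration by parts: `S` collects the convolution of `f` with `b'` and the boundary term at
  -- `u₀`, while the boundary term at `u` is `b 0 * f u`.
  refine ⟨_, (hf.conv (ω := ω) hr hμ h0 hb').add (LogClassPlus.hol
    (c := fun x => -(b (x - Complex.exp u₀) * f u₀)) (by fun_prop)), fun u hu => ?_⟩
  rw [conv_const_add_exp, conv_const_add_exp]
  have hfc := hf.differentiableOn.continuousOn
  have c1 : ContinuousOn (fun v => b (Complex.exp u - Complex.exp v) * h v * Complex.exp v)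
    (logPlane r) := ((hb.continuous.comp (by fun_prop : Continuous fun v : ℂ =>
          Complex.exp u - Complex.exp v)).continuousOn.mul hh).mul Complex.continuous_exp.continuousOn
  have c2 : ContinuousOn (fun v => -1 * (deriv b (Complex.exp u - Complex.exp v) * f v *
      Complex.exp v)) (logPlane r) := continuousOn_const.mul
      (((hb'.continuous.comp (by fun_prop : Continuous fun v : ℂ =>
          Complex.exp u - Complex.exp v)).continuousOn.mul hfc).mul
            Complex.continuous_exp.continuousOn)
  have h2 := segInt_eq_sub (convex_logPlane hr) h0 hu (c1.add c2)
    (F := fun v => b (Complex.exp u - Complex.exp v) * f v) fun v hv => by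
      have h3 : HasDerivAt (fun v => b (Complex.exp u - Complex.exp v))
          (deriv b (Complex.exp u - Complex.exp v) * -Complex.exp v) v :=
        (hb (Complex.exp u - Complex.exp v)).hasDerivAt.comp v
          ((Complex.hasDerivAt_exp v).const_sub _)
      refine (h3.mul (hd v hv)).congr_deriv ?_
      simp only [Pi.add_apply]
      ring
  have h4 := segInt_fun_add (convex_logPlane hr) h0 hu c1 c2
  have h5 : segInt u₀ u (fun v => -1 * (deriv b (Complex.exp u - Complex.exp v) * f v *
      Complex.exp v)) = -segInt u₀ u (fun v => deriv b (Complex.exp u - Complex.exp v) * f v *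
      Complex.exp v) := by
    simp only [segInt, mul_left_comm _ (-1 : ℂ), intervalIntegral.integral_const_mul]
    ring
  rw [h5] at h4
  have h6 := h4.symm.trans h2
  simp only [sub_self] at h6
  linear_combination h6

end LogClass

/-! ### Polynomials in the logarithm. -/

/-- Polynomial functions of degree less than `n`. -/
def PolyLT (n : ℕ) (q : ℂ → ℂ) : Prop :=
  ∃ c : ℕ → ℂ, ∀ u, q u = ∑ i ∈ Finset.range n, c i * u ^ i

theorem PolyLT.mono {n m : ℕ} (h : n ≤ m) {q : ℂ → ℂ} (hq : PolyLT n q) : PolyLT m q := by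
  obtain ⟨c, hc⟩ := hq
  refine ⟨fun i => if i < n then c i else 0, fun u => ?_⟩
  rw [hc]
  refine Finset.sum_subset_zero_on_sdiff (Finset.range_subset_range.2 h) ?_ ?_
  · intro i hi
    simp only [Finset.mem_sdiff, Finset.mem_range] at hi
    simp [hi.2]
  · intro i hi
    simp [Finset.mem_range.1 hi]

theorem PolyLT.const_mul {n : ℕ} {q : ℂ → ℂ} (hq : PolyLT n q) (b : ℂ) :
    PolyLT n fun u => b * q u := by
  obtain ⟨c, hc⟩ := hq
  exact ⟨fun i => b * c i, fun u => by simp only [hc, Finset.mul_sum, mul_assoc]⟩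

theorem PolyLT.add {n : ℕ} {q q' : ℂ → ℂ} (hq : PolyLT n q) (hq' : PolyLT n q') :
    PolyLT n fun u => q u + q' u := by
  obtain ⟨c, hc⟩ := hq
  obtain ⟨c', hc'⟩ := hq'
  exact ⟨fun i => c i + c' i, fun u => by simp only [hc, hc', add_mul, Finset.sum_add_distrib]⟩

theorem PolyLT.monomial {n i : ℕ} (h : i < n) (b : ℂ) : PolyLT n fun u => b * u ^ i :=
  PolyLT.mono h ⟨fun j => if j = i then b else 0, fun u => by
    rw [Finset.sum_eq_single_of_mem i (by simp) fun j _ hj => by simp [hj]]; simp⟩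

theorem PolyLT.sum {ι : Type*} {n : ℕ} (s : Finset ι) {F : ι → ℂ → ℂ}
    (h : ∀ i ∈ s, PolyLT n (F i)) : PolyLT n fun u => ∑ i ∈ s, F i u := by
  classical
  induction s using Finset.induction_on with
  | empty => exact ⟨fun _ => 0, fun u => by simp⟩
  | insert i s hi ih =>
    simp only [Finset.sum_insert hi]
    exact (h i (Finset.mem_insert_self i s)).add
      (ih fun j hj => h j (Finset.mem_insert_of_mem hj))

theorem PolyLT.primitive {n : ℕ} {q : ℂ → ℂ} (hq : PolyLT n q) :
    ∃ Q, PolyLT (n + 1) Q ∧ ∀ u, HasDerivAt Q (q u) u := by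
  obtain ⟨c, hc⟩ := hq
  refine ⟨_, PolyLT.sum (Finset.range n) fun i hi =>
    PolyLT.monomial (i := i + 1) (by simpa using hi) (c i / (i + 1)), fun u => ?_⟩
  rw [hc]
  refine HasDerivAt.fun_sum fun i _ => ?_
  refine ((hasDerivAt_pow (i + 1) u).const_mul _).congr_deriv ?_
  have : (i : ℂ) + 1 ≠ 0 := Nat.cast_add_one_ne_zero i
  push_cast
  field_simp

theorem PolyLT.solve {s : ℂ} (hs : s ≠ 0) {n : ℕ} {q : ℂ → ℂ} (hq : PolyLT n q) :
    ∃ Q, PolyLT n Q ∧ ∀ u, HasDerivAt Q (q u - s * Q u) u := by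
  induction n generalizing q with
  | zero =>
    obtain ⟨c, hc⟩ := hq
    refine ⟨fun _ => 0, ⟨fun _ => 0, fun u => by simp⟩, fun u => ?_⟩
    simpa [hc] using hasDerivAt_const u (0 : ℂ)
  | succ n ih =>
    obtain ⟨c, hc⟩ := hq
    -- The monomial `(c n / s) uⁿ` removes the top term of `q` and leaves its derivative as a
    -- correction of lower degree; the correction vanishes for `n = 0`.
    have h1 : PolyLT n fun u => (∑ i ∈ Finset.range n, c i * u ^ i) +
        -(n * (c n / s)) * u ^ (n - 1) := by
      rcases Nat.eq_zero_or_pos n with rfl | hn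
      · exact ⟨fun _ => 0, fun u => by simp⟩
      · exact PolyLT.add ⟨c, fun _ => rfl⟩ (PolyLT.monomial (by omega) _)
    obtain ⟨Q, hQ, hd⟩ := ih h1
    refine ⟨_, (hQ.mono n.le_succ).add (PolyLT.monomial n.lt_succ_self (c n / s)), fun u => ?_⟩
    refine ((hd u).add ((hasDerivAt_pow n u).const_mul _)).congr_deriv ?_
    rw [hc, Finset.sum_range_succ]
    field_simp
    ring

/-! ### Structure of the solutions at a singular point. -/

namespace ConvSystem

variable {P : Type} [Fintype P] {T : ConvSystem P}

/-- Homogeneous solutions at a singular point are powers times polynomials in the logarithm. -/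
theorem exists_polyLT {r : ℝ} (hr : 0 < r) {u₀ : ℂ} (h0 : u₀ ∈ logPlane r) {ω : ℂ}
    {h : P → ℂ → ℂ} (hh : ∀ p, T.a p = ω → ∀ u ∈ logPlane r,
      HasDerivAt (h p) ((T.lam p - 1) * h p u + ∑ p', T.N p p' * h p' u) u) :
    ∀ p, T.a p = ω → ∃ q, PolyLT (T.rk p + 1) q ∧
      ∀ u ∈ logPlane r, h p u = Complex.exp ((T.lam p - 1) * u) * q u := by
  suffices H : ∀ n p, T.rk p < n → T.a p = ω → ∃ q, PolyLT (T.rk p + 1) q ∧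
      ∀ u ∈ logPlane r, h p u = Complex.exp ((T.lam p - 1) * u) * q u from
    fun p => H _ p (Nat.lt_succ_self _)
  intro n
  induction n with
  | zero => intro p hp; exact absurd hp (Nat.not_lt_zero _)
  | succ n ih =>
    intro p hp hpω
    have hlow : ∀ p', ∃ q, PolyLT (T.rk p) q ∧ ∀ u ∈ logPlane r,
        T.N p p' * h p' u = Complex.exp ((T.lam p - 1) * u) * q u := by
      intro p'
      by_cases hN : T.N p p' = 0
      · exact ⟨fun _ => 0, ⟨fun _ => 0, fun u => by simp⟩, fun u _ => by simp [hN]⟩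
      · obtain ⟨q, hq, hq'⟩ := ih p' (by have := T.rk_lt hN; omega) ((T.a_eq hN).trans hpω)
        refine ⟨_, (hq.mono (T.rk_lt hN)).const_mul (T.N p p'), fun u hu => ?_⟩
        rw [hq' u hu, T.lam_eq hN]; ring
    choose q hq hq' using hlow
    -- All entries coupled by `N` share the same exponent, so after multiplication by `exp ((1 - λ)
    -- u)` only a polynomial primitive is needed: one more degree per unit of rank.
    obtain ⟨Q, hQ, hQd⟩ := (PolyLT.sum Finset.univ fun p' _ => hq p').primitive
    have hexp : ∀ u, HasDerivAt (fun u => Complex.exp ((1 - T.lam p) * u))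
        (Complex.exp ((1 - T.lam p) * u) * (1 - T.lam p)) u := fun u => by
      simpa using ((hasDerivAt_id u).const_mul (1 - T.lam p)).cexp
    have hinv : ∀ u, Complex.exp ((1 - T.lam p) * u) * Complex.exp ((T.lam p - 1) * u) = 1 :=
      fun u => by rw [← Complex.exp_add]; ring_nf; simp
    have hconst : ∀ u ∈ logPlane r,
        HasDerivAt (fun u => Complex.exp ((1 - T.lam p) * u) * h p u - Q u) 0 u := by
      intro u hu
      refine (((hexp u).mul (hh p hpω u hu)).sub (hQd u)).congr_deriv ?_
      have : ∑ p', T.N p p' * h p' u = Complex.exp ((T.lam p - 1) * u) * ∑ p', q p' u := by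
        rw [Finset.mul_sum]
        exact Finset.sum_congr rfl fun p' _ => hq' p' u hu
      rw [this]
      linear_combination (∑ p', q p' u) * hinv u
    refine ⟨_, hQ.add (PolyLT.monomial (i := 0) (Nat.succ_pos _)
      (Complex.exp ((1 - T.lam p) * u₀) * h p u₀ - Q u₀)), fun u hu => ?_⟩
    have := eqOn_const_of_hasDerivAt_zero (convex_logPlane hr) hconst h0 hu
    linear_combination Complex.exp ((T.lam p - 1) * u) * this - h p u * hinv u

variable {κ : Type*} [Fintype κ] {r : ℝ} {μ : κ → ℂ} {d : P → κ → ℕ} {ω u₀ : ℂ}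

/-- Compatibility of the exponents `μ` and of the logarithmic degrees `d` with the system. -/
structure Compatible (T : ConvSystem P) (r : ℝ) (μ : κ → ℂ) (d : P → κ → ℕ) (ω : ℂ) : Prop where
  re_nonneg : ∀ k, 0 ≤ (μ k).re
  re_lt : ∀ p, (T.lam p).re < 1
  deg_β : ∀ p p', T.β p p' ≠ 0 → d p' ≤ d p
  deg_N : ∀ p p', T.N p p' ≠ 0 → d p' ≤ d p
  hol : ∀ p, ∃ k, μ k = 0 ∧ 0 < d p k
  β_zero : ∀ p p', T.a p = T.a p' → T.β p p' 0 = 0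
  exists_exponent : ∀ p, T.a p = ω →
    ∃ k, μ k = T.lam p ∧ T.rk p < d p k ∧ (T.lam p = 0 → T.rk p + 1 < d p k)
  ne : ∀ p, T.a p ≠ ω → ∀ y ∈ ball (0 : ℂ) r, ω + y ≠ T.a p

/-- `Φ` is the sum of a function of the class `LogClass` and of a homogeneous solution. -/
structure IsDecomposition (T : ConvSystem P) (r : ℝ) (μ : κ → ℂ) (d : P → κ → ℕ) (ω : ℂ)
    (Φ R : P → ℂ → ℂ) : Prop where
  logClass : ∀ p, LogClass r μ (d p) (R p)
  eq : ∀ p, T.a p ≠ ω → ∀ u ∈ logPlane r, Φ p u = R p u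
  homogeneous : ∀ p, T.a p = ω → ∀ u ∈ logPlane r, HasDerivAt (fun u => Φ p u - R p u)
    ((T.lam p - 1) * (Φ p u - R p u) + ∑ p', T.N p p' * (Φ p' u - R p' u)) u

/-- Isolates the single term that is not in `ξ · class + holomorphic`: the value `β(0)` times a
primitive `ℓ` of the homogeneous part. -/
theorem IsDecomposition.conv {Φ R : P → ℂ → ℂ} (hT : T.Compatible r μ d ω)
    (h : T.IsDecomposition r μ d ω Φ R) (hr : 0 < r) (h0 : u₀ ∈ logPlane r) (p p' : P) :
    ∃ S ℓ : ℂ → ℂ, LogClassPlus r μ (d p) S ∧ LogClass r μ (d p) ℓ ∧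
      (T.a p' ≠ ω → ∀ u ∈ logPlane r, ℓ u = 0) ∧ ∀ u ∈ logPlane r,
      LevelOne.conv (fun u => ω + Complex.exp u) u₀ (T.β p p') (Φ p') u =
        S u + T.β p p' 0 * ℓ u := by
  by_cases hβ : T.β p p' = 0
  · refine ⟨_, _, LogClassPlus.hol (differentiableOn_const (0 : ℂ)), LogClass.zero,
      fun _ _ _ => rfl, fun u _ => ?_⟩
    simp [hβ, LevelOne.conv, segInt]
  have hd := hT.deg_β p p' hβ
  have hR := (h.logClass p').conv (ω := ω) hr hT.re_nonneg h0 (T.diff p p')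
  by_cases ha : T.a p' = ω
  · obtain ⟨q, hq, hq'⟩ := exists_polyLT hr h0 h.homogeneous p' ha
    obtain ⟨k, hk, hk1, hk2⟩ := hT.exists_exponent p' ha
    -- `exp (λ u) Q` is to be a primitive in `ξ` of `ξ^{λ-1} q(ln ξ)`, that is, `Q' + λ Q = q`. The
    -- degree rises by one only if `λ = 0`.
    have hℓ : ∃ Q, PolyLT (d p' k) Q ∧ ∀ u, HasDerivAt Q (q u - T.lam p' * Q u) u := by
      by_cases hl : T.lam p' = 0
      · obtain ⟨Q, hQ, hQ'⟩ := hq.primitive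
        exact ⟨Q, hQ.mono (hk2 hl), fun u => by simpa [hl] using hQ' u⟩
      · exact (hq.mono hk1).solve hl
    obtain ⟨Q, ⟨c, hc⟩, hQ⟩ := hℓ
    have hlog : LogClass r μ (d p') fun u => Complex.exp (T.lam p' * u) * Q u := by
      refine (LogClass.poly (μ := μ) (k := k) le_rfl (c := fun i _ => c i)
        fun i => differentiableOn_const (c i)).congr fun u _ => ?_
      rw [hc, hk]
    have hder : ∀ u ∈ logPlane r, HasDerivAt (fun u => Complex.exp (T.lam p' * u) * Q u)
        ((Φ p' u - R p' u) * Complex.exp u) u := by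
      intro u hu
      have h1 : HasDerivAt (fun u => Complex.exp (T.lam p' * u))
          (Complex.exp (T.lam p' * u) * T.lam p') u := by
        simpa using ((hasDerivAt_id u).const_mul (T.lam p')).cexp
      refine (h1.mul (hQ u)).congr_deriv ?_
      have h2 : Complex.exp (T.lam p' * u) = Complex.exp ((T.lam p' - 1) * u) * Complex.exp u := by
        rw [← Complex.exp_add]; ring_nf
      rw [hq' u hu, h2]; ring
    have hcont : ContinuousOn (fun u => Φ p' u - R p' u) (logPlane r) := fun u hu =>
      (h.homogeneous p' ha u hu).continuousAt.continuousWithinAt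
    obtain ⟨S, hS, hS'⟩ := hlog.conv_deriv (ω := ω) hr hT.re_nonneg h0 (T.diff p p') hcont hder
    refine ⟨_, _, (hR.add hS).mono hd, hlog.mono hd, fun h => absurd ha h, fun u hu => ?_⟩
    have h3 := conv_fun_add (ω := ω) hr h0 (T.diff p p').continuous
      (h.logClass p').differentiableOn.continuousOn hcont hu
    simp only [add_sub_cancel] at h3
    rw [show (fun v => Φ p' v) = Φ p' from rfl] at h3
    rw [h3, hS' u hu]
    ring
  · refine ⟨_, _, hR.mono hd, LogClass.zero, fun _ _ _ => rfl, fun u hu => ?_⟩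
    rw [mul_zero, add_zero]
    refine segInt_congr (convex_logPlane hr) h0 hu fun v hv => ?_
    simp only [h.eq p' ha v hv]

/-- At a singular entry the exceptional terms `β(0) ℓ` all disappear: `β(0) = 0` if the other entry
is singular at `ω` too, and `ℓ = 0` if it is not. -/
theorem IsDecomposition.source {E Φ R : P → ℂ → ℂ} (hT : T.Compatible r μ d ω)
    (h : T.IsDecomposition r μ d ω Φ R) (hr : 0 < r) (h0 : u₀ ∈ logPlane r)
    (hE : ∀ p, Differentiable ℂ (E p)) (p : P) :
    LogClass r μ (d p) (T.source (fun u => ω + Complex.exp u) u₀ E Φ p) ∧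
    (T.a p = ω → LogClassPlus r μ (d p) (T.source (fun u => ω + Complex.exp u) u₀ E Φ p)) := by
  have hEp : LogClassPlus r μ (d p) fun u => E p (ω + Complex.exp u) :=
    LogClassPlus.hol (c := fun x => E p (ω + x))
      ((hE p).comp (differentiable_id.const_add ω)).differentiableOn
  choose S ℓ hS hℓ hℓ0 heq using fun p' => h.conv hT hr h0 p p'
  constructor
  · refine (hEp.logClass (hT.hol p)).add (LogClass.sum _ fun p' _ => ?_)
    exact (((hS p').logClass (hT.hol p)).add ((hℓ p').const_mul _)).congr (heq p')
  · intro ha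
    refine hEp.add (LogClassPlus.sum _ fun p' _ => (hS p').congr fun u hu => ?_)
    rw [heq p' u hu]
    by_cases ha' : T.a p' = ω
    · rw [hT.β_zero p p' (ha.trans ha'.symm), zero_mul, add_zero]
    · rw [hℓ0 p' ha' u hu, mul_zero, add_zero]

/-- At a point where its equation is regular, a component belongs to the class. -/
theorem Compatible.logClass_of_ne (hT : T.Compatible r μ d ω) (hr : 0 < r)
    (h0 : u₀ ∈ logPlane r) {Ψ Φ : P → ℂ → ℂ} (hΨ : ∀ p, LogClass r μ (d p) (Ψ p))
    (hΦ : T.SolvesOn (logPlane r) (fun u => ω + Complex.exp u) Ψ Φ) :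
    ∀ p, T.a p ≠ ω → LogClass r μ (d p) (Φ p) := by
  suffices H : ∀ n p, T.rk p < n → T.a p ≠ ω → LogClass r μ (d p) (Φ p) from
    fun p => H _ p (Nat.lt_succ_self _)
  intro n
  induction n with
  | zero => intro p hp; exact absurd hp (Nat.not_lt_zero _)
  | succ n ih =>
    intro p hp ha
    have hN : LogClass r μ (d p) fun u => ∑ p', T.N p p' * Φ p' u := by
      refine LogClass.sum _ fun p' _ => ?_
      by_cases hN : T.N p p' = 0
      · simpa [hN] using LogClass.zero
      · exact (((ih p' (by have := T.rk_lt hN; omega)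
          (by rw [T.a_eq hN]; exact ha)).mono (hT.deg_N p p' hN))).const_mul _
    have hne : ∀ y ∈ ball (0 : ℂ) r, ω + y - T.a p ≠ 0 :=
      fun y hy => sub_ne_zero.2 (hT.ne p ha y hy)
    set α : ℂ → ℂ := fun y => (1 - T.lam p) / (ω + y - T.a p) with hα
    have hαd : DifferentiableOn ℂ α (ball 0 r) :=
      (differentiableOn_const _).div (by fun_prop) hne
    set e : ℂ → ℂ := fun y => Complex.exp (segInt 0 y α) with he
    have hed : ∀ y ∈ ball (0 : ℂ) r, HasDerivAt e (e y * α y) y := fun y hy =>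
      (hasDerivAt_segInt (convex_ball 0 r) isOpen_ball (mem_ball_self hr) hy hαd).cexp
    have hed' : DifferentiableOn ℂ e (ball 0 r) := fun y hy =>
      (hed y hy).differentiableAt.differentiableWithinAt
    set H : ℂ → ℂ := fun y => e y / (ω + y - T.a p) with hH
    have hHd : DifferentiableOn ℂ H (ball 0 r) := hed'.div (by fun_prop) hne
    have hHd' := hHd.deriv isOpen_ball
    -- With the integrating factor `e` and `H = e / (ξ - a)`, the derivative of `e Φ - H Ψ` is `exp
    -- u` times this function. Subtracting `H Ψ` replaces `Ψ'`, which need not contain `exp u`, by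
    -- `Ψ`.
    have hw : LogClass r μ (d p) fun u => H (Complex.exp u) * (∑ p', T.N p p' * Φ p' u) +
        -1 * (deriv H (Complex.exp u) * Ψ p u) :=
      (hN.hol_mul hHd).add (((hΨ p).hol_mul hHd').const_mul (-1))
    -- A primitive of `exp u * w` is `exp u * χ` with `χ' + χ = w`; the factor `exp u` prevents any
    -- rise of the degree.
    obtain ⟨χ, hχ, hχd⟩ := hw.solve hT.re_nonneg (s := 0) (by simp)
    have hconst : ∀ u ∈ logPlane r, HasDerivAt (fun u => e (Complex.exp u) * Φ p u -
        H (Complex.exp u) * Ψ p u - Complex.exp u * χ u) 0 u := by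
      intro u hu
      have hx := mapsTo_exp r hu
      have h1 := (hed _ hx).comp u (Complex.hasDerivAt_exp u)
      have h2 := (hHd.differentiableAt (isOpen_ball.mem_nhds hx)).hasDerivAt.comp u
        (Complex.hasDerivAt_exp u)
      have h3 := ((hΦ p).1.differentiableAt ((isOpen_logPlane r).mem_nhds hu)).hasDerivAt
      have h4 := ((hΨ p).differentiableOn.differentiableAt
        ((isOpen_logPlane r).mem_nhds hu)).hasDerivAt
      refine (((h1.mul h3).sub (h2.mul h4)).sub
        ((Complex.hasDerivAt_exp u).mul (hχd u hu))).congr_deriv ?_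
      have h5 := (hΦ p).2 u hu
      rw [deriv_const_add_exp] at h5
      have h6 := hne _ hx
      have h7 : H (Complex.exp u) * (ω + Complex.exp u - T.a p) = e (Complex.exp u) :=
        div_mul_cancel₀ _ h6
      have h8 : e (Complex.exp u) * α (Complex.exp u) = H (Complex.exp u) * (1 - T.lam p) := by
        simp only [hα, hH]; ring
      simp only [Function.comp_apply, sub_zero, one_mul]
      linear_combination H (Complex.exp u) * h5 - deriv (Φ p) u * h7 +
        Complex.exp u * Φ p u * h8
    have hfin : ∀ u ∈ logPlane r, Φ p u = (e (Complex.exp u))⁻¹ * (H (Complex.exp u) * Ψ p u +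
        (Complex.exp u * χ u + (e (Complex.exp u₀) * Φ p u₀ -
        H (Complex.exp u₀) * Ψ p u₀ - Complex.exp u₀ * χ u₀))) := by
      intro u hu
      have h1 := eqOn_const_of_hasDerivAt_zero (convex_logPlane hr) hconst h0 hu
      rw [← h1, eq_inv_mul_iff_mul_eq₀ (Complex.exp_ne_zero _)]
      ring
    exact ((((hΨ p).hol_mul hHd).add ((hχ.hol_mul differentiableOn_id).add
      (LogClass.hol (hT.hol p) (differentiableOn_const _)))).hol_mul
      (hed'.inv fun y _ => Complex.exp_ne_zero _)).congr hfin

/-- At a singular entry the derivative of the source is `exp u * g` with `g` in the class, so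
division by `exp u` leaves `Φ' + (1 - λ) Φ = g + N Φ`, with `'` denoting `d/du`. A particular
solution in the class is built by induction on the rank, and the difference is homogeneous. -/
theorem IsDecomposition.succ {E Φ R Φ' : P → ℂ → ℂ} (hT : T.Compatible r μ d ω)
    (h : T.IsDecomposition r μ d ω Φ R) (hr : 0 < r) (h0 : u₀ ∈ logPlane r)
    (hE : ∀ p, Differentiable ℂ (E p)) (hΦ' : T.SolvesOn (logPlane r)
      (fun u => ω + Complex.exp u) (T.source (fun u => ω + Complex.exp u) u₀ E Φ) Φ') :
    ∃ R', T.IsDecomposition r μ d ω Φ' R' := by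
  classical
  have hsrc := h.source hT hr h0 hE
  have hne := hT.logClass_of_ne hr h0 (fun p => (hsrc p).1) hΦ'
  have hg : ∀ p, ∃ g, LogClass r μ (d p) g ∧ (T.a p = ω → ∀ u ∈ logPlane r,
      HasDerivAt (T.source (fun u => ω + Complex.exp u) u₀ E Φ p) (Complex.exp u * g u) u) := by
    intro p
    by_cases ha : T.a p = ω
    · obtain ⟨g, hg, hg'⟩ := ((hsrc p).2 ha).hasDerivAt (hT.hol p)
      exact ⟨g, hg, fun _ => hg'⟩
    · exact ⟨_, LogClass.zero, fun h => absurd h ha⟩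
  choose g hg hgd using hg
  obtain ⟨R', hR'⟩ : ∃ R' : P → ℂ → ℂ, ∀ p, LogClass r μ (d p) (R' p) ∧ ∀ u ∈ logPlane r,
      HasDerivAt (R' p) (g p u + (∑ p', T.N p p' * R' p' u) - (1 - T.lam p) * R' p u) u := by
    refine exists_of_triangular (T := ℂ → ℂ) T.rk
      (fun p R' t => LogClass r μ (d p) t ∧ ∀ u ∈ logPlane r,
      HasDerivAt t (g p u + (∑ p', T.N p p' * R' p' u) - (1 - T.lam p) * t u) u) ?_ ?_
    · rintro p R₁ R₂ t hR ⟨h1, h2⟩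
      refine ⟨h1, fun u hu => ?_⟩
      rw [← sum_N_congr fun p' hp' => congrFun (hR p' hp') u]
      exact h2 u hu
    · intro p R' hR'
      have hN : LogClass r μ (d p) fun u => ∑ p', T.N p p' * R' p' u := by
        refine LogClass.sum _ fun p' _ => ?_
        by_cases hN : T.N p p' = 0
        · simpa [hN] using LogClass.zero
        · exact (((hR' p' (T.rk_lt hN)).1).mono (hT.deg_N p p' hN)).const_mul _
      exact ((hg p).add hN).solve hT.re_nonneg (hT.re_lt p)
  -- Regular entries lie entirely in the class. Since `N` couples only entries with equal `a`,
  -- replacing `R'` there does not affect the equations of the singular entries.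
  refine ⟨fun p => if T.a p = ω then R' p else Φ' p, fun p => ?_, fun p ha u _ => ?_,
    fun p ha u hu => ?_⟩
  · split_ifs with ha
    · exact (hR' p).1
    · exact hne p ha
  · simp [ha]
  · simp only [if_pos ha]
    have h3 := ((hΦ' p).1.differentiableAt ((isOpen_logPlane r).mem_nhds hu)).hasDerivAt
    refine (h3.sub ((hR' p).2 u hu)).congr_deriv ?_
    have h5 := (hΦ' p).2 u hu
    rw [(hgd p ha u hu).deriv, deriv_const_add_exp, ha, add_sub_cancel_left] at h5
    have h6 : ∑ p', T.N p p' * (Φ' p' u - (if T.a p' = ω then R' p' else Φ' p') u) =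
        (∑ p', T.N p p' * Φ' p' u) - ∑ p', T.N p p' * R' p' u := by
      rw [← Finset.sum_sub_distrib]
      refine Finset.sum_congr rfl fun p' _ => ?_
      by_cases hN : T.N p p' = 0
      · simp [hN]
      · rw [if_pos ((T.a_eq hN).trans ha)]; ring
    rw [h6]
    have h7 : deriv (Φ' p) u + (1 - T.lam p) * Φ' p u = g p u + ∑ p', T.N p p' * Φ' p' u :=
      mul_left_cancel₀ (Complex.exp_ne_zero u) (by linear_combination h5)
    linear_combination h7

theorem IsSol.exists_isDecomposition {E Φ : ℕ → P → ℂ → ℂ} (hT : T.Compatible r μ d ω)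
    (hr : 0 < r) (h0 : u₀ ∈ logPlane r)
    (h : T.IsSol (logPlane r) (fun u => ω + Complex.exp u) u₀ E Φ) (m : ℕ) :
    ∃ R, T.IsDecomposition r μ d ω (Φ m) R := by
  induction m with
  | zero =>
    refine ⟨fun _ _ => 0, fun _ => LogClass.zero, fun p _ u _ => h.zero p u, fun p _ u _ => ?_⟩
    simpa [h.zero] using hasDerivAt_const u (0 : ℂ)
  | succ m ih =>
    obtain ⟨R, hR⟩ := ih
    exact hR.succ hT hr h0 (h.entire (m + 1)) (h.solves m)

end ConvSystem

/-! ### Formal power series solutions. -/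

namespace ConvSystem

variable {P : Type} [Fintype P] (T : ConvSystem P)

/-- The formal differential equations with right-hand side `G`. -/
def FormalEq (f G : P → ℂ⟦X⟧) : Prop :=
  ∀ p, PowerSeries.X ^ 2 * PowerSeries.derivative ℂ (f p) - PowerSeries.C (T.a p) * f p -
    PowerSeries.X * (PowerSeries.C (T.lam p) * f p + ∑ p', PowerSeries.C (T.N p p') * f p') = G p

variable {T}

theorem coeff_succ_X_sq_mul_derivative (f : ℂ⟦X⟧) (n : ℕ) :
    PowerSeries.coeff (n + 1) (PowerSeries.X ^ 2 * PowerSeries.derivative ℂ f) =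
      n * PowerSeries.coeff n f := by
  rw [sq, mul_assoc, PowerSeries.coeff_succ_X_mul]
  cases n with
  | zero => simp
  | succ n =>
    rw [PowerSeries.coeff_succ_X_mul, PowerSeries.coeff_derivative]
    push_cast
    ring

theorem formalEq_iff {f G : P → ℂ⟦X⟧} (hf : ∀ p, PowerSeries.constantCoeff (f p) = 0)
    (hG : ∀ p, PowerSeries.constantCoeff (G p) = 0) :
    T.FormalEq f G ↔ ∀ p (n : ℕ), ((n : ℂ) - T.lam p) * PowerSeries.coeff n (f p) -
      T.a p * PowerSeries.coeff (n + 1) (f p) -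
      ∑ p', T.N p p' * PowerSeries.coeff n (f p') = PowerSeries.coeff (n + 1) (G p) := by
  refine forall_congr' fun p => ?_
  have key : ∀ n : ℕ, PowerSeries.coeff (n + 1) (PowerSeries.X ^ 2 * PowerSeries.derivative ℂ (f p) -
      PowerSeries.C (T.a p) * f p - PowerSeries.X * (PowerSeries.C (T.lam p) * f p +
      ∑ p', PowerSeries.C (T.N p p') * f p')) =
      ((n : ℂ) - T.lam p) * PowerSeries.coeff n (f p) -
      T.a p * PowerSeries.coeff (n + 1) (f p) -
      ∑ p', T.N p p' * PowerSeries.coeff n (f p') := by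
    intro n
    rw [map_sub, map_sub, coeff_succ_X_sq_mul_derivative, PowerSeries.coeff_succ_X_mul, map_add,
      map_sum]
    simp only [PowerSeries.coeff_C_mul]
    ring
  constructor
  · intro h n
    rw [← key, h]
  · intro h
    ext n
    cases n with
    | zero => simp [hf, hG]
    | succ n => rw [key, h]

theorem natCast_succ_sub_ne_zero {l : ℂ} (hl : l.re < 1) (n : ℕ) : ((n + 1 : ℕ) : ℂ) - l ≠ 0 := by
  intro h
  have := congrArg Complex.re h
  simp only [Complex.sub_re, Complex.natCast_re, Complex.zero_re] at this
  push_cast at this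
  have hn : (0 : ℝ) ≤ n := n.cast_nonneg
  linarith

/-- If `a ≠ 0`, the recurrence gives the coefficient of index `n + 1`. If `a = 0`, it gives that of
index `n ≥ 1` on division by `n - λ`, which is nonzero as `Re λ < 1`; at `n = 0` it is the
compatibility condition that the coefficient of `x` in the right-hand side vanish. -/
theorem exists_formalEq (hl : ∀ p, (T.lam p).re < 1) {G : P → ℂ⟦X⟧}
    (hG : ∀ p, PowerSeries.constantCoeff (G p) = 0)
    (hG1 : ∀ p, T.a p = 0 → PowerSeries.coeff 1 (G p) = 0) :
    ∃ f : P → ℂ⟦X⟧, (∀ p, PowerSeries.constantCoeff (f p) = 0) ∧ T.FormalEq f G := by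
  suffices H : ∃ f : P → ℂ⟦X⟧, ∀ p, PowerSeries.constantCoeff (f p) = 0 ∧
      ∀ n : ℕ, ((n : ℂ) - T.lam p) * PowerSeries.coeff n (f p) -
      T.a p * PowerSeries.coeff (n + 1) (f p) -
      ∑ p', T.N p p' * PowerSeries.coeff n (f p') = PowerSeries.coeff (n + 1) (G p) by
    obtain ⟨f, hf⟩ := H
    exact ⟨f, fun p => (hf p).1, (formalEq_iff (fun p => (hf p).1) hG).2 fun p => (hf p).2⟩
  refine exists_of_triangular (T := ℂ⟦X⟧) T.rk
    (fun p f t => PowerSeries.constantCoeff t = 0 ∧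
      ∀ n : ℕ, ((n : ℂ) - T.lam p) * PowerSeries.coeff n t -
      T.a p * PowerSeries.coeff (n + 1) t -
      ∑ p', T.N p p' * PowerSeries.coeff n (f p') = PowerSeries.coeff (n + 1) (G p)) ?_ ?_
  · rintro p f f' t h ⟨h1, h2⟩
    refine ⟨h1, fun n => ?_⟩
    rw [← h2 n, sum_N_congr fun p' hp' => congrArg (PowerSeries.coeff n) (h p' hp').symm]
  · intro p f hf
    by_cases ha : T.a p = 0
    · refine ⟨PowerSeries.mk fun n => if n = 0 then 0 else (PowerSeries.coeff (n + 1) (G p) +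
        ∑ p', T.N p p' * PowerSeries.coeff n (f p')) / (n - T.lam p), by
          rw [← PowerSeries.coeff_zero_eq_constantCoeff_apply]; simp, fun n => ?_⟩
      cases n with
      | zero =>
        have : ∑ p', T.N p p' * PowerSeries.coeff 0 (f p') = ∑ p', T.N p p' * 0 :=
          sum_N_congr fun p' hp' =>
            (PowerSeries.coeff_zero_eq_constantCoeff_apply _).trans (hf p' hp').1
        rw [this]
        simp [ha, hG1 p ha]
      | succ n =>
        have := natCast_succ_sub_ne_zero (hl p) n
        simp only [PowerSeries.coeff_mk, if_neg (Nat.succ_ne_zero _), ha, zero_mul, sub_zero]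
        rw [mul_div_cancel₀ _ this, add_sub_cancel_right]
    · refine ⟨PowerSeries.mk fun n => Nat.rec 0 (fun n t => ((n - T.lam p) * t -
        (PowerSeries.coeff (n + 1) (G p) +
          ∑ p', T.N p p' * PowerSeries.coeff n (f p'))) / T.a p) n, by
          rw [← PowerSeries.coeff_zero_eq_constantCoeff_apply]; simp, fun n => ?_⟩
      simp only [PowerSeries.coeff_mk]
      rw [mul_div_cancel₀ _ ha]
      ring

theorem FormalEq.unique (hl : ∀ p, (T.lam p).re < 1) {f f' G : P → ℂ⟦X⟧}
    (hG : ∀ p, PowerSeries.constantCoeff (G p) = 0)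
    (hf : ∀ p, PowerSeries.constantCoeff (f p) = 0) (h : T.FormalEq f G)
    (hf' : ∀ p, PowerSeries.constantCoeff (f' p) = 0) (h' : T.FormalEq f' G) : f = f' := by
  rw [formalEq_iff hf hG] at h
  rw [formalEq_iff hf' hG] at h'
  have key : ∀ k p, T.rk p < k → f p = f' p := by
    intro k
    induction k with
    | zero => intro p hp; exact absurd hp (Nat.not_lt_zero _)
    | succ k ih =>
      intro p hp
      have hrec : ∀ n : ℕ, ((n : ℂ) - T.lam p) *
          (PowerSeries.coeff n (f p) - PowerSeries.coeff n (f' p)) =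
          T.a p * (PowerSeries.coeff (n + 1) (f p) - PowerSeries.coeff (n + 1) (f' p)) := by
        intro n
        have h1 := h p n
        have h2 := h' p n
        rw [sum_N_congr (g := fun p' => PowerSeries.coeff n (f' p')) fun p' hp' => by
          rw [ih p' (by omega)]] at h1
        linear_combination h1 - h2
      ext n
      induction n with
      | zero =>
        rw [PowerSeries.coeff_zero_eq_constantCoeff_apply,
          PowerSeries.coeff_zero_eq_constantCoeff_apply, hf, hf']
      | succ n ihn =>
        by_cases ha : T.a p = 0
        · have h1 := hrec (n + 1)
          rw [ha, zero_mul] at h1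
          exact sub_eq_zero.1 ((mul_eq_zero.1 h1).resolve_left (natCast_succ_sub_ne_zero (hl p) n))
        · have h1 := hrec n
          rw [ihn, sub_self, mul_zero] at h1
          exact sub_eq_zero.1 ((mul_eq_zero.1 h1.symm).resolve_left ha)
  exact funext fun p => key _ p (Nat.lt_succ_self _)

end ConvSystem

/-! ### Geometric bounds, Borel transforms and convolution of series. -/

/-- Growth at most `Kⁿ`, up to a constant. -/
def GeomBound (K : ℝ) (c : ℕ → ℂ) : Prop := ∃ C : ℝ, 0 ≤ C ∧ ∀ n, ‖c n‖ ≤ C * K ^ n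

section GeomBound

variable {K : ℝ} {c e : ℕ → ℂ}

theorem GeomBound.zero : GeomBound K fun _ => 0 := ⟨0, le_rfl, fun n => by simp⟩

theorem GeomBound.add (hc : GeomBound K c) (he : GeomBound K e) :
    GeomBound K fun n => c n + e n := by
  obtain ⟨C, hC, hc⟩ := hc
  obtain ⟨D, hD, he⟩ := he
  exact ⟨C + D, by positivity, fun n => (norm_add_le _ _).trans (by linarith [hc n, he n])⟩

theorem GeomBound.const_mul (hc : GeomBound K c) (b : ℂ) : GeomBound K fun n => b * c n := by
  obtain ⟨C, hC, hc⟩ := hc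
  refine ⟨‖b‖ * C, by positivity, fun n => ?_⟩
  rw [norm_mul, mul_assoc]
  exact mul_le_mul_of_nonneg_left (hc n) (norm_nonneg b)

theorem GeomBound.sum {ι : Type*} (s : Finset ι) {F : ι → ℕ → ℂ}
    (h : ∀ i ∈ s, GeomBound K (F i)) : GeomBound K fun n => ∑ i ∈ s, F i n := by
  classical
  induction s using Finset.induction_on with
  | empty => simpa using GeomBound.zero
  | insert i s hi ih =>
    simp only [Finset.sum_insert hi]
    exact (h i (Finset.mem_insert_self i s)).add
      (ih fun j hj => h j (Finset.mem_insert_of_mem hj))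

theorem GeomBound.of_succ (hK : 1 ≤ K) {D : ℝ} (h : ∀ n, ‖c (n + 1)‖ ≤ D * K ^ n) :
    GeomBound K c := by
  have hD : 0 ≤ D := by simpa using (norm_nonneg _).trans (h 0)
  refine ⟨‖c 0‖ + D, by positivity, fun n => ?_⟩
  cases n with
  | zero => simpa using hD
  | succ n =>
    exact (h n).trans (mul_le_mul (le_add_of_nonneg_left (norm_nonneg _))
      (pow_le_pow_right₀ hK n.le_succ) (by positivity) (by positivity))

theorem GeomBound.of_recurrence (hK : 1 ≤ K) {D : ℝ} (hD : 0 ≤ D)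
    (h : ∀ n, ‖c (n + 1)‖ ≤ K / 2 * ‖c n‖ + D * K ^ n) : GeomBound K c := by
  refine ⟨‖c 0‖ + 2 * D, by positivity, fun n => ?_⟩
  induction n with
  | zero => simpa using hD
  | succ n ih =>
    refine (h n).trans ?_
    have hKn : 0 ≤ K ^ n := by positivity
    have h1 : K / 2 * ‖c n‖ ≤ K / 2 * ((‖c 0‖ + 2 * D) * K ^ n) := by gcongr
    have h2 : D * K ^ n ≤ K / 2 * (2 * D * K ^ n) := by nlinarith [mul_nonneg hD hKn]
    have h3 : 0 ≤ K / 2 * (‖c 0‖ * K ^ n) := by positivity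
    rw [pow_succ]
    linarith

/-- The sum of the power series with coefficients `c`. -/
def seqSum (c : ℕ → ℂ) (z : ℂ) : ℂ := ∑' n, c n * z ^ n

theorem GeomBound.summable (hK : 1 ≤ K) (hc : GeomBound K c) {x : ℝ} (hx0 : 0 ≤ x)
    (hx : x * K < 1) : Summable fun n => ‖c n‖ * x ^ n := by
  obtain ⟨C, hC, hc⟩ := hc
  refine Summable.of_nonneg_of_le (fun n => by positivity) (fun n => ?_)
    ((summable_geometric_of_lt_one (by positivity) hx).mul_left C)
  rw [mul_pow, mul_comm (x ^ n), ← mul_assoc]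
  exact mul_le_mul_of_nonneg_right (hc n) (by positivity)

theorem hasSum_seqSum {x : ℝ} (h : Summable fun n => ‖c n‖ * x ^ n) {z : ℂ} (hz : ‖z‖ ≤ x) :
    HasSum (fun n => c n * z ^ n) (seqSum c z) := by
  refine (Summable.of_norm_bounded h fun n => ?_).hasSum
  rw [norm_mul, norm_pow]
  gcongr

theorem hasDerivAt_seqSum {x : ℝ} (h : Summable fun n => ‖c n‖ * x ^ n) {z : ℂ} (hz : ‖z‖ < x) :
    HasDerivAt (seqSum c) (deriv (seqSum c) z) z ∧
    HasSum (fun n : ℕ => ((n : ℂ) + 1) * c (n + 1) * z ^ n) (deriv (seqSum c) z) := by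
  have hle : ∀ n, ∀ w ∈ ball (0 : ℂ) x, ‖c n * w ^ n‖ ≤ ‖c n‖ * x ^ n := by
    intro n w hw
    rw [norm_mul, norm_pow]
    have := (mem_ball_zero_iff.1 hw).le
    gcongr
  have hd : ∀ n, DifferentiableOn ℂ (fun w : ℂ => c n * w ^ n) (ball 0 x) := fun n => by fun_prop
  have hz' : z ∈ ball (0 : ℂ) x := mem_ball_zero_iff.2 hz
  constructor
  · exact ((Complex.differentiableOn_tsum_of_summable_norm h hd isOpen_ball hle).differentiableAt
      (isOpen_ball.mem_nhds hz')).hasDerivAt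
  · have h1 := Complex.hasSum_deriv_of_summable_norm h hd isOpen_ball hle hz'
    rw [← hasSum_nat_add_iff' 1] at h1
    simp only [Finset.range_one, Finset.sum_singleton, pow_zero, mul_one] at h1
    have h2 : deriv (fun _ : ℂ => c 0) z = 0 := deriv_const z (c 0)
    rw [h2, sub_zero] at h1
    have h3 : (fun n : ℕ => ((n : ℂ) + 1) * c (n + 1) * z ^ n) =
        fun n => deriv (fun w => c (n + 1) * w ^ (n + 1)) z := by
      funext n
      rw [((hasDerivAt_pow (n + 1) z).const_mul (c (n + 1))).deriv]
      push_cast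
      ring
    rw [h3]
    exact h1

theorem integral_pow_mul_one_sub_pow (k l : ℕ) :
    ∫ t in (0 : ℝ)..1, (t : ℂ) ^ l * (1 - t) ^ k =
      (k.factorial * l.factorial : ℂ) / (k + l + 1).factorial := by
  have h := Complex.betaIntegral_eq_Gamma_mul_div (l + 1) (k + 1) (by simp; positivity)
    (by simp; positivity)
  rw [Complex.betaIntegral] at h
  simp only [add_sub_cancel_right, Complex.cpow_natCast] at h
  rw [h, Complex.Gamma_nat_eq_factorial, Complex.Gamma_nat_eq_factorial,
    show (l : ℂ) + 1 + (k + 1) = ((k + l + 1 : ℕ) : ℂ) + 1 by push_cast; ring,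
    Complex.Gamma_nat_eq_factorial]
  ring

end GeomBound

theorem coeff_borel (f : ℂ⟦X⟧) (n : ℕ) :
    PowerSeries.coeff n (borel f) = PowerSeries.coeff (n + 1) f / n.factorial := by
  simp [borel]

theorem factorial_ne_zero_complex (n : ℕ) : (n.factorial : ℂ) ≠ 0 := by
  exact_mod_cast n.factorial_ne_zero

theorem coeff_succ_succ_mul {b f : ℂ⟦X⟧} (hb : PowerSeries.constantCoeff b = 0)
    (hf : PowerSeries.constantCoeff f = 0) (n : ℕ) :
    PowerSeries.coeff (n + 2) (b * f) = ∑ q ∈ Finset.HasAntidiagonal.antidiagonal n,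
      PowerSeries.coeff (q.1 + 1) b * PowerSeries.coeff (q.2 + 1) f := by
  rw [PowerSeries.coeff_mul, Finset.Nat.antidiagonal_succ_succ']
  simp [hb, hf]

theorem coeff_succ_borel_mul {b f : ℂ⟦X⟧} (hb : PowerSeries.constantCoeff b = 0)
    (hf : PowerSeries.constantCoeff f = 0) (n : ℕ) :
    PowerSeries.coeff (n + 1) (borel (b * f)) = ∑ q ∈ Finset.HasAntidiagonal.antidiagonal n,
      PowerSeries.coeff q.1 (borel b) * PowerSeries.coeff q.2 (borel f) *
        (q.1.factorial * q.2.factorial / (n + 1).factorial) := by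
  rw [coeff_borel, coeff_succ_succ_mul hb hf, Finset.sum_div]
  refine Finset.sum_congr rfl fun q _ => ?_
  rw [coeff_borel, coeff_borel]
  have h1 := factorial_ne_zero_complex q.1
  have h2 := factorial_ne_zero_complex q.2
  have h3 := factorial_ne_zero_complex (n + 1)
  field_simp

theorem coeff_zero_borel_mul {b f : ℂ⟦X⟧} (hb : PowerSeries.constantCoeff b = 0)
    (hf : PowerSeries.constantCoeff f = 0) : PowerSeries.coeff 0 (borel (b * f)) = 0 := by
  rw [coeff_borel, PowerSeries.coeff_mul]
  simp [Finset.Nat.antidiagonal_succ, hb, hf]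

/-- The coefficient is a sum of `n + 1` terms of size at most `C D Kⁿ n!`, divided by `(n + 1)!`;
thus the same rate `K` is kept from one order to the next. -/
theorem geomBound_coeff_succ_borel_mul {K : ℝ} (hK : 1 ≤ K) {b f : ℂ⟦X⟧}
    (hb : PowerSeries.constantCoeff b = 0) (hf : PowerSeries.constantCoeff f = 0)
    (hbK : GeomBound K fun k => PowerSeries.coeff (k + 1) b)
    (hfK : GeomBound K fun k => PowerSeries.coeff k (borel f)) :
    GeomBound K fun n => PowerSeries.coeff (n + 1) (borel (b * f)) := by
  obtain ⟨C, hC, hbK⟩ := hbK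
  obtain ⟨D, hD, hfK⟩ := hfK
  refine ⟨C * D, by positivity, fun n => ?_⟩
  have hterm : ∀ q ∈ Finset.HasAntidiagonal.antidiagonal n,
      ‖PowerSeries.coeff (q.1 + 1) b * PowerSeries.coeff (q.2 + 1) f‖ ≤
        C * D * K ^ n * n.factorial := by
    intro q hq
    have hq' := Finset.HasAntidiagonal.mem_antidiagonal.1 hq
    have h1 : PowerSeries.coeff (q.2 + 1) f =
        q.2.factorial * PowerSeries.coeff q.2 (borel f) := by
      rw [coeff_borel, mul_div_cancel₀ _ (factorial_ne_zero_complex _)]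
    have h2 : (q.2.factorial : ℝ) ≤ n.factorial := by
      exact_mod_cast Nat.factorial_le (by omega)
    rw [h1, norm_mul, norm_mul, Complex.norm_natCast, ← hq', pow_add]
    calc ‖PowerSeries.coeff (q.1 + 1) b‖ * (q.2.factorial * ‖PowerSeries.coeff q.2 (borel f)‖)
        ≤ (C * K ^ q.1) * (n.factorial * (D * K ^ q.2)) := by
          gcongr
          · exact hbK q.1
          · exact hfK q.2
      _ = _ := by rw [hq']; ring
  dsimp only
  rw [coeff_borel, coeff_succ_succ_mul hb hf, norm_div, Complex.norm_natCast,
    div_le_iff₀ (by positivity)]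
  refine (norm_sum_le_of_le _ hterm).trans ?_
  rw [Finset.sum_const, Finset.Nat.card_antidiagonal, nsmul_eq_mul, Nat.factorial_succ]
  push_cast
  exact le_of_eq (by ring)

section Conv

variable {β φ : ℕ → ℂ} {x : ℝ}

theorem summable_of_geomBound_factorial {K : ℝ} {b : ℕ → ℂ} (hb : GeomBound K b)
    (hx : 0 ≤ x) : Summable fun n => ‖b n / n.factorial‖ * x ^ n := by
  obtain ⟨C, hC, hb⟩ := hb
  refine Summable.of_nonneg_of_le (fun n => by positivity) (fun n => ?_)
    ((Real.summable_pow_div_factorial (K * x)).mul_left C)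
  rw [norm_div, Complex.norm_natCast, mul_pow, div_mul_eq_mul_div, mul_div_assoc', ← mul_assoc]
  gcongr
  exact hb n

theorem differentiable_seqSum (h : ∀ x : ℝ, 0 ≤ x → Summable fun n => ‖β n‖ * x ^ n) :
    Differentiable ℂ (seqSum β) := fun z =>
  (hasDerivAt_seqSum (h (‖z‖ + 1) (by positivity)) (z := z) (by linarith)).1.differentiableAt

/-- The convolution of two convergent power series. -/
theorem hasSum_conv (hβ : Summable fun n => ‖β n‖ * x ^ n) (hφ : Summable fun n => ‖φ n‖ * x ^ n)
    {z : ℂ} (hz : ‖z‖ ≤ x) :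
    HasSum (fun n => (∑ q ∈ Finset.HasAntidiagonal.antidiagonal n, β q.1 * φ q.2 *
      (q.1.factorial * q.2.factorial / (n + 1).factorial)) * z ^ (n + 1))
      (conv id 0 (seqSum β) (seqSum φ) z) := by
  have hx : 0 ≤ x := (norm_nonneg z).trans hz
  have hprod : Summable fun n => ∑ q ∈ Finset.HasAntidiagonal.antidiagonal n,
      (‖β q.1‖ * x ^ q.1) * (‖φ q.2‖ * x ^ q.2) := by
    have h1 := summable_norm_sum_mul_antidiagonal_of_summable_norm
      (f := fun n => ‖β n‖ * x ^ n) (g := fun n => ‖φ n‖ * x ^ n) (by simpa using hβ.norm)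
      (by simpa using hφ.norm)
    exact h1.of_norm
  have hle : ∀ t ∈ uIoc (0 : ℝ) 1, ‖(1 - (t : ℂ)) * z‖ ≤ x ∧ ‖(t : ℂ) * z‖ ≤ x := by
    intro t ht
    rw [uIoc_of_le zero_le_one] at ht
    constructor
    · rw [norm_mul, ← Complex.ofReal_one, ← Complex.ofReal_sub, Complex.norm_real,
        Real.norm_of_nonneg (by linarith [ht.2])]
      nlinarith [ht.1, norm_nonneg z]
    · rw [norm_mul, Complex.norm_real, Real.norm_of_nonneg ht.1.le]
      nlinarith [ht.2, norm_nonneg z]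
  -- Termwise integration of the Cauchy product of the two series; each monomial contributes a Beta
  -- integral.
  have key := intervalIntegral.hasSum_integral_of_dominated_convergence (μ := volume) (a := 0)
    (b := 1)
    (F := fun n (t : ℝ) => z * ∑ q ∈ Finset.HasAntidiagonal.antidiagonal n,
      (β q.1 * ((1 - t) * z) ^ q.1) * (φ q.2 * (t * z) ^ q.2))
    (f := fun t : ℝ => z * (seqSum β ((1 - t) * z) * seqSum φ (t * z)))
    (fun n _ => ‖z‖ * ∑ q ∈ Finset.HasAntidiagonal.antidiagonal n, (‖β q.1‖ * x ^ q.1) * (‖φ q.2‖ * x ^ q.2))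
    (fun n => (by fun_prop : Continuous _).aestronglyMeasurable) ?_
    (Eventually.of_forall fun t _ => hprod.mul_left _) intervalIntegrable_const ?_
  · have hterm : ∀ n, ∫ t in (0 : ℝ)..1, z * ∑ q ∈ Finset.HasAntidiagonal.antidiagonal n,
        (β q.1 * ((1 - t) * z) ^ q.1) * (φ q.2 * (t * z) ^ q.2) =
        (∑ q ∈ Finset.HasAntidiagonal.antidiagonal n, β q.1 * φ q.2 *
        (q.1.factorial * q.2.factorial / (n + 1).factorial)) * z ^ (n + 1) := by
      intro n
      rw [intervalIntegral.integral_const_mul, intervalIntegral.integral_finsetSum]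
      · rw [Finset.mul_sum, Finset.sum_mul]
        refine Finset.sum_congr rfl fun q hq => ?_
        have hq' := Finset.HasAntidiagonal.mem_antidiagonal.1 hq
        have h1 : ∀ t : ℝ, (β q.1 * ((1 - t) * z) ^ q.1) * (φ q.2 * (t * z) ^ q.2) =
            (β q.1 * φ q.2 * z ^ n) * ((t : ℂ) ^ q.2 * (1 - t) ^ q.1) := by
          intro t
          rw [← hq', mul_pow, mul_pow, pow_add]
          ring
        simp only [h1]
        rw [intervalIntegral.integral_const_mul, integral_pow_mul_one_sub_pow, hq']
        ring
      · intro q _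
        exact (by fun_prop : Continuous _).intervalIntegrable _ _
    simp only [hterm] at key
    have hconv : conv id 0 (seqSum β) (seqSum φ) z =
        ∫ t in (0 : ℝ)..1, z * (seqSum β ((1 - t) * z) * seqSum φ (t * z)) := by
      simp only [conv, segInt, id, deriv_id', sub_zero, zero_add, mul_one, sub_mul, one_mul]
    rw [hconv]
    exact key
  · intro n
    refine Eventually.of_forall fun t ht => ?_
    obtain ⟨h1, h2⟩ := hle t ht
    rw [norm_mul]
    gcongr
    refine norm_sum_le_of_le _ fun q _ => ?_
    rw [norm_mul, norm_mul, norm_mul, norm_pow, norm_pow]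
    gcongr
  · refine Eventually.of_forall fun t ht => ?_
    obtain ⟨h1, h2⟩ := hle t ht
    have s1 := hasSum_seqSum hβ h1
    have s2 := hasSum_seqSum hφ h2
    have n1 : Summable fun n => ‖β n * ((1 - t) * z) ^ n‖ :=
      Summable.of_nonneg_of_le (fun n => norm_nonneg _) (fun n => by
        rw [norm_mul, norm_pow]; gcongr) hβ
    have n2 : Summable fun n => ‖φ n * (t * z) ^ n‖ :=
      Summable.of_nonneg_of_le (fun n => norm_nonneg _) (fun n => by
        rw [norm_mul, norm_pow]; gcongr) hφ
    refine HasSum.mul_left z ?_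
    rw [← s1.tsum_eq, ← s2.tsum_eq, tsum_mul_tsum_eq_tsum_sum_antidiagonal_of_summable_norm n1 n2]
    exact (summable_norm_sum_mul_antidiagonal_of_summable_norm n1 n2).of_norm.hasSum

end Conv

/-! ### From formal solutions to holomorphic solutions near the origin. -/

namespace ConvSystem

variable {P : Type} [Fintype P] {T : ConvSystem P} {K : ℝ}

theorem FormalEq.borel {f G : P → ℂ⟦X⟧} (hf : ∀ p, PowerSeries.constantCoeff (f p) = 0)
    (hG : ∀ p, PowerSeries.constantCoeff (G p) = 0) (h : T.FormalEq f G) (p : P) (n : ℕ) :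
    ((n : ℂ) + 1 - T.lam p) * PowerSeries.coeff n (LevelOne.borel (f p)) -
      T.a p * ((n + 1) * PowerSeries.coeff (n + 1) (LevelOne.borel (f p))) -
      ∑ p', T.N p p' * PowerSeries.coeff n (LevelOne.borel (f p')) =
      (n + 1) * PowerSeries.coeff (n + 1) (LevelOne.borel (G p)) := by
  have h1 := (formalEq_iff hf hG).1 h p (n + 1)
  simp only [coeff_borel]
  have h2 := factorial_ne_zero_complex n
  have h3 : ((n + 1).factorial : ℂ) = (n + 1) * n.factorial := by
    rw [Nat.factorial_succ]; push_cast; ring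
  have h4 : (n : ℂ) + 1 ≠ 0 := Nat.cast_add_one_ne_zero n
  have h5 : ∑ p', T.N p p' * (PowerSeries.coeff (n + 1) (f p') / n.factorial) =
      (∑ p', T.N p p' * PowerSeries.coeff (n + 1) (f p')) / n.factorial := by
    rw [Finset.sum_div]
    exact Finset.sum_congr rfl fun _ _ => by ring
  rw [h5, h3]
  push_cast at h1
  field_simp
  linear_combination h1

/-- If `a = 0`, each coefficient is obtained on division by `n + 1 - λ`, of modulus at least `(n +
1) (1 - Re λ)` because `Re λ ≥ 0`. If `a ≠ 0`, this is a first-order recurrence of ratio at most `(1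
+ ‖λ‖) / ‖a‖ ≤ K / 2`. The factors `n + 1` cancel in both cases. -/
theorem FormalEq.geomBound {f G : P → ℂ⟦X⟧} (hf : ∀ p, PowerSeries.constantCoeff (f p) = 0)
    (hG : ∀ p, PowerSeries.constantCoeff (G p) = 0) (h : T.FormalEq f G)
    (hl : ∀ p, 0 ≤ (T.lam p).re ∧ (T.lam p).re < 1) (hK : 1 ≤ K)
    (hKa : ∀ p, T.a p ≠ 0 → 2 * (1 + ‖T.lam p‖) ≤ K * ‖T.a p‖)
    (hγ : ∀ p, GeomBound K fun n => PowerSeries.coeff (n + 1) (LevelOne.borel (G p))) (p : P) :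
    GeomBound K fun n => PowerSeries.coeff n (LevelOne.borel (f p)) := by
  suffices H : ∀ k p, T.rk p < k → GeomBound K fun n => PowerSeries.coeff n (LevelOne.borel (f p))
    from H _ p (Nat.lt_succ_self _)
  intro k
  induction k with
  | zero => intro p hp; exact absurd hp (Nat.not_lt_zero _)
  | succ k ih =>
    intro p hp
    have hN : GeomBound K fun n =>
        ∑ p', T.N p p' * PowerSeries.coeff n (LevelOne.borel (f p')) := by
      refine GeomBound.sum _ fun p' _ => ?_
      by_cases hN : T.N p p' = 0
      · simpa [hN] using GeomBound.zero
      · exact (ih p' (by have := T.rk_lt hN; omega)).const_mul _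
    obtain ⟨C, hC, hN⟩ := hN
    obtain ⟨D, hD, hγ⟩ := hγ p
    have heq := h.borel hf hG p
    simp only at hN hγ
    by_cases ha : T.a p = 0
    · obtain ⟨hl0, hl1⟩ := hl p
      have hδ : 0 < 1 - (T.lam p).re := by linarith
      refine ⟨(C + D * K) / (1 - (T.lam p).re) + D, by positivity, fun n => ?_⟩
      have h1 : (n : ℝ) + 1 - (T.lam p).re ≤ ‖(n : ℂ) + 1 - T.lam p‖ := by
        refine le_trans (le_of_eq ?_) (Complex.re_le_norm _)
        simp
      have hn : (0 : ℝ) ≤ n := n.cast_nonneg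
      have h2 : ((n : ℝ) + 1) * (1 - (T.lam p).re) ≤ ‖(n : ℂ) + 1 - T.lam p‖ := by
        nlinarith
      have h3 : ‖(n : ℂ) + 1 - T.lam p‖ * ‖PowerSeries.coeff n (LevelOne.borel (f p))‖ ≤
          ((n : ℝ) + 1) * ((C + D) * K ^ n) := by
        have h4 : ((n : ℂ) + 1 - T.lam p) * PowerSeries.coeff n (LevelOne.borel (f p)) =
            (n + 1) * PowerSeries.coeff (n + 1) (LevelOne.borel (G p)) +
            ∑ p', T.N p p' * PowerSeries.coeff n (LevelOne.borel (f p')) := by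
          rw [ha] at heq
          linear_combination heq n
        have h5 : ‖(n : ℂ) + 1‖ = n + 1 := by
          rw [← Nat.cast_add_one, Complex.norm_natCast]; push_cast; ring
        rw [← norm_mul, h4]
        refine (norm_add_le _ _).trans ?_
        rw [norm_mul, h5]
        have := hN n
        have h6 : 0 ≤ C * K ^ n := by positivity
        have h7 := mul_le_mul_of_nonneg_left (hγ n) (by positivity : (0 : ℝ) ≤ n + 1)
        nlinarith
      have h8 : ‖PowerSeries.coeff n (LevelOne.borel (f p))‖ ≤
          (C + D) / (1 - (T.lam p).re) * K ^ n := by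
        rw [div_mul_eq_mul_div, le_div_iff₀ hδ]
        have h9 := (mul_le_mul_of_nonneg_right h2 (norm_nonneg
          (PowerSeries.coeff n (LevelOne.borel (f p))))).trans h3
        refine le_of_mul_le_mul_left ?_ (by positivity : (0 : ℝ) < n + 1)
        linarith
      refine h8.trans (mul_le_mul_of_nonneg_right ?_ (by positivity))
      have : (C + D) / (1 - (T.lam p).re) ≤ (C + D * K) / (1 - (T.lam p).re) := by
        gcongr
        nlinarith
      linarith
    · have ha' : 0 < ‖T.a p‖ := norm_pos_iff.2 ha
      refine GeomBound.of_recurrence hK (D := (C + D) / ‖T.a p‖) (by positivity) fun n => ?_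
      have hn : (0 : ℝ) ≤ n := n.cast_nonneg
      have h5 : ‖(n : ℂ) + 1‖ = n + 1 := by
        rw [← Nat.cast_add_one, Complex.norm_natCast]; push_cast; ring
      have h4 : T.a p * ((n + 1) * PowerSeries.coeff (n + 1) (LevelOne.borel (f p))) =
          ((n : ℂ) + 1 - T.lam p) * PowerSeries.coeff n (LevelOne.borel (f p)) -
          (∑ p', T.N p p' * PowerSeries.coeff n (LevelOne.borel (f p'))) -
          (n + 1) * PowerSeries.coeff (n + 1) (LevelOne.borel (G p)) := by
        linear_combination -heq n
      have h6 := congrArg norm h4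
      rw [norm_mul, norm_mul, h5] at h6
      have h7 : ‖(n : ℂ) + 1 - T.lam p‖ ≤ (n + 1) * (1 + ‖T.lam p‖) := by
        refine (norm_sub_le _ _).trans ?_
        rw [h5]
        nlinarith [norm_nonneg (T.lam p), mul_nonneg hn (norm_nonneg (T.lam p))]
      have h8 : ‖T.a p‖ * ((n + 1) * ‖PowerSeries.coeff (n + 1) (LevelOne.borel (f p))‖) ≤
          (n + 1) * ((1 + ‖T.lam p‖) * ‖PowerSeries.coeff n (LevelOne.borel (f p))‖ +
            (C + D) * K ^ n) := by
        rw [h6]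
        refine (norm_sub_le _ _).trans ?_
        rw [norm_mul _ (PowerSeries.coeff (n + 1) (LevelOne.borel (G p))), h5]
        have h9 := norm_sub_le (((n : ℂ) + 1 - T.lam p) *
          PowerSeries.coeff n (LevelOne.borel (f p)))
          (∑ p', T.N p p' * PowerSeries.coeff n (LevelOne.borel (f p')))
        rw [norm_mul] at h9
        have h10 := mul_le_mul_of_nonneg_right h7
          (norm_nonneg (PowerSeries.coeff n (LevelOne.borel (f p))))
        have h11 := mul_le_mul_of_nonneg_left (hγ n) (by positivity : (0 : ℝ) ≤ n + 1)
        have h12 := hN n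
        have h13 : 0 ≤ n * (C * K ^ n) := by positivity
        linarith
      have h9 : ‖T.a p‖ * ‖PowerSeries.coeff (n + 1) (LevelOne.borel (f p))‖ ≤
          (1 + ‖T.lam p‖) * ‖PowerSeries.coeff n (LevelOne.borel (f p))‖ + (C + D) * K ^ n := by
        refine le_of_mul_le_mul_left ?_ (by positivity : (0 : ℝ) < n + 1)
        linarith
      have h10 : (1 + ‖T.lam p‖) * ‖PowerSeries.coeff n (LevelOne.borel (f p))‖ ≤
          ‖T.a p‖ * (K / 2 * ‖PowerSeries.coeff n (LevelOne.borel (f p))‖) := by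
        have := mul_le_mul_of_nonneg_right (hKa p ha)
          (norm_nonneg (PowerSeries.coeff n (LevelOne.borel (f p))))
        linarith
      refine le_of_mul_le_mul_left ?_ ha'
      have h11 : ‖T.a p‖ * ((C + D) / ‖T.a p‖ * K ^ n) = (C + D) * K ^ n := by
        field_simp
      rw [mul_add, h11]
      linarith

/-- The Borel transforms of the formal solutions define a solution near `0`. -/
theorem isSol_seqSum (hl : ∀ p, 0 ≤ (T.lam p).re ∧ (T.lam p).re < 1) (hK : 1 ≤ K)
    (hKa : ∀ p, T.a p ≠ 0 → 2 * (1 + ‖T.lam p‖) ≤ K * ‖T.a p‖)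
    {B : P → P → ℂ⟦X⟧} (hB0 : ∀ p p', PowerSeries.constantCoeff (B p p') = 0)
    (hBK : ∀ p p', GeomBound K fun k => PowerSeries.coeff (k + 1) (B p p'))
    (hβ : ∀ p p', T.β p p' = seqSum fun n => PowerSeries.coeff n (LevelOne.borel (B p p')))
    {e : P → ℂ⟦X⟧} (he0 : ∀ p, PowerSeries.constantCoeff (e p) = 0)
    (heK : ∀ p, GeomBound K fun k => PowerSeries.coeff (k + 1) (e p))
    {f : ℕ → P → ℂ⟦X⟧} (hf0 : ∀ m p, PowerSeries.constantCoeff (f m p) = 0)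
    (hf : T.FormalEq (f 0) e) (hfs : ∀ m, T.FormalEq (f (m + 1)) fun p => ∑ p', B p p' * f m p') :
    (∀ m p, GeomBound K fun n => PowerSeries.coeff n (LevelOne.borel (f m p))) ∧
    T.IsSol (ball 0 (1 / (2 * K))) id 0
      (fun m p => if m = 1 then seqSum fun n => PowerSeries.coeff n (LevelOne.borel (e p)) else 0)
      (fun m p => match m with
        | 0 => 0
        | m + 1 => seqSum fun n => PowerSeries.coeff n (LevelOne.borel (f m p))) := by
  have hK0 : 0 ≤ K := by linarith
  -- One radius for all orders, inside the disc of radius `1 / K` where all the series converge.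
  set ρ := 1 / (2 * K) with hρ
  have hρ0 : 0 ≤ ρ := by positivity
  have hρK : ρ * K < 1 := by
    rw [hρ]; field_simp; norm_num
  have hGs0 : ∀ m p, PowerSeries.constantCoeff (∑ p', B p p' * f m p') = 0 := by
    intro m p; simp [hB0]
  have hborel_sum : ∀ m p n, PowerSeries.coeff n (LevelOne.borel (∑ p', B p p' * f m p')) =
      ∑ p', PowerSeries.coeff n (LevelOne.borel (B p p' * f m p')) := by
    intro m p n
    simp only [coeff_borel, map_sum, Finset.sum_div]
  have heb : ∀ p, GeomBound K fun n => PowerSeries.coeff (n + 1) (LevelOne.borel (e p)) := by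
    intro p
    obtain ⟨C, hC, h⟩ := heK p
    refine ⟨C * K, by positivity, fun n => ?_⟩
    dsimp only
    rw [coeff_borel, norm_div, Complex.norm_natCast]
    have h1 := h (n + 1)
    have h2 : (1 : ℝ) ≤ (n + 1).factorial := by exact_mod_cast Nat.succ_le_of_lt (Nat.factorial_pos _)
    refine (div_le_self (norm_nonneg _) h2).trans (h1.trans (le_of_eq ?_))
    rw [pow_succ]; ring
  have hgeo : ∀ m p, GeomBound K fun n => PowerSeries.coeff n (LevelOne.borel (f m p)) := by
    intro m
    induction m with
    | zero => exact hf.geomBound (hf0 0) he0 hl hK hKa heb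
    | succ m ih =>
      refine (hfs m).geomBound (hf0 _) (hGs0 m) hl hK hKa fun p => ?_
      simp only [hborel_sum]
      exact GeomBound.sum _ fun p' _ =>
        geomBound_coeff_succ_borel_mul hK (hB0 p p') (hf0 m p') (hBK p p') (ih p')
  have hes : ∀ p (x : ℝ), 0 ≤ x →
      Summable fun n => ‖PowerSeries.coeff n (LevelOne.borel (e p))‖ * x ^ n := fun p x hx => by
    simp only [coeff_borel]
    exact summable_of_geomBound_factorial (heK p) hx
  have hBs : ∀ p p' (x : ℝ), 0 ≤ x →
      Summable fun n => ‖PowerSeries.coeff n (LevelOne.borel (B p p'))‖ * x ^ n :=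
    fun p p' x hx => by
      simp only [coeff_borel]
      exact summable_of_geomBound_factorial (hBK p p') hx
  have hode : ∀ (F G : P → ℂ⟦X⟧), (∀ p, PowerSeries.constantCoeff (F p) = 0) →
      (∀ p, PowerSeries.constantCoeff (G p) = 0) → T.FormalEq F G →
      (∀ p, GeomBound K fun n => PowerSeries.coeff n (LevelOne.borel (F p))) →
      (∀ p, Summable fun n => ‖PowerSeries.coeff n (LevelOne.borel (G p))‖ * ρ ^ n) →
      T.SolvesOn (ball 0 ρ) id
        (fun p => seqSum fun n => PowerSeries.coeff n (LevelOne.borel (G p)))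
        (fun p => seqSum fun n => PowerSeries.coeff n (LevelOne.borel (F p))) := by
    intro F G hF0 hG0 hFG hF hG p
    have hFs := fun p => (hF p).summable hK hρ0 hρK
    refine ⟨fun z hz => (hasDerivAt_seqSum (hFs p)
      (mem_ball_zero_iff.1 hz)).1.differentiableAt.differentiableWithinAt, fun z hz => ?_⟩
    have hz' := mem_ball_zero_iff.1 hz
    have s1 := (hasDerivAt_seqSum (hFs p) hz').2
    have s2 := (hasDerivAt_seqSum (hG p) hz').2
    have s3 : ∀ p', HasSum _ _ := fun p' => hasSum_seqSum (hFs p') hz'.le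
    -- The series of `z φ'(z)`, the derivative series shifted by one index so that all series can be
    -- compared termwise.
    have s4 : HasSum (fun n : ℕ => (n : ℂ) * PowerSeries.coeff n (LevelOne.borel (F p)) * z ^ n)
        (z * deriv (seqSum fun n => PowerSeries.coeff n (LevelOne.borel (F p))) z) := by
      rw [← hasSum_nat_add_iff' 1]
      simp only [Finset.range_one, Finset.sum_singleton, Nat.cast_zero, zero_mul, sub_zero]
      have h1 : (fun n : ℕ => ((n + 1 : ℕ) : ℂ) *
          PowerSeries.coeff (n + 1) (LevelOne.borel (F p)) * z ^ (n + 1)) = fun n : ℕ =>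
          z * (((n : ℂ) + 1) * PowerSeries.coeff (n + 1) (LevelOne.borel (F p)) * z ^ n) := by
        funext n
        push_cast
        ring
      rw [h1]
      exact s1.mul_left z
    have lhs := (s4.sub (s1.mul_left (T.a p))).add ((s3 p).mul_left (1 - T.lam p))
    have rhs := s2.add (hasSum_sum fun p' (_ : p' ∈ Finset.univ) => (s3 p').mul_left (T.N p p'))
    simp only [id, deriv_id', mul_one, one_mul]
    rw [sub_mul]
    have hterm : ∀ n : ℕ, (n : ℂ) * PowerSeries.coeff n (LevelOne.borel (F p)) * z ^ n -
        T.a p * (((n : ℂ) + 1) * PowerSeries.coeff (n + 1) (LevelOne.borel (F p)) * z ^ n) +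
        (1 - T.lam p) * (PowerSeries.coeff n (LevelOne.borel (F p)) * z ^ n) =
        ((n : ℂ) + 1) * PowerSeries.coeff (n + 1) (LevelOne.borel (G p)) * z ^ n +
        ∑ p', T.N p p' * (PowerSeries.coeff n (LevelOne.borel (F p')) * z ^ n) := by
      intro n
      have h1 : ∑ p', T.N p p' * (PowerSeries.coeff n (LevelOne.borel (F p')) * z ^ n) =
          (∑ p', T.N p p' * PowerSeries.coeff n (LevelOne.borel (F p'))) * z ^ n := by
        rw [Finset.sum_mul]
        exact Finset.sum_congr rfl fun _ _ => by ring
      rw [h1]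
      linear_combination z ^ n * hFG.borel hF0 hG0 p n
    simp only [hterm] at lhs
    exact lhs.unique rhs
  refine ⟨hgeo, fun m p => ?_, fun _ _ => rfl, fun m => ?_⟩
  · split_ifs
    · exact differentiable_seqSum (hes p)
    · exact differentiable_const 0
  · cases m with
    -- At the first order the preceding unknown is set to `0`. The product of `B` with the constant
    -- term of order zero, which has no Borel transform, is accounted for by `e`.
    | zero =>
      refine (hode (f 0) e (hf0 0) he0 hf (hgeo 0) fun p => hes p ρ hρ0).congr_source isOpen_ball
        fun p z _ => ?_
      simp [source, conv, segInt]
    | succ m =>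
      have hsum : ∀ p p', Summable fun n =>
          ‖PowerSeries.coeff n (LevelOne.borel (B p p' * f m p'))‖ * ρ ^ n := fun p p' => by
        obtain ⟨C, _, h⟩ := geomBound_coeff_succ_borel_mul hK (hB0 p p') (hf0 m p') (hBK p p')
          (hgeo m p')
        exact (GeomBound.of_succ hK h).summable hK hρ0 hρK
      have hGsum : ∀ p, Summable fun n =>
          ‖PowerSeries.coeff n (LevelOne.borel (∑ p', B p p' * f m p'))‖ * ρ ^ n := fun p => by
        refine Summable.of_nonneg_of_le (fun n => by positivity) (fun n => ?_)
          (summable_sum fun p' (_ : p' ∈ Finset.univ) => hsum p p')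
        rw [hborel_sum, ← Finset.sum_mul]
        gcongr
        exact norm_sum_le _ _
      refine (hode (f (m + 1)) _ (hf0 _) (hGs0 m) (hfs m) (hgeo _) hGsum).congr_source
        isOpen_ball fun p z hz => ?_
      have hz' := (mem_ball_zero_iff.1 hz).le
      have hconv : ∀ p', HasSum
          (fun n => PowerSeries.coeff n (LevelOne.borel (B p p' * f m p')) * z ^ n)
          (conv id 0 (T.β p p')
            (seqSum fun n => PowerSeries.coeff n (LevelOne.borel (f m p'))) z) := by
        intro p'
        have h1 := hasSum_conv (hBs p p' ρ hρ0) ((hgeo m p').summable hK hρ0 hρK) hz'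
        rw [← hasSum_nat_add_iff' 1]
        simp only [Finset.range_one, Finset.sum_singleton, coeff_zero_borel_mul (hB0 p p') (hf0 m p'),
          zero_mul, sub_zero, coeff_succ_borel_mul (hB0 p p') (hf0 m p'), hβ]
        exact h1
      have h2 := hasSum_sum fun p' (_ : p' ∈ Finset.univ) => hconv p'
      simp only [← Finset.sum_mul, ← hborel_sum] at h2
      simp only [source, Nat.add_eq_right, Nat.add_eq_zero_iff, one_ne_zero, and_false, if_false,
        Pi.zero_apply, zero_add]
      exact h2.unique (hasSum_seqSum (hGsum p) hz')

end ConvSystem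

theorem GeomBound.mono {K K' : ℝ} (hK : 0 ≤ K) (hKK' : K ≤ K') {c : ℕ → ℂ} (h : GeomBound K c) :
    GeomBound K' c := by
  obtain ⟨C, hC, h⟩ := h
  exact ⟨C, hC, fun n => (h n).trans (by gcongr)⟩

theorem IsConvergent.geomBound {f : ℂ⟦X⟧} (hf : IsConvergent f) :
    ∃ K, 1 ≤ K ∧ GeomBound K fun k => PowerSeries.coeff (k + 1) f := by
  obtain ⟨r, hr, hs⟩ := hf
  obtain ⟨M, hM⟩ := hs.tendsto_atTop_zero.bddAbove_range
  have hM' : ∀ s, ‖PowerSeries.coeff s f‖ * r ^ s ≤ M := fun s => hM (mem_range_self s)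
  have hM0 : 0 ≤ M := le_trans (by positivity) (hM' 0)
  refine ⟨max 1 r⁻¹, le_max_left _ _, M * max 1 r⁻¹, by positivity, fun k => ?_⟩
  have h1 : ‖PowerSeries.coeff (k + 1) f‖ ≤ M * r⁻¹ ^ (k + 1) := by
    rw [inv_pow, ← div_eq_mul_inv, le_div_iff₀ (by positivity)]
    exact hM' (k + 1)
  refine h1.trans ?_
  rw [mul_assoc, ← pow_succ']
  have := le_max_right (1 : ℝ) r⁻¹
  gcongr

theorem exists_uniform_bound {ι : Type*} [Finite ι] {p : ι → ℝ → Prop}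
    (hp : ∀ i K K', 1 ≤ K → K ≤ K' → p i K → p i K') (h : ∀ i, ∃ K, 1 ≤ K ∧ p i K) :
    ∃ K, 1 ≤ K ∧ ∀ i, p i K := by
  choose K hK1 hK using h
  obtain ⟨M, hM⟩ := (Set.finite_range K).bddAbove
  exact ⟨max 1 M, le_max_left _ _, fun i => hp i (K i) _ (hK1 i)
    ((hM (mem_range_self i)).trans (le_max_right _ _)) (hK i)⟩

/-! ### The prepared system as a convolution system. -/

theorem blockDiagonal'_smul_one {J : ℕ} (size : Fin J → ℕ) (c : Fin J → ℂ) :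
    Matrix.blockDiagonal' (fun j => c j • (1 : Matrix (Fin (size j)) (Fin (size j)) ℂ)) =
      Matrix.diagonal fun x => c x.1 := by
  ext ⟨j, i⟩ ⟨j', i'⟩
  by_cases h : j = j'
  · subst h
    by_cases h' : i = i'
    · subst h'
      simp [Matrix.blockDiagonal'_apply_eq]
    · rw [Matrix.blockDiagonal'_apply_eq, Matrix.diagonal_apply_ne _ (by simpa using h')]
      simp [h']
  · rw [Matrix.blockDiagonal'_apply_ne _ _ _ h, Matrix.diagonal_apply_ne _ (by simp [h])]

namespace PreparedSystem

variable {J : ℕ} [NeZero J] (S : PreparedSystem J)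

/-- The nilpotent part of the matrix of exponents of formal monodromy. -/
def nilp : Matrix S.Idx S.Idx ℂ := Matrix.blockDiagonal' fun j => jordanBlock (S.size j)

theorem A0_apply (x y : S.Idx) :
    S.A0 x y = PowerSeries.C (Matrix.diagonal (fun x : S.Idx => S.a x.1) x y) +
      PowerSeries.X * PowerSeries.C (Matrix.diagonal (fun x : S.Idx => S.lam x.1) x y +
        S.nilp x y) := by
  have h1 : (Matrix.blockDiagonal' fun j =>
      S.lam j • (1 : Matrix (Fin (S.size j)) (Fin (S.size j)) ℂ) + jordanBlock (S.size j)) =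
      Matrix.diagonal (fun x : S.Idx => S.lam x.1) + S.nilp := by
    rw [← blockDiagonal'_smul_one, nilp, ← Matrix.blockDiagonal'_add]
    rfl
  simp only [A0, normalForm, h1, blockDiagonal'_smul_one, constMat, Matrix.add_apply,
    Matrix.smul_apply, Matrix.map_apply, smul_eq_mul]

theorem constantCoeff_A0 (x y : S.Idx) : PowerSeries.constantCoeff (S.A0 x y) =
    Matrix.diagonal (fun x : S.Idx => S.a x.1) x y := by
  simp [A0_apply]

theorem coeff_succ_A0 (x y : S.Idx) (n : ℕ) : PowerSeries.coeff (n + 1) (S.A0 x y) =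
    if n = 0 then Matrix.diagonal (fun x : S.Idx => S.lam x.1) x y + S.nilp x y else 0 := by
  rw [A0_apply, map_add, PowerSeries.coeff_succ_X_mul, PowerSeries.coeff_C, PowerSeries.coeff_C,
    if_neg (Nat.succ_ne_zero n), zero_add]

theorem constantCoeff_F (x y : S.Idx) :
    PowerSeries.constantCoeff (S.F x y) = (1 : Matrix S.Idx S.Idx ℂ) x y :=
  congrFun (congrFun S.F_zero x) y

/-- As `F(0) = 1`, the constant terms of the gauge equation give `A(0) = A₀(0)`. -/
theorem constantCoeff_B (x y : S.Idx) : PowerSeries.constantCoeff (S.B x y) = 0 := by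
  have h := congrArg PowerSeries.constantCoeff (congrFun (congrFun S.F_eq x) y)
  simp only [Matrix.add_apply, Matrix.mul_apply, map_add, map_sum, map_mul, constantCoeff_F,
    eulerTwo, Matrix.map_apply] at h
  change _ + ∑ k, _ * PowerSeries.constantCoeff (S.A0 k y) = _ at h
  simp only [constantCoeff_A0, Matrix.one_apply, ite_mul, one_mul, zero_mul, mul_ite, mul_one,
    mul_zero, Finset.sum_ite_eq, Finset.sum_ite_eq', Finset.mem_univ, if_true, map_pow,
    PowerSeries.constantCoeff_X, ne_eq, OfNat.ofNat_ne_zero, not_false_eq_true, zero_pow,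
    zero_add] at h
  rw [B, Matrix.sub_apply, map_sub, ← h, constantCoeff_A0, sub_self]

/-- The coefficient of `x` in the gauge equation shows that the coefficient of `x` in `B` is the
commutator of that of `F` with the diagonal matrix of the `a`; it vanishes between equal values of
`a`. In Borel terms, this is the vanishing of `β(0)`. -/
theorem coeff_one_B {x y : S.Idx} (hxy : S.a x.1 = S.a y.1) :
    PowerSeries.coeff 1 (S.B x y) = 0 := by
  have h := congrArg (PowerSeries.coeff 1) (congrFun (congrFun S.F_eq x) y)
  have hA : S.A = S.A0 + S.B := by rw [B]; abel
  have hmul : ∀ φ ψ : ℂ⟦X⟧, PowerSeries.coeff 1 (φ * ψ) = PowerSeries.coeff 1 φ *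
      PowerSeries.constantCoeff ψ + PowerSeries.constantCoeff φ * PowerSeries.coeff 1 ψ := by
    intro φ ψ
    rw [PowerSeries.coeff_mul, Finset.Nat.antidiagonal_succ]
    simp [add_comm]
  have h2 : PowerSeries.coeff 1 (eulerTwo S.F x y) = 0 := by
    rw [eulerTwo, Matrix.map_apply, ConvSystem.coeff_succ_X_sq_mul_derivative _ 0]
    simp
  rw [Matrix.add_apply, map_add, h2, zero_add] at h
  change PowerSeries.coeff 1 ((S.F * S.A0) x y) = _ at h
  rw [hA] at h
  simp only [Matrix.mul_apply, map_sum, hmul, Matrix.add_apply, map_add, constantCoeff_F,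
    constantCoeff_A0, constantCoeff_B, add_zero, Finset.sum_add_distrib, Matrix.one_apply,
    ite_mul, one_mul, zero_mul, mul_ite, mul_one, mul_zero, Finset.sum_ite_eq,
    Finset.sum_ite_eq', Finset.mem_univ, if_true, Matrix.diagonal_apply, add_mul] at h
  rw [← hxy] at h
  linear_combination -h

theorem exists_geomBound : ∃ K, 1 ≤ K ∧
    (∀ x y, GeomBound K fun k => PowerSeries.coeff (k + 1) (S.B x y)) ∧
    ∀ j, S.a j ≠ 0 → 2 * (1 + ‖S.lam j‖) ≤ K * ‖S.a j‖ := by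
  obtain ⟨K, hK1, hK⟩ := exists_uniform_bound (ι := S.Idx × S.Idx)
    (p := fun i K => GeomBound K fun k => PowerSeries.coeff (k + 1) (S.B i.1 i.2))
    (fun i K K' h1 h2 h => h.mono (by linarith) h2) fun i => by
      obtain ⟨K, hK1, hK⟩ := (S.A_convergent i.1 i.2).geomBound
      refine ⟨K, hK1, ?_⟩
      have hA0 : GeomBound K fun k => PowerSeries.coeff (k + 1) (S.A0 i.1 i.2) := by
        refine GeomBound.of_succ (D := 0) hK1 fun n => ?_
        simp [coeff_succ_A0]
      have := hK.add (hA0.const_mul (-1))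
      simpa [B, sub_eq_add_neg] using this
  obtain ⟨L, hL1, hL⟩ := exists_uniform_bound (ι := Fin J)
    (p := fun j K => S.a j ≠ 0 → 2 * (1 + ‖S.lam j‖) ≤ K * ‖S.a j‖)
    (fun j K K' _ h2 h ha => (h ha).trans (by gcongr)) fun j => by
      refine ⟨max 1 (2 * (1 + ‖S.lam j‖) / ‖S.a j‖), le_max_left _ _, fun ha => ?_⟩
      have ha' : 0 < ‖S.a j‖ := norm_pos_iff.2 ha
      rw [← div_le_iff₀ ha']
      exact le_max_right _ _
  refine ⟨max K L, hK1.trans (le_max_left _ _), fun x y =>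
    (hK (x, y)).mono (by linarith) (le_max_left _ _), fun j ha => (hL j ha).trans ?_⟩
  have := le_max_right K L
  gcongr

/-- The coupling of the entries of the unknown by the matrix `B`. -/
def coupling (p p' : S.Idx × S.Col) : ℂ⟦X⟧ := if p'.2 = p.2 then S.B p.1 p'.1 else 0

/-- The matrix of `f ↦ J f - f J₁`, where `J` is the nilpotent part. -/
def adNilp (p p' : S.Idx × S.Col) : ℂ :=
  (if p'.2 = p.2 then S.nilp p.1 p'.1 else 0) -
    if p'.1 = p.1 then jordanBlock (S.size 0) p'.2 p.2 else 0

theorem jordanBlock_ne_zero {n : ℕ} {i j : Fin n} (h : jordanBlock n i j ≠ 0) :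
    (i : ℕ) + 1 = j := by
  by_contra h'
  exact h (by simp [jordanBlock, h'])

/-- The nonzero entries of `adNilp` move one step down a Jordan block, or to the preceding column. -/
theorem adNilp_ne_zero {p p' : S.Idx × S.Col} (h : S.adNilp p p' ≠ 0) :
    p'.1.1 = p.1.1 ∧ (((p.1.2 : ℕ) + 1 = p'.1.2 ∧ p'.2 = p.2) ∨
      ((p.1.2 : ℕ) = p'.1.2 ∧ (p'.2 : ℕ) + 1 = p.2)) := by
  obtain ⟨⟨j, i⟩, q⟩ := p
  obtain ⟨⟨j', i'⟩, q'⟩ := p'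
  simp only [adNilp] at h
  by_cases h1 : q' = q ∧ S.nilp ⟨j, i⟩ ⟨j', i'⟩ ≠ 0
  · obtain ⟨rfl, h1⟩ := h1
    have hj : j = j' := by
      by_contra hj
      exact h1 (Matrix.blockDiagonal'_apply_ne _ _ _ hj)
    subst hj
    rw [nilp, Matrix.blockDiagonal'_apply_eq] at h1
    exact ⟨rfl, Or.inl ⟨jordanBlock_ne_zero h1, rfl⟩⟩
  · have h2 : (if q' = q then S.nilp ⟨j, i⟩ ⟨j', i'⟩ else 0) = 0 := by
      by_cases hq : q' = q
      · rw [if_pos hq]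
        by_contra h3
        exact h1 ⟨hq, h3⟩
      · rw [if_neg hq]
    rw [h2, zero_sub, neg_ne_zero] at h
    by_cases hx : (⟨j', i'⟩ : S.Idx) = ⟨j, i⟩
    · rw [if_pos hx] at h
      have := jordanBlock_ne_zero h
      cases hx
      exact ⟨rfl, Or.inr ⟨rfl, this⟩⟩
    · exact absurd (if_neg hx) h

theorem sum_adNilp {R : Type*} [CommRing R] (φ : ℂ →+* R) (p : S.Idx × S.Col)
    (f : S.Idx → S.Col → R) : ∑ p' : S.Idx × S.Col, φ (S.adNilp p p') * f p'.1 p'.2 =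
      (∑ x, φ (S.nilp p.1 x) * f x p.2) -
        ∑ q, f p.1 q * φ (jordanBlock (S.size 0) q p.2) := by
  simp only [adNilp, map_sub, sub_mul, Finset.sum_sub_distrib, Fintype.sum_prod_type]
  congr 1
  · refine Finset.sum_congr rfl fun x _ => ?_
    rw [Finset.sum_eq_single p.2]
    · simp
    · intro q _ hq
      simp [hq]
    · simp
  · rw [Finset.sum_eq_single p.1]
    · simp [mul_comm]
    · intro x _ hx
      simp [hx]
    · simp

theorem geomBound_coupling {K : ℝ}
    (hK : ∀ x y, GeomBound K fun k => PowerSeries.coeff (k + 1) (S.B x y)) (p p' : S.Idx × S.Col) :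
    GeomBound K fun k => PowerSeries.coeff (k + 1) (S.coupling p p') := by
  unfold coupling
  split_ifs
  · exact hK _ _
  · simpa using GeomBound.zero

/-- The system of convolution equations for the entries of the Borel transforms. -/
def convSystem : ConvSystem (S.Idx × S.Col) where
  a p := S.a p.1.1
  lam p := S.lam p.1.1
  N := S.adNilp
  -- The coupling moves to the next row of the block or to the preceding column; either lowers this
  -- rank by one.
  rk p := (S.size p.1.1 - 1 - p.1.2) + p.2
  β p p' := seqSum fun n => PowerSeries.coeff n (borel (S.coupling p p'))
  rk_lt {p p'} h := by
    obtain ⟨⟨j, i⟩, q⟩ := p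
    obtain ⟨⟨j', i'⟩, q'⟩ := p'
    obtain ⟨h1, h2⟩ := S.adNilp_ne_zero h
    simp only at h1 h2 ⊢
    subst h1
    have hi := i.2
    have hi' := i'.2
    rcases h2 with ⟨h2, h3⟩ | ⟨h2, h3⟩
    · subst h3
      omega
    · omega
  a_eq h := congrArg S.a (S.adNilp_ne_zero h).1
  lam_eq h := congrArg S.lam (S.adNilp_ne_zero h).1
  diff p p' := by
    obtain ⟨K, _, hK, _⟩ := S.exists_geomBound
    refine differentiable_seqSum fun x hx => ?_
    simp only [coeff_borel]
    exact summable_of_geomBound_factorial (S.geomBound_coupling hK p p') hx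

theorem constantCoeff_coupling (p p' : S.Idx × S.Col) :
    PowerSeries.constantCoeff (S.coupling p p') = 0 := by
  unfold coupling
  split_ifs
  · exact S.constantCoeff_B _ _
  · simp

theorem sum_coupling (f : Matrix S.Idx S.Col ℂ⟦X⟧) (p : S.Idx × S.Col) :
    ∑ p' : S.Idx × S.Col, S.coupling p p' * f p'.1 p'.2 = (S.B * f) p.1 p.2 := by
  simp only [coupling, Fintype.sum_prod_type, Matrix.mul_apply]
  refine Finset.sum_congr rfl fun x _ => ?_
  rw [Finset.sum_eq_single p.2]
  · simp
  · intro q _ hq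
    simp [hq]
  · simp

theorem mul_truncId (p : S.Idx × S.Col) : (S.B * S.truncId) p.1 p.2 = S.B p.1 ⟨0, p.2⟩ := by
  simp [truncId, Matrix.mul_apply, Matrix.one_apply]

theorem perturbed_apply (f : Matrix S.Idx S.Col ℂ⟦X⟧) (p : S.Idx × S.Col) :
    (eulerTwo f - S.A0 * f +
      (PowerSeries.X : ℂ⟦X⟧) • (f * constMat (jordanBlock (S.size 0)))) p.1 p.2 =
    PowerSeries.X ^ 2 * PowerSeries.derivative ℂ (f p.1 p.2) -
      PowerSeries.C (S.a p.1.1) * f p.1 p.2 -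
      PowerSeries.X * (PowerSeries.C (S.lam p.1.1) * f p.1 p.2 +
        ∑ p' : S.Idx × S.Col, PowerSeries.C (S.adNilp p p') * f p'.1 p'.2) := by
  rw [S.sum_adNilp (PowerSeries.C (R := ℂ)) p f]
  have h1 : (S.A0 * f) p.1 p.2 = PowerSeries.C (S.a p.1.1) * f p.1 p.2 + PowerSeries.X *
      (PowerSeries.C (S.lam p.1.1) * f p.1 p.2 +
        ∑ x, PowerSeries.C (S.nilp p.1 x) * f x p.2) := by
    simp only [Matrix.mul_apply, A0_apply, Matrix.diagonal_apply, map_add, add_mul, mul_add,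
      Finset.sum_add_distrib, apply_ite (PowerSeries.C (R := ℂ)), map_zero, ite_mul, zero_mul,
      mul_ite, mul_zero, Finset.sum_ite_eq, Finset.mem_univ, if_true, Finset.mul_sum, mul_assoc]
  rw [Matrix.add_apply, Matrix.sub_apply, h1, Matrix.smul_apply, Matrix.mul_apply]
  simp only [eulerTwo, constMat, Matrix.map_apply, smul_eq_mul]
  ring

theorem formalEq_iff_matrix {f G : Matrix S.Idx S.Col ℂ⟦X⟧} :
    S.convSystem.FormalEq (fun p => f p.1 p.2) (fun p => G p.1 p.2) ↔
      eulerTwo f - S.A0 * f +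
        (PowerSeries.X : ℂ⟦X⟧) • (f * constMat (jordanBlock (S.size 0))) = G := by
  constructor
  · intro h
    ext1 x q
    rw [S.perturbed_apply f (x, q)]
    exact h (x, q)
  · intro h p
    subst h
    exact (S.perturbed_apply f p).symm

/-- On the first block `a = λ = 0`, and `J I_{n,n₁} = I_{n,n₁} J_{n₁}`. -/
theorem perturbed_truncId : eulerTwo S.truncId - S.A0 * S.truncId +
    (PowerSeries.X : ℂ⟦X⟧) • (S.truncId * constMat (jordanBlock (S.size 0))) = 0 := by
  ext1 x q
  rw [S.perturbed_apply _ (x, q), S.sum_adNilp (PowerSeries.C (R := ℂ)) (x, q) S.truncId]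
  obtain ⟨j, i⟩ := x
  have h1 : ∑ y, PowerSeries.C (S.nilp ⟨j, i⟩ y) * S.truncId y q =
      PowerSeries.C (S.nilp ⟨j, i⟩ ⟨0, q⟩) := by
    simp [truncId, Matrix.one_apply]
  have h2 : ∑ q', S.truncId ⟨j, i⟩ q' * PowerSeries.C (jordanBlock (S.size 0) q' q) =
      PowerSeries.C (S.nilp ⟨j, i⟩ ⟨0, q⟩) := by
    by_cases hj : j = 0
    · subst hj
      simp [truncId, Matrix.one_apply, nilp, Matrix.blockDiagonal'_apply_eq]
    · rw [nilp, Matrix.blockDiagonal'_apply_ne _ _ _ hj]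
      simp [truncId, hj]
  simp only [h1, h2, sub_self, add_zero, Matrix.zero_apply]
  by_cases hj : j = 0
  · subst hj
    rw [S.a_zero, S.lam_zero]
    by_cases hq : i = q
    · subst hq
      have h3 : S.truncId ⟨0, i⟩ i = 1 := Matrix.one_apply_eq (⟨0, i⟩ : S.Idx)
      simp [h3]
    · simp [truncId, hq]
  · simp [truncId, hj]

theorem constantCoeff_B_mul (f : Matrix S.Idx S.Col ℂ⟦X⟧) (x : S.Idx) (q : S.Col) :
    PowerSeries.constantCoeff ((S.B * f) x q) = 0 := by
  simp [Matrix.mul_apply, constantCoeff_B]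

/-- The solvability condition of `exists_formalEq`. At the first order it is `coeff_one_B`, since
the first block has `a = 0`; afterwards both factors vanish at `x = 0`. -/
theorem coeff_one_B_mul {f : Matrix S.Idx S.Col ℂ⟦X⟧}
    (hf : f = S.truncId ∨ ∀ x q, PowerSeries.constantCoeff (f x q) = 0) {x : S.Idx}
    (hx : S.a x.1 = 0) (q : S.Col) : PowerSeries.coeff 1 ((S.B * f) x q) = 0 := by
  rcases hf with rfl | hf
  · rw [S.mul_truncId (x, q)]
    exact S.coeff_one_B (hx.trans S.a_zero.symm)
  · rw [Matrix.mul_apply, map_sum]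
    refine Finset.sum_eq_zero fun y _ => ?_
    rw [PowerSeries.coeff_mul, Finset.Nat.antidiagonal_succ]
    simp [constantCoeff_B, hf]

theorem existsUnique_isPerturbativeExpansion :
    ∃! f : ℕ → Matrix S.Idx S.Col ℂ⟦X⟧, S.IsPerturbativeExpansion f := by
  have hl : ∀ p, (S.convSystem.lam p).re < 1 := fun p => (S.lam_re p.1.1).2
  have hstep : ∀ f : Matrix S.Idx S.Col ℂ⟦X⟧, ∃ g : Matrix S.Idx S.Col ℂ⟦X⟧,
      (f = S.truncId ∨ ∀ x q, PowerSeries.constantCoeff (f x q) = 0) →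
      (∀ x q, PowerSeries.constantCoeff (g x q) = 0) ∧ eulerTwo g - S.A0 * g +
        (PowerSeries.X : ℂ⟦X⟧) • (g * constMat (jordanBlock (S.size 0))) = S.B * f := by
    intro f
    by_cases hf : f = S.truncId ∨ ∀ x q, PowerSeries.constantCoeff (f x q) = 0
    · obtain ⟨g, hg0, hg⟩ := S.convSystem.exists_formalEq hl
        (G := fun p => (S.B * f) p.1 p.2) (fun p => S.constantCoeff_B_mul f p.1 p.2)
        fun p hp => S.coeff_one_B_mul hf hp p.2
      exact ⟨fun x q => g (x, q), fun _ => ⟨fun x q => hg0 (x, q), S.formalEq_iff_matrix.1 hg⟩⟩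
    · exact ⟨f, fun h => absurd h hf⟩
  choose step hstep using hstep
  let f : ℕ → Matrix S.Idx S.Col ℂ⟦X⟧ := fun m => Nat.rec S.truncId (fun _ g => step g) m
  have hf : ∀ m, f m = S.truncId ∨ ∀ x q, PowerSeries.constantCoeff (f m x q) = 0 := by
    intro m
    induction m with
    | zero => exact Or.inl rfl
    | succ m ih => exact Or.inr (hstep (f m) ih).1
  refine ⟨f, ⟨rfl, fun m hm => ?_, S.perturbed_truncId, fun m => (hstep (f m) (hf m)).2⟩, ?_⟩
  · obtain ⟨m, rfl⟩ := Nat.exists_eq_succ_of_ne_zero (Nat.one_le_iff_ne_zero.1 hm)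
    exact (hstep (f m) (hf m)).1
  · intro g hg
    funext m
    induction m with
    | zero => exact hg.zero
    | succ m ih =>
      have h1 := S.formalEq_iff_matrix.2 (hg.order_succ m)
      have h2 := S.formalEq_iff_matrix.2 (hstep (f m) (hf m)).2
      rw [ih] at h1
      have h3 := h1.unique hl (fun p => S.constantCoeff_B_mul (f m) p.1 p.2)
        (fun p => hg.constantCoeff_eq_zero (m + 1) (Nat.succ_pos m) p.1 p.2)
        (fun p => (hstep (f m) (hf m)).1 p.1 p.2) h2
      ext1 x q
      exact congrFun h3 (x, q)

end PreparedSystem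

/-! ### Matrix exponentials and the constant-coefficient matrix equation. -/

section MatrixExp

attribute [local instance] Matrix.linftyOpNormedRing Matrix.linftyOpNormedAlgebra

theorem hasDerivAt_exp_smul_apply {n : ℕ} (A : Matrix (Fin n) (Fin n) ℂ) (u : ℂ) (i k : Fin n) :
    HasDerivAt (fun u : ℂ => NormedSpace.exp (u • A) i k) ((NormedSpace.exp (u • A) * A) i k) u := by
  have h := hasDerivAt_exp_smul_const (𝕂 := ℂ) A u
  have h2 := (LinearMap.toContinuousLinearMap
    (Matrix.entryLinearMap ℂ ℂ i k : Matrix (Fin n) (Fin n) ℂ →ₗ[ℂ] ℂ)).hasFDerivAt.comp_hasDerivAt u h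
  exact h2

theorem exp_smul_mul_exp_neg_smul {n : ℕ} (A : Matrix (Fin n) (Fin n) ℂ) (u : ℂ) :
    NormedSpace.exp (u • A) * NormedSpace.exp ((-u) • A) = 1 := by
  rw [← Matrix.exp_add_of_commute _ _ (((Commute.refl A).smul_left u).smul_right (-u)), ← add_smul,
    add_neg_cancel, zero_smul, NormedSpace.exp_zero]

theorem commute_exp_smul {n : ℕ} (A : Matrix (Fin n) (Fin n) ℂ) (u : ℂ) :
    NormedSpace.exp (u • A) * A = A * NormedSpace.exp (u • A) :=
  (((Commute.refl A).smul_left u).exp_left).eq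

end MatrixExp

/-- Entrywise product rule. -/
theorem hasDerivAt_matrix_mul_apply {l m n : Type*} [Fintype m] {M : ℂ → Matrix l m ℂ}
    {M' : Matrix l m ℂ} {N : ℂ → Matrix m n ℂ} {N' : Matrix m n ℂ} {u : ℂ}
    (hM : ∀ i k, HasDerivAt (fun u => M u i k) (M' i k) u)
    (hN : ∀ k j, HasDerivAt (fun u => N u k j) (N' k j) u) (i : l) (j : n) :
    HasDerivAt (fun u => (M u * N u) i j) ((M' * N u + M u * N') i j) u := by
  simp only [Matrix.add_apply, Matrix.mul_apply, ← Finset.sum_add_distrib]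
  exact HasDerivAt.fun_sum fun k _ => (hM i k).mul (hN k j)

/-- The solutions of `M' = (l - 1) M + A M - M C`. -/
theorem eq_exp_mul_exp_of_hasDerivAt {m n : ℕ} {U : Set ℂ} (hU : Convex ℝ U) {u₀ : ℂ}
    (h0 : u₀ ∈ U) (l : ℂ) (A : Matrix (Fin m) (Fin m) ℂ) (C : Matrix (Fin n) (Fin n) ℂ)
    {M : ℂ → Matrix (Fin m) (Fin n) ℂ} (hM : ∀ u ∈ U, ∀ i j,
      HasDerivAt (fun u => M u i j) (((l - 1) • M u + (A * M u - M u * C)) i j) u) :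
    ∃ K : Matrix (Fin m) (Fin n) ℂ, ∀ u ∈ U, M u = Complex.exp ((l - 1) * u) •
      (NormedSpace.exp (u • A) * K * NormedSpace.exp ((-u) • C)) := by
  -- Conjugation by the exponentials removes `A` and `C` and leaves the scalar equation `X' = (l -
  -- 1) X` for every entry.
  set X : ℂ → Matrix (Fin m) (Fin n) ℂ := fun u =>
    NormedSpace.exp ((-u) • A) * M u * NormedSpace.exp (u • C) with hX
  have hA : ∀ u i k, HasDerivAt (fun u : ℂ => NormedSpace.exp ((-u) • A) i k)
      ((-(NormedSpace.exp ((-u) • A) * A)) i k) u := by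
    intro u i k
    have := (hasDerivAt_exp_smul_apply A (-u) i k).comp u (hasDerivAt_neg u)
    simpa [Function.comp_def] using this
  have hXd : ∀ u ∈ U, ∀ i j, HasDerivAt (fun u => X u i j) ((l - 1) * X u i j) u := by
    intro u hu i j
    refine (hasDerivAt_matrix_mul_apply (hasDerivAt_matrix_mul_apply (hA u) (hM u hu))
      (hasDerivAt_exp_smul_apply C u) i j).congr_deriv ?_
    change _ = ((l - 1) • X u) i j
    rw [commute_exp_smul C u]
    refine congrFun (congrFun ?_ i) j
    simp only [hX, Matrix.mul_add, Matrix.mul_sub, Matrix.add_mul, Matrix.sub_mul, Matrix.neg_mul,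
      Matrix.mul_assoc, Matrix.mul_smul, Matrix.smul_mul]
    abel
  have hconst : ∀ u ∈ U, X u = Complex.exp ((l - 1) * u) •
      (Complex.exp (-((l - 1) * u₀)) • X u₀) := by
    intro u hu
    ext i j
    have h1 := eqOn_const_of_hasDerivAt_zero hU
      (f := fun u => Complex.exp (-((l - 1) * u)) * X u i j) (fun v hv => by
        have h2 : HasDerivAt (fun u => Complex.exp (-((l - 1) * u)))
            (Complex.exp (-((l - 1) * v)) * -(l - 1)) v := by
          simpa using ((hasDerivAt_id v).const_mul (l - 1)).neg.cexp
        exact (h2.mul (hXd v hv i j)).congr_deriv (by ring)) h0 hu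
    simp only [Matrix.smul_apply, smul_eq_mul]
    rw [← h1, ← mul_assoc, ← Complex.exp_add, add_neg_cancel, Complex.exp_zero, one_mul]
  refine ⟨Complex.exp (-((l - 1) * u₀)) • X u₀, fun u hu => ?_⟩
  have h1 : M u = NormedSpace.exp (u • A) * X u * NormedSpace.exp ((-u) • C) := by
    have h2 := exp_smul_mul_exp_neg_smul A u
    have h3 := exp_smul_mul_exp_neg_smul C u
    calc M u = (NormedSpace.exp (u • A) * NormedSpace.exp ((-u) • A)) * M u *
          (NormedSpace.exp (u • C) * NormedSpace.exp ((-u) • C)) := by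
          rw [h2, h3, Matrix.one_mul, Matrix.mul_one]
      _ = _ := by simp only [hX, Matrix.mul_assoc]
  rw [h1, hconst u hu, Matrix.mul_smul, Matrix.smul_mul]

/-! ### Exponents, logarithmic degrees and leading terms at a Stokes value. -/

namespace PreparedSystem

variable {J : ℕ} [NeZero J] (S : PreparedSystem J)

/-- The exponents occurring in the singularities; `none` stands for holomorphic functions. -/
def exponent : Option (Fin J) → ℂ
  | none => 0
  | some k => S.lam k

open Classical in
/-- One more than the largest power of the logarithm, for each exponent. -/
def logBound (ω : ℂ) (p : S.Idx × S.Col) : Option (Fin J) → ℕ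
  | none => 1
  | some k => if S.a k = ω then S.logDegree k p.2 + 1 else 0

theorem logBound_mono (ω : ℂ) {p p' : S.Idx × S.Col} (h : (p'.2 : ℕ) ≤ p.2) :
    S.logBound ω p' ≤ S.logBound ω p := by
  rintro (_ | k)
  · exact le_rfl
  · simp only [logBound]
    split_ifs
    · simp only [logDegree]
      split_ifs <;> omega
    · exact le_rfl

/-- The degree bounds depend only on the column and increase with it; `B` preserves the column and
the nilpotent coupling never raises it. The rank is at most `size - 1 + q`, so `N[k]` leaves room
for the homogeneous polynomials and, when `λ = 0`, for one more logarithm. -/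
theorem compatible {ω : ℂ} {r : ℝ} (hr : ∀ b ∈ S.Omega, b ∈ ball ω r → b = ω) :
    S.convSystem.Compatible r S.exponent (S.logBound ω) ω where
  re_nonneg := by
    rintro (_ | k)
    · simp [exponent]
    · exact (S.lam_re k).1
  re_lt p := (S.lam_re p.1.1).2
  deg_β p p' h := by
    refine S.logBound_mono ω (le_of_eq ?_)
    by_contra hq
    refine h ?_
    have : S.coupling p p' = 0 := if_neg fun h => hq (congrArg _ h)
    funext z
    simp [convSystem, this, seqSum, borel]
  deg_N p p' h := by
    refine S.logBound_mono ω ?_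
    rcases (S.adNilp_ne_zero h).2 with h | h
    · rw [h.2]
    · omega
  hol p := ⟨none, rfl, Nat.one_pos⟩
  β_zero p p' h := by
    have h1 : (S.convSystem.β p p') 0 = PowerSeries.coeff 0 (borel (S.coupling p p')) := by
      refine (tsum_eq_single 0 fun n hn => ?_).trans (by simp)
      rw [zero_pow hn, mul_zero]
    rw [h1, coeff_borel, coupling]
    split_ifs
    · rw [S.coeff_one_B h]; simp
    · simp
  exists_exponent p h := by
    have h' : S.a p.1.1 = ω := h
    have hsz := S.size_pos p.1.1
    refine ⟨some p.1.1, rfl, ?_, fun hl => ?_⟩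
    · simp only [logBound, if_pos h', convSystem, logDegree]
      split_ifs <;> omega
    · have hl' : S.lam p.1.1 = 0 := hl
      simp only [logBound, if_pos h', convSystem, logDegree, hl', ne_eq, not_true, if_false]
      omega
  ne p h y hy heq := by
    refine h (hr _ ⟨p.1.1, rfl⟩ ?_)
    change S.a p.1.1 ∈ ball ω r
    rw [show S.a p.1.1 = ω + y from heq.symm, mem_ball, dist_eq_norm, add_sub_cancel_left]
    exact mem_ball_zero_iff.1 hy

/-- The homogeneous parts at `ω` are the leading terms of the singularities. -/
theorem exists_leadingTerm {r : ℝ} (hr0 : 0 < r) {u₀ : ℂ} (h0 : u₀ ∈ logPlane r) {ω : ℂ}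
    {μ : Option (Fin J) → ℂ} {d : S.Idx × S.Col → Option (Fin J) → ℕ}
    {Φ R : S.Idx × S.Col → ℂ → ℂ} (h : S.convSystem.IsDecomposition r μ d ω Φ R) (j : Fin J) :
    ∃ K : Matrix (Fin (S.size j)) S.Col ℂ, (S.a j ≠ ω → K = 0) ∧ ∀ i q, ∀ u ∈ logPlane r,
      Φ (⟨j, i⟩, q) u - R (⟨j, i⟩, q) u = S.leadingTerm j K u i q := by
  by_cases ha : S.a j = ω
  · obtain ⟨K, hK⟩ := eq_exp_mul_exp_of_hasDerivAt (convex_logPlane hr0) h0 (S.lam j)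
      (jordanBlock (S.size j)) (jordanBlock (S.size 0))
      (M := fun u i q => Φ (⟨j, i⟩, q) u - R (⟨j, i⟩, q) u) fun u hu i q => by
        refine (h.homogeneous (⟨j, i⟩, q) ha u hu).congr_deriv ?_
        have h1 := S.sum_adNilp (RingHom.id ℂ) (⟨j, i⟩, q) fun x q => Φ (x, q) u - R (x, q) u
        simp only [RingHom.id_apply] at h1
        have h2 : ∑ x, S.nilp ⟨j, i⟩ x * (Φ (x, q) u - R (x, q) u) =
            ∑ i', jordanBlock (S.size j) i i' * (Φ (⟨j, i'⟩, q) u - R (⟨j, i'⟩, q) u) := by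
          rw [Fintype.sum_sigma, Finset.sum_eq_single j]
          · simp only [nilp, Matrix.blockDiagonal'_apply_eq]
          · intro j' _ hj'
            refine Finset.sum_eq_zero fun i' _ => ?_
            rw [nilp, Matrix.blockDiagonal'_apply_ne _ _ _ hj'.symm, zero_mul]
          · simp
        rw [h2] at h1
        exact congrArg _ h1
    exact ⟨K, fun h => absurd ha h, fun i q u hu => congrFun (congrFun (hK u hu) i) q⟩
  · refine ⟨0, fun _ => rfl, fun i q u hu => ?_⟩
    rw [h.eq (⟨j, i⟩, q) ha u hu]
    simp [leadingTerm]

/-- Splits off the exponent `none`, whose contribution is the holomorphic germ that a major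
disregards. -/
theorem remainder_eq (ω : ℂ) (x : S.Idx) (q : S.Col)
    (c : S.Idx × S.Col → Option (Fin J) → ℕ → ℂ → ℂ) (u : ℂ) :
    ∑ k, Complex.exp (S.exponent k * u) *
      ∑ i ∈ Finset.range (S.logBound ω (x, q) k), c (x, q) k i (Complex.exp u) * u ^ i =
    S.remainder ω (fun k x q i => c (x, q) (some k) i) x q u +
      c (x, q) none 0 (Complex.exp u) := by
  classical
  rw [Fintype.sum_option, add_comm]
  congr 1
  · rw [remainder, Finset.sum_filter]
    refine Finset.sum_congr rfl fun k _ => ?_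
    simp only [logBound, exponent]
    split_ifs <;> simp
  · simp [logBound, exponent]

end PreparedSystem

end LevelOne

end

/-! ### The main theorem. -/

theorem mainTheorem4 (J : ℕ) [NeZero J] (S : LevelOne.PreparedSystem J) :
    (∃! f : ℕ → Matrix S.Idx S.Col ℂ⟦X⟧, S.IsPerturbativeExpansion f) ∧
    ∀ f : ℕ → Matrix S.Idx S.Col ℂ⟦X⟧, S.IsPerturbativeExpansion f →
    ∀ m : ℕ, 1 ≤ m →
    ∀ ω ∈ S.Omega,
    -- every path `γ` from `0` towards `ω`, ending at `ξ₀` in a disc around `ω` free of other points of `Ω`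
    ∀ (ξ₀ : ℂ) (γ : Path (0 : ℂ) ξ₀), (∀ t : unitInterval, t ≠ 0 → γ t ∉ S.Omega) →
    ∀ r : ℝ, (∀ b ∈ S.Omega, b ∈ Metric.ball ω r → b = ω) → ξ₀ ∈ Metric.ball ω r →
    -- the Borel transform `φₘ` of `fₘ` has an analytic continuation `g` along `γ`
    ∃ g : S.Idx → S.Col → unitInterval → ℂ → ℂ,
      (∀ x q, LevelOne.IsContinuationAlong γ (LevelOne.borel (f m x q)) (g x q)) ∧
      -- for each determination `ζ₀` of `ln (ξ₀ - ω)`, the end germ extends to `G`, analytic on the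
      -- Riemann surface of `u = ln (ξ - ω)` over the punctured disc
      ∀ ζ₀ : ℂ, Complex.exp ζ₀ = ξ₀ - ω →
        ∃ G : S.Idx → S.Col → ℂ → ℂ,
          (∀ x q, DifferentiableOn ℂ (G x q) {u : ℂ | ‖Complex.exp u‖ < r} ∧
            ∀ᶠ u in 𝓝 ζ₀, G x q u = g x q 1 (ω + Complex.exp u)) ∧
          ∃ (K : (j : Fin J) → Matrix (Fin (S.size j)) S.Col ℂ)
            (c : Fin J → S.Idx → S.Col → ℕ → ℂ → ℂ),
            (∀ j, S.a j ≠ ω → K j = 0) ∧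
            (∀ k x q p, AnalyticAt ℂ (c k x q p) 0) ∧
            ∀ (j : Fin J) (i : Fin (S.size j)) (q : S.Col),
              LevelOne.IsMajor (G ⟨j, i⟩ q)
                (fun u => S.leadingTerm j (K j) u i q + S.remainder ω c ⟨j, i⟩ q u) := by
  refine ⟨S.existsUnique_isPerturbativeExpansion, ?_⟩
  intro f hf m hm ω hω ξ₀ γ hγ r hr hξ₀
  obtain ⟨m, rfl⟩ := Nat.exists_eq_succ_of_ne_zero (Nat.one_le_iff_ne_zero.1 hm)
  have hr0 : 0 < r := lt_of_le_of_lt dist_nonneg (Metric.mem_ball.1 hξ₀)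
  obtain ⟨L, hL1, hLB, hLa⟩ := S.exists_geomBound
  obtain ⟨hgeo, hsol⟩ := LevelOne.ConvSystem.isSol_seqSum (T := S.convSystem)
    (fun p => S.lam_re p.1.1) hL1 (fun p => hLa p.1.1) S.constantCoeff_coupling
    (S.geomBound_coupling hLB) (fun _ _ => rfl) (e := fun p => S.B p.1 ⟨0, p.2⟩)
    (fun p => S.constantCoeff_B _ _) (fun p => hLB _ _) (f := fun m p => f (m + 1) p.1 p.2)
    (fun m p => hf.constantCoeff_eq_zero (m + 1) (Nat.succ_pos m) p.1 p.2)
    (by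
      have h := S.formalEq_iff_matrix.2 (hf.order_succ 0)
      rw [hf.zero] at h
      simpa only [S.mul_truncId] using h)
    (fun m => by
      have h := S.formalEq_iff_matrix.2 (hf.order_succ (m + 1))
      simpa only [S.sum_coupling] using h)
  have hL0 : 0 < 1 / (2 * L) := by positivity
  obtain ⟨g, hg⟩ := hsol.continuation γ (fun t ht p hp => hγ t ht ⟨p.1.1, hp.symm⟩)
    (Metric.ball_mem_nhds 0 hL0)
  refine ⟨fun x q t => g (m + 1) (x, q) t, fun x q => ⟨?_, fun t => ?_, fun t => ?_⟩, ?_⟩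
  · filter_upwards [Metric.ball_mem_nhds (0 : ℂ) hL0] with z hz
    rw [hg.start]
    have hx : 1 / (2 * L) * L < 1 := by field_simp; norm_num
    exact LevelOne.hasSum_seqSum ((hgeo m (x, q)).summable hL1 hL0.le hx)
      (mem_ball_zero_iff.1 hz).le
  · exact hg.analyticAt (m + 1) (x, q) t unitInterval.le_one'
  · have h := hg.locally_eq (m + 1) (x, q) t unitInterval.le_one'
    rwa [show Set.Iic (1 : unitInterval) = Set.univ from
      Set.eq_univ_of_forall fun _ => unitInterval.le_one', nhdsWithin_univ] at h
  · intro ζ₀ hζ₀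
    have hπ : Differentiable ℂ fun u => ω + Complex.exp u := by fun_prop
    have hπζ : (fun u => ω + Complex.exp u) ζ₀ = γ 1 := by
      simp [hζ₀]
    have hζr : ζ₀ ∈ LevelOne.logPlane r := by
      rw [LevelOne.mem_logPlane, hζ₀, mem_ball_zero_iff, ← dist_eq_norm]
      exact hξ₀
    obtain ⟨E, U, hU, hE⟩ := hg.sol
    rw [← hπζ] at hU hE
    obtain ⟨O, hO, hsolO⟩ := LevelOne.ConvSystem.IsSol.comp
      (π := fun u => ω + Complex.exp u) (u₀ := ζ₀) hE hU (LevelOne.isOpen_logPlane r) hζr hπ.differentiableOn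
    have hcomp := S.compatible hr
    obtain ⟨Φ, hΦ, hΦg⟩ := hsolO.extend hO (LevelOne.convex_logPlane hr0)
      -- No singular value is met on the half-plane: `exp u ≠ 0` excludes `ω`, and the disc contains
      -- no other point of `Ω`.
      (LevelOne.isOpen_logPlane r) hζr hπ.differentiableOn fun u hu p hp => by
        by_cases ha : S.convSystem.a p = ω
        · rw [ha] at hp
          simp at hp
        · exact hcomp.ne p ha _ (LevelOne.mapsTo_exp r hu) hp
    obtain ⟨R, hR⟩ := hΦ.exists_isDecomposition hcomp hr0 hζr (m + 1)
    choose K hK0 hK using S.exists_leadingTerm hr0 hζr hR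
    choose c hc hcR using hR.logClass
    refine ⟨fun x q => Φ (m + 1) (x, q), fun x q => ⟨hΦ.differentiableOn _ _, hΦg _ _⟩, K,
      fun k x q i => c (x, q) (some k) i, hK0, fun k x q i => ?_, fun j i q => ?_⟩
    · exact (hc (x, q) (some k) i).analyticAt (Metric.ball_mem_nhds 0 hr0)
    · refine ⟨c (⟨j, i⟩, q) none 0, (hc _ _ _).analyticAt (Metric.ball_mem_nhds 0 hr0), r, hr0,
        fun u hu => ?_⟩
      have h1 := hK j i q u hu
      have h2 := hcR (⟨j, i⟩, q) u hu
      rw [S.remainder_eq ω ⟨j, i⟩ q c u] at h2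
      linear_combination h1 + h2
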